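/- Proposition (Ehrenfest equation). Let $\mathfrak h_S$ and $\mathfrak f_B$ be complex Hilbert spaces and let $\mathfrak H_B=\Gamma(\mathfrak f_B)$ be the Bose Fock space over $\mathfrak f_B$, with vacuum vector $\mathrm{vac}$, annihilation and creation operators $\hat a(g),\hat a(g)^*$, and differential second quantization $d\Gamma$. Let $\hat H=\hat H^*$, $\hat L$ and $\hat X$ be bounded operators on $\mathfrak h_S$, let $\hat h_B$ be a (possibly unbounded) self-adjoint operator on $\mathfrak f_B$, and let $g\in\mathfrak f_B$. Put $\hat H_B=d\Gamma(\hat h_B)$, let $\hat H_0$ be the closure of $\hat I_S\otimes \hat H_B$, let $\hat H_{\mathrm{Tot}}$ be the closure of $$\hat H\otimes \hat I_B+\hat I_S\otimes \hat H_B+i\hat L\otimes \hat a(g)^*-i\hat L^*\otimes \hat a(g)$$ on the linear span of the product vectors $x\otimes\psi$ with $x\in\mathfrak h_S$ and $\psi$ in the domains of $\hat H_B$, $\hat a(g)^*$ and $\hat a(g)$, and set, for $t,s\in\mathbb R$, $$\hat U_t=e^{it\hat H_0}e^{-it\hat H_{\mathrm{Tot}}},\qquad j_t(\hat Y)=\hat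 U_t^*(\hat Y\otimes \hat I_B)\hat U_t\quad(\hat Y\in B(\mathfrak h_S)),\qquad K(t,s)=\langle e^{it\hat h_B}g\,|\,e^{is\hat h_B}g\rangle .$$ Fix $\phi\in\mathfrak h_S$ and write $\langle \hat T\rangle=\langle \phi\otimes\mathrm{vac}\,|\,\hat T\,(\phi\otimes\mathrm{vac})\rangle$ for bounded operators $\hat T$ on $\mathfrak h_S\otimes\mathfrak H_B$. Then for every $t\in\mathbb R$ the function $s\mapsto\langle j_s(\hat X)\rangle$ is differentiable at $t$, the two integrands below are integrable between $0$ and $t$, and $$\frac{d}{dt}\langle j_t(\hat X)\rangle=\Big\langle j_t\Big(\frac1i[\hat X,\hat H]\Big)\Big\rangle+\int_0^t K(t,\tau)\,\langle j_t([\hat L^*,\hat X])\,j_\tau(\hat L)\rangle\,d\tau+\int_0^t K(t,\tau)^*\,\langle j_\tau(\hat L^*)\,j_t([\hat X,\hat L])\rangle\,d\tau .$$ -/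

import Mathlib

open scoped TensorProduct ComplexConjugate

noncomputable section

namespace QBath

open UniformSpace (Completion)

/-! ### Algebraic tensor powers of a Hilbert space and their inner product -/

section TensorPowers

variable (F : Type*) [NormedAddCommGroup F] [InnerProductSpace ℂ F] (n : ℕ)

/-- The algebraic `n`-th tensor power `F ⊗ ⋯ ⊗ F` (a copy of Mathlib's tensor product of the
constant family, so that it can carry the Hilbert space inner product). -/
def AlgPow : Type _ := PiTensorProduct ℂ (fun _ : Fin n => F)

instance : AddCommGroup (AlgPow F n) :=
  inferInstanceAs (AddCommGroup (PiTensorProduct ℂ (fun _ : Fin n => F)))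

instance : Module ℂ (AlgPow F n) :=
  inferInstanceAs (Module ℂ (PiTensorProduct ℂ (fun _ : Fin n => F)))

/-- The algebraic dual of `AlgPow F n`, on which scalars act through complex conjugation. -/
def ConjDual : Type _ := AlgPow F n →ₗ[ℂ] ℂ

instance : AddCommGroup (ConjDual F n) := inferInstanceAs (AddCommGroup (AlgPow F n →ₗ[ℂ] ℂ))

instance : Module ℂ (ConjDual F n) :=
  Module.compHom (AlgPow F n →ₗ[ℂ] ℂ) (starRingEnd ℂ)

variable {F n}

/-- The elementary tensor `v 0 ⊗ ⋯ ⊗ v (n - 1)`. -/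
def algTensor (v : Fin n → F) : AlgPow F n := PiTensorProduct.tprod ℂ v

/-- The linear functional `w 0 ⊗ ⋯ ⊗ w (n - 1) ↦ ∏ i, ⟨v i, w i⟩`. -/
def pairing (v : Fin n → F) : AlgPow F n →ₗ[ℂ] ℂ :=
  PiTensorProduct.lift
    ((MultilinearMap.mkPiAlgebra ℂ (Fin n) ℂ).compLinearMap fun i => innerₛₗ ℂ (v i))

theorem pairing_algTensor (v w : Fin n → F) :
    pairing v (algTensor w) = ∏ i, inner ℂ (v i) (w i) := by
  unfold pairing algTensor
  erw [PiTensorProduct.lift.tprod]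
  simp

theorem algPow_hom_ext {f g : AlgPow F n →ₗ[ℂ] ℂ}
    (h : ∀ w : Fin n → F, f (algTensor w) = g (algTensor w)) : f = g :=
  PiTensorProduct.ext (MultilinearMap.ext h)

theorem prod_inner_update [DecidableEq (Fin n)] (v w : Fin n → F) (i : Fin n) (x : F) :
    ∏ j, inner ℂ (Function.update v i x j) (w j)
      = inner ℂ x (w i) * ∏ j ∈ Finset.univ.erase i, inner ℂ (v j) (w j) := by
  rw [← Finset.mul_prod_erase Finset.univ _ (Finset.mem_univ i), Function.update_self]
  congr 1
  refine Finset.prod_congr rfl fun j hj => ?_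
  rw [Function.update_of_ne (Finset.ne_of_mem_erase hj)]

/-- The sesquilinear form determined by `pairing`. -/
def innerForm (F : Type*) [NormedAddCommGroup F] [InnerProductSpace ℂ F] (n : ℕ) :
    AlgPow F n →ₗ[ℂ] ConjDual F n :=
  PiTensorProduct.lift
    { toFun := fun v => (pairing v : AlgPow F n →ₗ[ℂ] ℂ)
      map_update_add' := by
        intro _ v i x y
        refine algPow_hom_ext fun w => ?_
        refine (pairing_algTensor _ _).trans ?_
        refine Eq.trans ?_ (congrArg₂ (· + ·) (pairing_algTensor _ _) (pairing_algTensor _ _)).symm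
        simp only [prod_inner_update, inner_add_left, add_mul]
      map_update_smul' := by
        intro _ v i c x
        refine algPow_hom_ext fun w => ?_
        refine (pairing_algTensor _ _).trans ?_
        refine Eq.trans ?_ (congrArg (conj c * ·) (pairing_algTensor _ _)).symm
        simp only [prod_inner_update, inner_smul_left, mul_assoc] }

/-- The value of the sesquilinear form. -/
def innerVal (x y : AlgPow F n) : ℂ := (show AlgPow F n →ₗ[ℂ] ℂ from innerForm F n x) y

theorem innerVal_algTensor (v w : Fin n → F) :
    innerVal (algTensor v) (algTensor w) = ∏ i, inner ℂ (v i) (w i) := by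
  have h : innerForm F n (algTensor v) = pairing v := PiTensorProduct.lift.tprod v
  unfold innerVal
  rw [h]
  exact pairing_algTensor v w

theorem innerVal_add_left (x y z : AlgPow F n) :
    innerVal (x + y) z = innerVal x z + innerVal y z := by
  unfold innerVal
  rw [map_add]
  rfl

theorem innerVal_smul_left (c : ℂ) (x y : AlgPow F n) :
    innerVal (c • x) y = conj c * innerVal x y := by
  unfold innerVal
  rw [map_smul]
  rfl

theorem innerVal_add_right (x y z : AlgPow F n) :
    innerVal x (y + z) = innerVal x y + innerVal x z :=
  map_add (show AlgPow F n →ₗ[ℂ] ℂ from innerForm F n x) y z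

theorem innerVal_smul_right (c : ℂ) (x y : AlgPow F n) :
    innerVal x (c • y) = c * innerVal x y :=
  map_smul (show AlgPow F n →ₗ[ℂ] ℂ from innerForm F n x) c y

theorem innerVal_zero_left (y : AlgPow F n) : innerVal 0 y = 0 := by
  simpa using innerVal_smul_left (0 : ℂ) 0 y

theorem innerVal_zero_right (x : AlgPow F n) : innerVal x 0 = 0 := by
  simpa using innerVal_smul_right (0 : ℂ) x 0

theorem algPow_exists_finsupp (x : AlgPow F n) :
    ∃ (s : Finset (Fin n → F)) (c : (Fin n → F) → ℂ), x = ∑ v ∈ s, c v • algTensor v := by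
  have h : x ∈ Submodule.span ℂ (Set.range (algTensor : (Fin n → F) → AlgPow F n)) :=
    (PiTensorProduct.span_tprod_eq_top (R := ℂ) (s := fun _ : Fin n => F)).symm.le
      (Submodule.mem_top (x := x))
  obtain ⟨c, hc⟩ := Finsupp.mem_span_range_iff_exists_finsupp.mp h
  exact ⟨c.support, c, hc.symm⟩

theorem innerVal_sum_left (s : Finset (Fin n → F)) (c : (Fin n → F) → ℂ) (y : AlgPow F n) :
    innerVal (∑ v ∈ s, c v • algTensor v) y = ∑ v ∈ s, conj (c v) * innerVal (algTensor v) y := by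
  classical
  induction s using Finset.induction_on with
  | empty => simp [innerVal_zero_left]
  | insert a s ha ih =>
    rw [Finset.sum_insert ha, Finset.sum_insert ha, innerVal_add_left, ih, innerVal_smul_left]

theorem innerVal_sum_right (s : Finset (Fin n → F)) (c : (Fin n → F) → ℂ) (x : AlgPow F n) :
    innerVal x (∑ v ∈ s, c v • algTensor v) = ∑ v ∈ s, c v * innerVal x (algTensor v) := by
  classical
  induction s using Finset.induction_on with
  | empty => simp [innerVal_zero_right]
  | insert a s ha ih =>
    rw [Finset.sum_insert ha, Finset.sum_insert ha, innerVal_add_right, ih, innerVal_smul_right]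

theorem innerVal_conj_symm (x y : AlgPow F n) : conj (innerVal y x) = innerVal x y := by
  obtain ⟨s, c, rfl⟩ := algPow_exists_finsupp x
  obtain ⟨t, d, rfl⟩ := algPow_exists_finsupp y
  simp only [innerVal_sum_left, innerVal_sum_right, innerVal_algTensor,
    map_sum, map_mul, map_prod, inner_conj_symm, Complex.conj_conj, Finset.mul_sum]
  rw [Finset.sum_comm]
  refine Finset.sum_congr rfl fun v _ => Finset.sum_congr rfl fun w _ => ?_
  ring

open scoped ComplexOrder in
theorem prod_inner_posSemidef {𝕜 ι E : Type*} [RCLike 𝕜] [Finite ι] [NormedAddCommGroup E]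
    [InnerProductSpace 𝕜 E] {m : ℕ} (u : ι → Fin m → E) (s : Finset (Fin m)) :
    (Matrix.of fun a b : ι => ∏ i ∈ s, inner 𝕜 (u a i) (u b i)).PosSemidef := by
  classical
  induction s using Finset.induction_on with
  | empty =>
    have h := Matrix.posSemidef_gram (𝕜 := 𝕜) (fun _ : ι => (1 : 𝕜))
    convert h using 1
    ext a b
    simp [Matrix.gram]
  | insert j s hj ih =>
    have h := (Matrix.posSemidef_gram (𝕜 := 𝕜) (fun a : ι => u a j)).hadamard ih
    convert h using 1
    ext a b
    simp [Matrix.gram, Finset.prod_insert hj]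

theorem innerVal_self_nonneg (x : AlgPow F n) : 0 ≤ (innerVal x x).re := by
  obtain ⟨s, c, rfl⟩ := algPow_exists_finsupp x
  have h := (prod_inner_posSemidef (𝕜 := ℂ) (fun v : s => (v : Fin n → F))
    Finset.univ).re_dotProduct_nonneg (fun v => c v)
  refine le_of_le_of_eq h (congrArg Complex.re ?_)
  rw [innerVal_sum_left]
  simp only [innerVal_sum_right, innerVal_algTensor,
    Finset.mul_sum, Matrix.of_apply, dotProduct, Matrix.mulVec, Pi.star_apply]
  rw [← Finset.sum_coe_sort s]
  refine Finset.sum_congr rfl fun v _ => ?_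
  rw [← Finset.sum_coe_sort s]
  refine Finset.sum_congr rfl fun w _ => ?_
  simp only [RCLike.star_def]
  ring

instance instCore (F : Type*) [NormedAddCommGroup F] [InnerProductSpace ℂ F] (n : ℕ) :
    PreInnerProductSpace.Core ℂ (AlgPow F n) where
  inner := innerVal
  conj_inner_symm := innerVal_conj_symm
  re_inner_nonneg := innerVal_self_nonneg
  add_left := innerVal_add_left
  smul_left x y c := innerVal_smul_left c x y

instance : SeminormedAddCommGroup (AlgPow F n) :=
  InnerProductSpace.Core.toSeminormedAddCommGroup (𝕜 := ℂ)

instance : InnerProductSpace ℂ (AlgPow F n) := .ofCore _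

theorem inner_algTensor (v w : Fin n → F) :
    inner ℂ (algTensor v) (algTensor w) = ∏ i, inner ℂ (v i) (w i) :=
  innerVal_algTensor v w

end TensorPowers

/-! ### The symmetric Fock space -/

section Fock

variable (F : Type*) [NormedAddCommGroup F] [InnerProductSpace ℂ F]

/-- The Hilbert space tensor power `F ⊗ ⋯ ⊗ F` (`n` factors). -/
def TensorPow (n : ℕ) : Type _ := Completion (AlgPow F n)

instance (n : ℕ) : NormedAddCommGroup (TensorPow F n) :=
  inferInstanceAs (NormedAddCommGroup (Completion (AlgPow F n)))

instance (n : ℕ) : InnerProductSpace ℂ (TensorPow F n) :=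
  inferInstanceAs (InnerProductSpace ℂ (Completion (AlgPow F n)))

instance (n : ℕ) : CompleteSpace (TensorPow F n) :=
  inferInstanceAs (CompleteSpace (Completion (AlgPow F n)))

variable {F}

/-- The elementary tensor `v 0 ⊗ ⋯ ⊗ v (n - 1)` in the Hilbert space tensor power. -/
def elemTensor {n : ℕ} (v : Fin n → F) : TensorPow F n :=
  ((algTensor v : AlgPow F n) : Completion (AlgPow F n))

theorem inner_elemTensor {n : ℕ} (v w : Fin n → F) :
    inner ℂ (elemTensor v) (elemTensor w) = ∏ i, inner ℂ (v i) (w i) :=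
  (Completion.inner_coe (𝕜 := ℂ) (algTensor v) (algTensor w)).trans (inner_algTensor v w)

/-- The symmetrization `(1 / n!) ∑ σ, v (σ 0) ⊗ ⋯ ⊗ v (σ (n - 1))` of an elementary tensor. -/
def symmetrize {n : ℕ} (v : Fin n → F) : TensorPow F n :=
  ((n.factorial : ℂ)⁻¹) • ∑ σ : Equiv.Perm (Fin n), elemTensor (v ∘ σ)

variable (F) in
/-- The symmetrized `n`-fold Hilbert space tensor power: the closed span of all symmetrized
elementary tensors. -/
def SymPow (n : ℕ) : Submodule ℂ (TensorPow F n) :=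
  (Submodule.span ℂ (Set.range (symmetrize : (Fin n → F) → TensorPow F n))).topologicalClosure

variable (F) in
/-- The (Bose) Fock space `Γ(F)`: the Hilbert space direct sum of all symmetrized tensor powers. -/
abbrev Fock : Type _ := lp (fun n : ℕ => SymPow F n) 2

/-- The symmetrized elementary tensor `v 0 ∨ ⋯ ∨ v (n - 1)`, as a vector in the Fock space. -/
def symVec {n : ℕ} (v : Fin n → F) : Fock F :=
  lp.single 2 n ⟨symmetrize v, Submodule.le_topologicalClosure _ (Submodule.subset_span ⟨v, rfl⟩)⟩

variable (F) in
/-- The Fock vacuum. -/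
def vac : Fock F := symVec (Fin.elim0 : Fin 0 → F)

/-- The (closed) annihilation operator `a(g)`, antilinear in `g`:
`a(g) vac = 0` and
`a(g) (v 0 ∨ ⋯ ∨ v n) = (n + 1)^(-1/2) ∑ k, ⟨g, v k⟩ v 0 ∨ ⋯ (omit v k) ⋯ ∨ v n`. -/
def annihilation (g : F) : Fock F →ₗ.[ℂ] Fock F :=
  (Submodule.span ℂ ({(vac F, 0)} ∪
    {p : Fock F × Fock F | ∃ (n : ℕ) (v : Fin (n + 1) → F),
      p = (symVec v, ((Real.sqrt (n + 1) : ℂ)⁻¹) •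
        ∑ k, inner ℂ g (v k) • symVec (k.removeNth v))})).topologicalClosure.toLinearPMap

instance (n : ℕ) : CompleteSpace (SymPow F n) :=
  (Submodule.isClosed_topologicalClosure _).completeSpace_coe

instance : CompleteSpace (Fock F) := inferInstance

/-- The creation operator `a(g)^*`, the Hilbert space adjoint of the annihilation operator. -/
def creation (g : F) : Fock F →ₗ.[ℂ] Fock F := (annihilation g).adjoint

/-- The (closed) differential second quantization `dΓ(h)` of an operator `h` on `F`:
`dΓ(h) (v 0 ∨ ⋯ ∨ v (n - 1)) = ∑ k, v 0 ∨ ⋯ ∨ h (v k) ∨ ⋯ ∨ v (n - 1)` for all `v k` in the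
domain of `h`. In particular `dΓ(h) vac = 0`. -/
def dGamma (h : F →ₗ.[ℂ] F) : Fock F →ₗ.[ℂ] Fock F :=
  (Submodule.span ℂ {p : Fock F × Fock F | ∃ (n : ℕ) (v : Fin n → h.domain),
      p = (symVec fun k => (v k : F),
        ∑ k, symVec (Function.update (fun l => (v l : F)) k (h (v k))))}
    ).topologicalClosure.toLinearPMap

end Fock

/-! ### Unitary groups -/

section Groups

variable {E : Type*} [NormedAddCommGroup E] [InnerProductSpace ℂ E]

/-- `V` is the strongly continuous one-parameter unitary group `t ↦ e^{-itA}`: a strongly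
continuous group of isometries, hence of unitaries, such that `x` lies in the domain of `A`, with
`A x = y`, exactly when `t ↦ V t x` has derivative `-i y` at `0`. -/
structure IsUnitaryGroup (A : E →ₗ.[ℂ] E) (V : ℝ → E →L[ℂ] E) : Prop where
  map_zero : V 0 = 1
  map_add : ∀ s t, V (s + t) = V s * V t
  norm_map : ∀ t x, ‖V t x‖ = ‖x‖
  strongly_continuous : ∀ x, Continuous fun t => V t x
  generator : ∀ x y, (x, y) ∈ A.graph ↔ HasDerivAt (fun t => V t x) (-Complex.I • y) 0

open Classical in
/-- The unitary group `unitaryGroup A t = e^{-itA}`. By Stone's theorem it exists and is unique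
for every self-adjoint `A` (the value `1` is used for operators that generate no such group). -/
def unitaryGroup (A : E →ₗ.[ℂ] E) : ℝ → E →L[ℂ] E :=
  if h : ∃ V, IsUnitaryGroup A V then h.choose else fun _ => 1

end Groups

/-! ### The system coupled to the bath -/

section Model

variable (S F : Type*) [NormedAddCommGroup S] [InnerProductSpace ℂ S]
  [NormedAddCommGroup F] [InnerProductSpace ℂ F]

/-- The Hilbert space tensor product of the system space `S` and the Fock space of the bath. -/
def SysBath : Type _ := Completion (S ⊗[ℂ] Fock F)

instance : NormedAddCommGroup (SysBath S F) :=
  inferInstanceAs (NormedAddCommGroup (Completion (S ⊗[ℂ] Fock F)))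

instance : InnerProductSpace ℂ (SysBath S F) :=
  inferInstanceAs (InnerProductSpace ℂ (Completion (S ⊗[ℂ] Fock F)))

instance : CompleteSpace (SysBath S F) :=
  inferInstanceAs (CompleteSpace (Completion (S ⊗[ℂ] Fock F)))

variable {S F}

/-- The product vector `x ⊗ ψ`. -/
def tens (x : S) (ψ : Fock F) : SysBath S F :=
  ((x ⊗ₜ[ℂ] ψ : S ⊗[ℂ] Fock F) : Completion (S ⊗[ℂ] Fock F))

variable (F) in
/-- The bounded operator `X ⊗ I_B` for a bounded system operator `X`. -/
def ampliation (X : S →L[ℂ] S) : SysBath S F →L[ℂ] SysBath S F :=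
  (show Completion (S ⊗[ℂ] Fock F) →L[ℂ] Completion (S ⊗[ℂ] Fock F) from
    (X.rTensor (Fock F)).completion)

theorem ampliation_tens (X : S →L[ℂ] S) (x : S) (ψ : Fock F) :
    ampliation F X (tens x ψ) = tens (X x) ψ :=
  ContinuousLinearMap.completion_apply_coe (X.rTensor (Fock F)) (x ⊗ₜ[ℂ] ψ)

theorem inner_tens (x y : S) (ψ η : Fock F) :
    inner ℂ (tens x ψ) (tens y η) = inner ℂ x y * inner ℂ ψ η :=
  Completion.inner_coe (𝕜 := ℂ) (x ⊗ₜ[ℂ] ψ) (y ⊗ₜ[ℂ] η)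

variable (S) in
/-- The free Hamiltonian `H₀ = I_S ⊗ dΓ(h)`: the closure of the operator `x ⊗ ψ ↦ x ⊗ dΓ(h) ψ` on
the span of the product vectors. -/
def freeHamiltonian (h : F →ₗ.[ℂ] F) : SysBath S F →ₗ.[ℂ] SysBath S F :=
  (Submodule.span ℂ {p : SysBath S F × SysBath S F | ∃ (x : S) (ψ η : Fock F),
      (ψ, η) ∈ (dGamma h).graph ∧ p = (tens x ψ, tens x η)}
    ).topologicalClosure.toLinearPMap

variable [CompleteSpace S]

/-- The total Hamiltonian
`H ⊗ I_B + I_S ⊗ dΓ(h) + i L ⊗ a(g)^* - i L^* ⊗ a(g)`: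
the closure of the sum on the span of the product vectors `x ⊗ ψ` for which `ψ` lies in the
domains of `dΓ(h)`, `a(g)^*` and `a(g)`. -/
def totalHamiltonian (H L : S →L[ℂ] S) (h : F →ₗ.[ℂ] F) (g : F) :
    SysBath S F →ₗ.[ℂ] SysBath S F :=
  (Submodule.span ℂ {p : SysBath S F × SysBath S F | ∃ (x : S) (ψ η α β : Fock F),
      (ψ, η) ∈ (dGamma h).graph ∧ (ψ, α) ∈ (creation g).graph ∧ (ψ, β) ∈ (annihilation g).graph ∧
      p = (tens x ψ, tens (H x) ψ + tens x η + Complex.I • tens (L x) α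
        - Complex.I • tens (ContinuousLinearMap.adjoint L x) β)}
    ).topologicalClosure.toLinearPMap

/-- The interaction picture evolution `U t = e^{itH₀} e^{-itH_Tot}`. -/
def evolution (H L : S →L[ℂ] S) (h : F →ₗ.[ℂ] F) (g : F) (t : ℝ) :
    SysBath S F →L[ℂ] SysBath S F :=
  unitaryGroup (freeHamiltonian S h) (-t) * unitaryGroup (totalHamiltonian H L h g) t

/-- `j t X = (U t)^* (X ⊗ I_B) (U t)`. -/
def flow (H L : S →L[ℂ] S) (h : F →ₗ.[ℂ] F) (g : F) (t : ℝ) (X : S →L[ℂ] S) :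
    SysBath S F →L[ℂ] SysBath S F :=
  ContinuousLinearMap.adjoint (evolution H L h g t) * ampliation F X * evolution H L h g t

/-- The bath correlation function `K(t, s) = ⟨g_t, g_s⟩`, where `g_t = e^{ith} g`. -/
def bathKernel (h : F →ₗ.[ℂ] F) (g : F) (t s : ℝ) : ℂ :=
  inner ℂ (unitaryGroup h (-t) g) (unitaryGroup h (-s) g)

/-- The expectation `⟨T⟩ = ⟨φ ⊗ vac, T (φ ⊗ vac)⟩`. -/
def expect (φ : S) (T : SysBath S F →L[ℂ] SysBath S F) : ℂ :=
  inner ℂ (tens φ (vac F)) (T (tens φ (vac F)))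

end Model

end QBath

end

open scoped TensorProduct ComplexConjugate

noncomputable section

namespace QBath

/-! ### One-parameter unitary groups and their generators -/

section Flows

open Filter Topology

variable {E : Type*} [NormedAddCommGroup E] [InnerProductSpace ℂ E]

/-! Write `V t`, `G t`, `W t` for `e^{-ith}`, `e^{-itH₀}`, `e^{-itH_Tot}`. Since `G` commutes with
`X ⊗ I`, `j_t(X) = W(-t) (X ⊗ I) W(t)`. Formally its derivative is `j_t([X,H]/i)` plus `j_t([L*,X])
W(-t) a(g) W(t)` plus `W(-t) a(g)* W(t) j_t([X,L])`. The canonical commutation relations give a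
Duhamel formula: `W(-t) a(V_t f) W(t) = a(f) + ∫₀ᵗ ⟨V_τ f, g⟩ j_τ(L) dτ`. Take `f = V(-t) g`: then
`V_t f = g`, the kernel is `K(t,τ)`, and `a(f)` kills the vacuum. Substituting this, and its
adjoint, into the derivative gives the equation.

The difficulty is that `a(g)` is unbounded and that `W(t)` is not known to preserve its domain.
Everything is therefore done between spaces of fixed particle number, with projections `P_n`, where
`a(g)` and `a(g)*` are bounded. If `x` is in the domain of `H_Tot`, then `P_n x` is in the domain of
`H₀`, and the two operators differ there by a bounded one (`proj_mem_of_mem_totalCore`). Hence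
`G(-τ) P_n W(τ) η` is differentiable for every vector `η` (`hasDerivAt_proj`).

Each formal identity then holds in sector `n` up to a difference of fluxes through neighbouring
particle numbers (`inner_drift`, `commutator_sector`). Summed over `n ≤ m`, the fluxes telescope to
one boundary term, bounded by `(m + 1) a_m` with `a` summable by Cauchy–Schwarz. The harmonic series
diverges, so `(m + 1) a_m` tends to `0` along a subsequence (`exists_tendsto_mul_of_summable`), and
all limits are taken along a common one (`hasDerivAt_inner`).

The same device proves that `H_Tot` is essentially self-adjoint (`essSelfAdjoint_of_interaction`):
for a deficiency vector `ξ`, the sum of `‖P_n ξ‖²` over `n ≤ m` is a boundary flux. Stone's theorem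
(`exists_isUnitaryGroup`) then makes `W` exist. The free group is constructed by second quantization
and identified by an invariant core (`IsFlow.essSelfAdjoint`). -/

/-- A strongly continuous one-parameter group of isometries. -/
structure IsFlow (V : ℝ → E →L[ℂ] E) : Prop where
  map_zero : V 0 = 1
  map_add : ∀ s t, V (s + t) = V s * V t
  norm_map : ∀ t x, ‖V t x‖ = ‖x‖
  strongly_continuous : ∀ x, Continuous fun t => V t x

/-- The graph of the generator `A` of `V t = e^{-itA}`. -/
def genGraph (V : ℝ → E →L[ℂ] E) : Submodule ℂ (E × E) where
  carrier := {p | HasDerivAt (fun t => V t p.1) (-Complex.I • p.2) 0}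
  add_mem' {p q} hp hq := by
    simp only [Set.mem_ofPred_eq] at hp hq ⊢
    simpa only [Prod.fst_add, Prod.snd_add, map_add, smul_add] using hp.fun_add hq
  zero_mem' := by
    simpa using hasDerivAt_const (0 : ℝ) (0 : E)
  smul_mem' c p hp := by
    simp only [Set.mem_ofPred_eq] at hp ⊢
    simpa only [Prod.smul_fst, Prod.smul_snd, map_smul, smul_comm c] using hp.fun_const_smul c

theorem mem_genGraph {V : ℝ → E →L[ℂ] E} {p : E × E} :
    p ∈ genGraph V ↔ HasDerivAt (fun t => V t p.1) (-Complex.I • p.2) 0 := Iff.rfl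

theorem IsUnitaryGroup.isFlow {A : E →ₗ.[ℂ] E} {V : ℝ → E →L[ℂ] E} (h : IsUnitaryGroup A V) :
    IsFlow V := ⟨h.map_zero, h.map_add, h.norm_map, h.strongly_continuous⟩

theorem IsUnitaryGroup.graph_eq {A : E →ₗ.[ℂ] E} {V : ℝ → E →L[ℂ] E} (h : IsUnitaryGroup A V) :
    A.graph = genGraph V := by
  ext ⟨x, y⟩
  exact h.generator x y

theorem IsFlow.isUnitaryGroup {A : E →ₗ.[ℂ] E} {V : ℝ → E →L[ℂ] E} (h : IsFlow V)
    (hA : A.graph = genGraph V) : IsUnitaryGroup A V :=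
  ⟨h.map_zero, h.map_add, h.norm_map, h.strongly_continuous, fun x y => by rw [hA]; exact Iff.rfl⟩

theorem mem_genGraph_neg {V : ℝ → E →L[ℂ] E} {x y : E} (h : (x, y) ∈ genGraph V) :
    (x, -y) ∈ genGraph fun t => V (-t) := by
  rw [mem_genGraph] at h ⊢
  have h0 : HasDerivAt (fun s => V s x) (-Complex.I • y) (-0) := by rwa [neg_zero]
  simpa [Function.comp_def] using h0.scomp (0 : ℝ) (hasDerivAt_neg 0)

namespace IsFlow

variable {V : ℝ → E →L[ℂ] E} (hV : IsFlow V)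
include hV

theorem inner_map (t : ℝ) (x y : E) : inner ℂ (V t x) (V t y) = inner ℂ x y :=
  LinearIsometry.inner_map_map (⟨(V t).toLinearMap, hV.norm_map t⟩ : E →ₗᵢ[ℂ] E) x y

theorem apply_add (s t : ℝ) (x : E) : V (s + t) x = V s (V t x) := by
  rw [hV.map_add]; rfl

theorem neg_apply (t : ℝ) (x : E) : V (-t) (V t x) = x := by
  rw [← hV.apply_add, neg_add_cancel, hV.map_zero]; rfl

theorem apply_neg (t : ℝ) (x : E) : V t (V (-t) x) = x := by
  rw [← hV.apply_add, add_neg_cancel, hV.map_zero]; rfl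

theorem inner_neg_left (t : ℝ) (x y : E) : inner ℂ (V (-t) x) y = inner ℂ x (V t y) := by
  rw [← hV.inner_map t, hV.apply_neg]

theorem inner_neg_right (t : ℝ) (x y : E) : inner ℂ x (V (-t) y) = inner ℂ (V t x) y := by
  rw [← hV.inner_map t, hV.apply_neg]

theorem neg : IsFlow fun t => V (-t) where
  map_zero := by simp [hV.map_zero]
  map_add s t := by rw [neg_add, hV.map_add]
  norm_map t x := hV.norm_map _ x
  strongly_continuous x := (hV.strongly_continuous x).comp continuous_neg

/-- Strong continuity becomes joint continuity because the error in the vector is transported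
isometrically. -/
theorem tendsto_apply {ι : Type*} {l : Filter ι} {c : ι → ℝ} {u : ι → E} {c₀ : ℝ} {u₀ : E}
    (hc : Tendsto c l (𝓝 c₀)) (hu : Tendsto u l (𝓝 u₀)) :
    Tendsto (fun i => V (c i) (u i)) l (𝓝 (V c₀ u₀)) := by
  have h1 : Tendsto (fun i => V (c i) u₀) l (𝓝 (V c₀ u₀)) :=
    ((hV.strongly_continuous u₀).tendsto c₀).comp hc
  have h2 : Tendsto (fun i => V (c i) (u i - u₀)) l (𝓝 0) := by
    rw [tendsto_zero_iff_norm_tendsto_zero]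
    simp only [hV.norm_map]
    simpa using (hu.sub_const u₀).norm
  simpa using h2.add h1

theorem continuous_apply {ι : Type*} [TopologicalSpace ι] {c : ι → ℝ} {u : ι → E}
    (hc : Continuous c) (hu : Continuous u) : Continuous fun i => V (c i) (u i) :=
  continuous_iff_continuousAt.2 fun i => hV.tendsto_apply (hc.tendsto i) (hu.tendsto i)

theorem hasDerivAt {p : E × E} (hp : p ∈ genGraph V) (t : ℝ) :
    HasDerivAt (fun s => V s p.1) (-Complex.I • V t p.2) t := by
  have h0 : HasDerivAt (fun s => V s p.1) (-Complex.I • p.2) (t - t) := by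
    rw [sub_self]; exact hp
  have h1 := ((V t).restrictScalars ℝ).hasFDerivAt.comp_hasDerivAt t
    (h0.comp_sub_const t t)
  refine (h1.congr_deriv ?_).congr_of_eventuallyEq (Eventually.of_forall fun s => ?_)
  · exact map_smul (V t) _ _
  · change V s p.1 = V t (V (s - t) p.1)
    rw [← hV.apply_add, add_sub_cancel]

/-- A product rule for a group that is not norm differentiable. In `V s (u s) = V s (u s - u t) + V
s (u t)` the first term needs only joint continuity, so only the single vector `u t` has to lie in
the domain of the generator. -/
theorem hasDerivAt_apply {u : ℝ → E} {u' y : E} {t : ℝ} (hu : HasDerivAt u u' t)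
    (hy : (u t, y) ∈ genGraph V) :
    HasDerivAt (fun s => V s (u s)) (V t u' + -Complex.I • V t y) t := by
  have h1 := hV.hasDerivAt hy t
  have h2 : HasDerivAt (fun s => V s (u s - u t)) (V t u') t := by
    rw [hasDerivAt_iff_tendsto_slope] at hu ⊢
    refine (hV.tendsto_apply (tendsto_id.mono_left nhdsWithin_le_nhds) hu).congr fun s => ?_
    rw [slope_def_module, slope_def_module, sub_self, _root_.map_zero, sub_zero]
    exact map_smul ((V s).restrictScalars ℝ) _ _
  refine (h2.fun_add h1).congr_of_eventuallyEq (Eventually.of_forall fun s => ?_)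
  simp

/-- Differentiate the constant function `t ↦ ⟨V t p.1, V t q.1⟩` at `0`. -/
theorem genGraph_symm {p q : E × E} (hp : p ∈ genGraph V) (hq : q ∈ genGraph V) :
    inner ℂ p.2 q.1 = inner ℂ p.1 q.2 := by
  have h := HasDerivAt.inner ℂ (mem_genGraph.1 hp) (mem_genGraph.1 hq)
  simp only [hV.inner_map, hV.map_zero] at h
  have h2 := h.unique (hasDerivAt_const _ _)
  simp only [one_apply_eq_self, inner_smul_left, inner_smul_right, map_neg,
    Complex.conj_I, neg_neg] at h2
  have h3 : Complex.I * (inner ℂ p.2 q.1 - inner ℂ p.1 q.2) = 0 := by rw [← h2]; ring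
  simpa [sub_eq_zero] using h3

/-- Along a convergent sequence in the graph the derivatives of the orbits converge uniformly in
time, since `V` is isometric; so differentiation commutes with the limit. -/
theorem isClosed_genGraph : IsClosed (genGraph V : Set (E × E)) := by
  refine IsSeqClosed.isClosed fun u p hu hup => ?_
  have h1 : Tendsto (fun n => (u n).1) atTop (𝓝 p.1) := (continuous_fst.tendsto p).comp hup
  have h2 : Tendsto (fun n => (u n).2) atTop (𝓝 p.2) := (continuous_snd.tendsto p).comp hup
  have key := hasDerivAt_of_tendstoUniformly (l := atTop) (f := fun n t => V t (u n).1)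
    (f' := fun n t => -Complex.I • V t (u n).2) (g := fun t => V t p.1)
    (g' := fun t => -Complex.I • V t p.2) ?_ (Eventually.of_forall fun n t => hV.hasDerivAt (hu n) t)
    (fun t => ((V t).continuous.tendsto _).comp h1)
  · simpa [hV.map_zero, mem_genGraph] using key 0
  · rw [Metric.tendstoUniformly_iff]
    intro ε hε
    filter_upwards [Metric.tendsto_nhds.1 h2 ε hε] with n hn t
    rw [dist_eq_norm, ← smul_sub, ← map_sub, norm_smul, hV.norm_map, ← dist_eq_norm, dist_comm]
    simpa using hn

end IsFlow

end Flows

/-! ### Essential self-adjointness -/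

section EssSelfAdjoint

open Filter Topology

variable {E : Type*} [NormedAddCommGroup E] [InnerProductSpace ℂ E]

/-- The graph of an essentially self-adjoint operator: symmetric and densely defined, and the
ranges of `A - i s` are dense for all real `s ≠ 0`. -/
structure EssSelfAdjoint (G : Submodule ℂ (E × E)) : Prop where
  symm : ∀ p ∈ G, ∀ q ∈ G, inner ℂ p.2 q.1 = inner ℂ p.1 q.2
  dense : ∀ ξ : E, (∀ p ∈ G, inner ℂ ξ p.1 = 0) → ξ = 0
  range_dense : ∀ s : ℝ, s ≠ 0 → ∀ ξ : E,
    (∀ p ∈ G, inner ℂ ξ (p.2 - (s * Complex.I : ℂ) • p.1) = 0) → ξ = 0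

namespace EssSelfAdjoint

variable {G : Submodule ℂ (E × E)}

theorem closure (hG : EssSelfAdjoint G) : EssSelfAdjoint G.topologicalClosure where
  symm := by
    have h1 : ∀ p ∈ G, ∀ q ∈ G.topologicalClosure, inner ℂ p.2 q.1 = inner ℂ p.1 q.2 := by
      intro p hp q hq
      refine closure_minimal (s := (G : Set (E × E)))
        (t := {q | inner ℂ p.2 q.1 = inner ℂ p.1 q.2}) (fun q hq => hG.symm p hp q hq)
        (isClosed_eq (by fun_prop) (by fun_prop)) hq
    intro p hp q hq
    refine closure_minimal (s := (G : Set (E × E)))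
      (t := {p | inner ℂ p.2 q.1 = inner ℂ p.1 q.2}) (fun p hp => h1 p hp q hq)
      (isClosed_eq (by fun_prop) (by fun_prop)) hp
  dense ξ h := hG.dense ξ fun p hp => h p (G.le_topologicalClosure hp)
  range_dense s hs ξ h := hG.range_dense s hs ξ fun p hp => h p (G.le_topologicalClosure hp)

/-- Symmetry makes `y` orthogonal to the dense domain whenever `(0, y) ∈ G`, so the relation is
single-valued. Without this, `toLinearPMap` would not return the intended operator. -/
theorem graph_toLinearPMap (hG : EssSelfAdjoint G) : G.toLinearPMap.graph = G := by
  refine Submodule.toLinearPMap_graph_eq G fun p hp h0 => hG.dense _ fun q hq => ?_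
  rw [hG.symm p hp q hq, h0, inner_zero_left]

theorem inner_real (hG : EssSelfAdjoint G) {p : E × E} (hp : p ∈ G) :
    (inner ℂ p.1 p.2).im = 0 := by
  have h1 := hG.symm p hp p hp
  rw [← inner_conj_symm, Complex.conj_eq_iff_im] at h1
  exact h1

/-- The cross term vanishes because `⟨p.1, p.2⟩` is real. Both lower bounds for `A - is` follow. -/
theorem norm_sq (hG : EssSelfAdjoint G) {p : E × E} (hp : p ∈ G) (s : ℝ) :
    ‖p.2 - (s * Complex.I : ℂ) • p.1‖ ^ 2 = ‖p.2‖ ^ 2 + s ^ 2 * ‖p.1‖ ^ 2 := by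
  have h1 := hG.inner_real hp
  rw [← inner_conj_symm, Complex.conj_im, neg_eq_zero] at h1
  rw [@norm_sub_sq ℂ, inner_smul_right, norm_smul]
  simp [h1, mul_pow]

theorem norm_le (hG : EssSelfAdjoint G) {p : E × E} (hp : p ∈ G) (s : ℝ) :
    |s| * ‖p.1‖ ≤ ‖p.2 - (s * Complex.I : ℂ) • p.1‖ := by
  have := hG.norm_sq hp s
  refine le_of_sq_le_sq ?_ (norm_nonneg _)
  rw [this, mul_pow, sq_abs]
  nlinarith [sq_nonneg ‖p.2‖]

theorem norm_snd_le (hG : EssSelfAdjoint G) {p : E × E} (hp : p ∈ G) (s : ℝ) :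
    ‖p.2‖ ≤ ‖p.2 - (s * Complex.I : ℂ) • p.1‖ := by
  have := hG.norm_sq hp s
  refine le_of_sq_le_sq ?_ (norm_nonneg _)
  rw [this]
  nlinarith [mul_nonneg (sq_nonneg s) (sq_nonneg ‖p.1‖)]

/-- On a closed graph `A - is` is bounded below in the graph norm, so its range is closed; being
also dense, it is everything. -/
theorem exists_sub_eq [CompleteSpace E] (hG : EssSelfAdjoint G) (hc : IsClosed (G : Set (E × E)))
    {s : ℝ} (hs : s ≠ 0) (z : E) : ∃ p ∈ G, p.2 - (s * Complex.I : ℂ) • p.1 = z := by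
  let T : G →L[ℂ] E := (ContinuousLinearMap.snd ℂ E E -
    (s * Complex.I : ℂ) • ContinuousLinearMap.fst ℂ E E).comp G.subtypeL
  have hT : ∀ p : G, T p = p.1.2 - (s * Complex.I : ℂ) • p.1.1 := fun p => rfl
  have : CompleteSpace G := hc.completeSpace_coe
  have hcl : IsClosed (Set.range T) := by
    obtain ⟨K, hK⟩ : ∃ K, AntilipschitzWith K T := by
      refine ⟨⟨max |s|⁻¹ 1, by positivity⟩, AddMonoidHomClass.antilipschitz_of_bound T ?_⟩
      intro p
      change ‖(p : E × E)‖ ≤ max |s|⁻¹ 1 * ‖T p‖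
      rw [hT, Prod.norm_def, max_le_iff]
      constructor
      · refine le_trans ?_ (mul_le_mul_of_nonneg_right (le_max_left _ _) (norm_nonneg _))
        rw [inv_mul_eq_div, le_div_iff₀ (abs_pos.2 hs), mul_comm]
        exact hG.norm_le p.2 s
      · refine le_trans ?_ (mul_le_mul_of_nonneg_right (le_max_right _ _) (norm_nonneg _))
        rw [one_mul]
        exact hG.norm_snd_le p.2 s
    exact hK.isClosed_range T.uniformContinuous
  have hd : T.toLinearMap.range.topologicalClosure = ⊤ := by
    rw [Submodule.topologicalClosure_eq_top_iff, Submodule.eq_bot_iff]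
    intro ξ hξ
    refine hG.range_dense s hs ξ fun p hp => ?_
    rw [Submodule.mem_orthogonal'] at hξ
    exact hξ _ ⟨⟨p, hp⟩, rfl⟩
  have hz : z ∈ T.toLinearMap.range.topologicalClosure := by rw [hd]; trivial
  have hz2 : z ∈ _root_.closure (Set.range T) := hz
  rw [hcl.closure_eq] at hz2
  obtain ⟨p, hp⟩ := hz2
  exact ⟨p, p.2, hp⟩

/-- The adjoint is contained in the closure: solve `(A - i) q = η - iξ` in the closure; then `ξ - q`
is orthogonal to the range of `A + i`, hence zero. -/
theorem adjoint_mem [CompleteSpace E] (hG : EssSelfAdjoint G) {ξ η : E}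
    (h : ∀ p ∈ G, inner ℂ ξ p.2 = inner ℂ η p.1) : (ξ, η) ∈ G.topologicalClosure := by
  obtain ⟨q, hq, hqz⟩ := hG.closure.exists_sub_eq G.isClosed_topologicalClosure one_ne_zero
    (η - Complex.I • ξ)
  have hq1 : ξ - q.1 = 0 := by
    refine hG.range_dense (-1) (by norm_num) _ fun p hp => ?_
    have h1 := h p hp
    have h2 := hG.closure.symm q hq p (G.le_topologicalClosure hp)
    have h3 : q.2 = η - Complex.I • ξ + Complex.I • q.1 := by
      rw [← hqz]; simp
    rw [h3] at h2
    simp only [inner_sub_left, inner_sub_right, inner_add_left, inner_smul_left, inner_smul_right,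
      Complex.conj_I] at h2 ⊢
    push_cast
    linear_combination h1 + h2
  have h3 : q.2 = η := by
    have h3 : q.2 = η - Complex.I • ξ + Complex.I • q.1 := by rw [← hqz]; simp
    rw [h3, ← sub_eq_zero.1 hq1]; simp
  have : (ξ, η) = q := Prod.ext (sub_eq_zero.1 hq1) h3.symm
  rwa [this]

/-- A self-adjoint operator has no proper symmetric extension. -/
theorem eq_of_le [CompleteSpace E] (hG : EssSelfAdjoint G) (hc : IsClosed (G : Set (E × E)))
    {G' : Submodule ℂ (E × E)} (hle : G ≤ G')
    (hsymm : ∀ p ∈ G', ∀ q ∈ G', inner ℂ p.2 q.1 = inner ℂ p.1 q.2) : G' = G := by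
  refine le_antisymm (fun p hp => ?_) hle
  have := hG.adjoint_mem (ξ := p.1) (η := p.2) fun q hq => (hsymm p hp q (hle hq)).symm
  rwa [hc.submodule_topologicalClosure_eq] at this

end EssSelfAdjoint

/-- A densely defined invariant restriction of the generator of a unitary group is essentially
self-adjoint. -/
theorem IsFlow.essSelfAdjoint {V : ℝ → E →L[ℂ] E} (hV : IsFlow V) {G : Submodule ℂ (E × E)}
    (hle : G ≤ genGraph V) (hd : ∀ ξ : E, (∀ p ∈ G, inner ℂ ξ p.1 = 0) → ξ = 0)
    (hinv : ∀ p ∈ G, ∀ t, (V t p.1, V t p.2) ∈ G) : EssSelfAdjoint G where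
  symm p hp q hq := hV.genGraph_symm (hle hp) (hle hq)
  dense := hd
  range_dense s hs ξ h := by
    refine hd ξ fun p hp => ?_
    -- By invariance of `G` the orthogonality relation may be used at `V t p` for every `t`. It
    -- reads `⟨ξ, V t p.1⟩' = s ⟨ξ, V t p.1⟩`, so the factor `e^{-st}` makes the product constant.
    have hder : ∀ t : ℝ, HasDerivAt
        (fun t : ℝ => Complex.exp (-(s * t : ℝ)) * inner ℂ ξ (V t p.1)) 0 t := by
      intro t
      have h1 := HasDerivAt.inner ℂ (hasDerivAt_const t ξ) (hV.hasDerivAt (hle hp) t)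
      have h2 : HasDerivAt (fun t : ℝ => Complex.exp (-(s * t : ℝ)))
          (Complex.exp (-(s * t : ℝ)) * (-s)) t := by
        have h3 : HasDerivAt (fun t : ℝ => -((s * t : ℝ) : ℂ)) (-(s : ℂ)) t := by
          simpa using (((hasDerivAt_id t).const_mul s).ofReal_comp).fun_neg
        exact h3.cexp
      refine (h2.mul h1).congr_deriv ?_
      have h4 := h _ (hinv p hp t)
      simp only [inner_sub_right, inner_smul_right, inner_zero_left] at h4 ⊢
      linear_combination (-Complex.I * Complex.exp (-(s * t : ℝ))) * h4
        - (s * Complex.exp (-(s * t : ℝ)) * inner ℂ ξ (V t p.1)) * Complex.I_sq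
    have hconst : ∀ t : ℝ, Complex.exp (-(s * t : ℝ)) * inner ℂ ξ (V t p.1) = inner ℂ ξ p.1 := by
      intro t
      have := is_const_of_deriv_eq_zero (fun t => (hder t).differentiableAt)
        (fun t => (hder t).deriv) t 0
      simpa [hV.map_zero] using this
    by_contra hne
    set c := ‖inner ℂ ξ p.1‖ with hc
    have hcpos : 0 < c := norm_pos_iff.2 hne
    set C := ‖ξ‖ * ‖p.1‖ with hC
    -- At time `u / s` the inner product has grown by `e^u`, while isometry keeps it bounded by `C`.
    -- The choice `u = C / c` below already contradicts this.
    have hb : ∀ u : ℝ, c * Real.exp u ≤ C := by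
      intro u
      have h1 : inner ℂ ξ (V (u / s) p.1) = Complex.exp u * inner ℂ ξ p.1 := by
        rw [← hconst (u / s), ← mul_assoc, ← Complex.exp_add, mul_div_cancel₀ _ hs]
        simp
      have h2 := norm_inner_le_norm (𝕜 := ℂ) ξ (V (u / s) p.1)
      rw [h1, norm_mul, hV.norm_map, Complex.norm_exp, Complex.ofReal_re] at h2
      linarith
    have h1 := hb (C / c)
    have h2 := Real.add_one_le_exp (C / c)
    have h3 : c * (C / c + 1) ≤ C := (mul_le_mul_of_nonneg_left h2 hcpos.le).trans h1
    rw [mul_add, mul_div_cancel₀ _ hcpos.ne'] at h3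
    linarith

/-- The generator is a closed symmetric extension of the self-adjoint closure, hence equal to it. -/
theorem IsFlow.isUnitaryGroup_closure [CompleteSpace E] {V : ℝ → E →L[ℂ] E} (hV : IsFlow V)
    {G : Submodule ℂ (E × E)} (hG : EssSelfAdjoint G) (hle : G ≤ genGraph V) :
    IsUnitaryGroup G.topologicalClosure.toLinearPMap V := by
  refine hV.isUnitaryGroup ?_
  rw [hG.closure.graph_toLinearPMap]
  exact (hG.closure.eq_of_le G.isClosed_topologicalClosure
    (G.topologicalClosure_minimal hle hV.isClosed_genGraph)
    fun p hp q hq => hV.genGraph_symm hp hq).symm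

theorem essSelfAdjoint_of_isSelfAdjoint [CompleteSpace E] {h : E →ₗ.[ℂ] E}
    (hh : IsSelfAdjoint h) : EssSelfAdjoint h.graph := by
  have hd := hh.dense_domain
  have hadj : ∀ ξ η : E, (∀ p ∈ h.graph, inner ℂ ξ p.2 = inner ℂ η p.1) → (ξ, η) ∈ h.graph := by
    intro ξ η H
    have h1 : (ξ, η) ∈ h.graph.adjoint := by
      rw [Submodule.mem_adjoint_iff]
      intro a b hab
      have := congrArg conj (H _ hab)
      simp only [inner_conj_symm] at this
      simp [this]
    rw [← LinearPMap.adjoint_graph_eq_graph_adjoint hd] at h1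
    have h2 : h.adjoint = h := hh
    rwa [h2] at h1
  have hsymm : ∀ p ∈ h.graph, ∀ q ∈ h.graph, inner ℂ p.2 q.1 = inner ℂ p.1 q.2 := by
    intro p hp q hq
    have h2 : h.adjoint = h := hh
    have h1 : q ∈ h.graph.adjoint := by
      rw [← LinearPMap.adjoint_graph_eq_graph_adjoint hd, h2]; exact hq
    exact sub_eq_zero.1 ((Submodule.mem_adjoint_iff _ _).1 h1 p.1 p.2 hp)
  refine ⟨hsymm, fun ξ H => ?_, fun s hs ξ H => ?_⟩
  · have : ξ ∈ h.domainᗮ := by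
      rw [Submodule.mem_orthogonal']
      intro x hx
      exact H _ (h.mem_graph ⟨x, hx⟩)
    have h3 : h.domainᗮ = ⊥ := by
      rw [← Submodule.topologicalClosure_eq_top_iff, ← Submodule.dense_iff_topologicalClosure_eq_top]
      exact hd
    rw [h3] at this
    exact this
  -- A vector orthogonal to the range of `h - is` is an eigenvector of `h* = h` with the non-real
  -- eigenvalue `-is`, which symmetry excludes.
  · have h1 : (ξ, (-(s * Complex.I) : ℂ) • ξ) ∈ h.graph := by
      refine hadj _ _ fun p hp => ?_
      have := H p hp
      simp only [inner_sub_right, inner_smul_right, inner_smul_left] at this ⊢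
      simp only [map_neg, map_mul, Complex.conj_I, Complex.conj_ofReal]
      linear_combination this
    have h2 := hsymm _ h1 _ h1
    simp only [inner_smul_left, inner_smul_right, map_neg, map_mul, Complex.conj_I,
      Complex.conj_ofReal] at h2
    have h3 : (2 * s * Complex.I : ℂ) * inner ℂ ξ ξ = 0 := by linear_combination h2
    have h4 : (2 * s * Complex.I : ℂ) ≠ 0 := by simp [hs]
    exact inner_self_eq_zero.1 ((mul_eq_zero.1 h3).resolve_left h4)

/-- For `x` in the domain `⟨V t x, V' t x⟩` is constant, by symmetry of the common generator; hence
`‖V t x - V' t x‖ = 0`. This makes the choice in `unitaryGroup` harmless. -/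
theorem IsUnitaryGroup.eq {A : E →ₗ.[ℂ] E} {V V' : ℝ → E →L[ℂ] E}
    (hV : IsUnitaryGroup A V) (hV' : IsUnitaryGroup A V') (hd : Dense (A.domain : Set E)) :
    V = V' := by
  funext t
  refine ContinuousLinearMap.ext_on (s := A.domain) ?_ fun x hx => ?_
  · rw [Submodule.span_eq]; exact hd
  obtain ⟨y, hy⟩ := LinearPMap.mem_domain_iff.1 hx
  have h1 : (x, y) ∈ genGraph V := hV.graph_eq ▸ hy
  have h2 : (x, y) ∈ genGraph V' := hV'.graph_eq ▸ hy
  have hder : ∀ t, HasDerivAt (fun t => inner ℂ (V t x) (V' t x)) 0 t := by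
    intro t
    have h4 := HasDerivAt.inner ℂ (hV.isFlow.hasDerivAt h1 t) (hV'.isFlow.hasDerivAt h2 t)
    refine h4.congr_deriv ?_
    have hg : (V t x, V t y) ∈ genGraph V' := by
      rw [← hV'.graph_eq, hV.graph_eq, mem_genGraph]
      have h5 := hV.isFlow.hasDerivAt h1 t
      have h6 : HasDerivAt (fun s => V s x) (-Complex.I • V t y) (0 + t) := by rwa [zero_add]
      refine (h6.comp_add_const 0 t).congr_of_eventuallyEq (Eventually.of_forall fun s => ?_)
      exact (hV.isFlow.apply_add s t x).symm
    have hg2 : (V' t x, V' t y) ∈ genGraph V' := by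
      rw [mem_genGraph]
      have h5 := hV'.isFlow.hasDerivAt h2 t
      have h6 : HasDerivAt (fun s => V' s x) (-Complex.I • V' t y) (0 + t) := by rwa [zero_add]
      refine (h6.comp_add_const 0 t).congr_of_eventuallyEq (Eventually.of_forall fun s => ?_)
      exact (hV'.isFlow.apply_add s t x).symm
    have := hV'.isFlow.genGraph_symm hg hg2
    simp only [inner_smul_left, inner_smul_right, map_neg, Complex.conj_I] at this ⊢
    linear_combination Complex.I * this
  have h0 : inner ℂ (V t x) (V' t x) = inner ℂ x x := by
    have := is_const_of_deriv_eq_zero (fun t => (hder t).differentiableAt)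
      (fun t => (hder t).deriv) t 0
    simpa [hV.map_zero, hV'.map_zero] using this
  have h3 : ‖V t x - V' t x‖ ^ 2 = 0 := by
    rw [@norm_sub_sq ℂ, h0, hV.norm_map, hV'.norm_map, inner_self_eq_norm_sq]
    ring
  simpa [sub_eq_zero] using h3

theorem unitaryGroup_spec {A : E →ₗ.[ℂ] E} (h : ∃ V, IsUnitaryGroup A V) :
    IsUnitaryGroup A (unitaryGroup A) := by
  unfold unitaryGroup
  rw [dif_pos h]
  exact h.choose_spec

theorem IsUnitaryGroup.unitaryGroup_eq {A : E →ₗ.[ℂ] E} {V : ℝ → E →L[ℂ] E}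
    (hV : IsUnitaryGroup A V) (hd : Dense (A.domain : Set E)) : unitaryGroup A = V :=
  (unitaryGroup_spec ⟨V, hV⟩).eq hV hd

end EssSelfAdjoint

/-! ### Stone's theorem -/

section Stone

open Filter Topology

variable {E : Type*} [NormedAddCommGroup E] [InnerProductSpace ℂ E]

theorem IsFlow.norm_sub_le {V : ℝ → E →L[ℂ] E} (hV : IsFlow V) {p : E × E}
    (hp : p ∈ genGraph V) (t : ℝ) : ‖V t p.1 - p.1‖ ≤ |t| * ‖p.2‖ := by
  have h := Convex.norm_image_sub_le_of_norm_hasDerivWithin_le (𝕜 := ℝ) (C := ‖p.2‖)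
    (fun s _ => (hV.hasDerivAt hp s).hasDerivWithinAt) (fun s _ => by simp [norm_smul, hV.norm_map])
    convex_univ (Set.mem_univ 0) (Set.mem_univ t)
  simpa [hV.map_zero, mul_comm] using h

variable [CompleteSpace E]

theorem EssSelfAdjoint.dense_fst {G : Submodule ℂ (E × E)} (hG : EssSelfAdjoint G) :
    Dense ((G.map (LinearMap.fst ℂ E E) : Submodule ℂ E) : Set E) := by
  rw [Submodule.dense_iff_topologicalClosure_eq_top, Submodule.topologicalClosure_eq_top_iff,
    Submodule.eq_bot_iff]
  intro ξ hξ
  rw [Submodule.mem_orthogonal'] at hξ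
  exact hG.dense ξ fun p hp => hξ _ (Submodule.mem_map_of_mem hp)

/-- A flow obtained as a strong limit of flows whose generators converge on a dense domain. -/
theorem exists_flow_of_tendsto {G : Submodule ℂ (E × E)}
    (hd : Dense ((G.map (LinearMap.fst ℂ E E) : Submodule ℂ E) : Set E))
    {W : ℕ → ℝ → E →L[ℂ] E} (hW : ∀ n, IsFlow (W n)) {z : ℕ → E → E}
    (hz : ∀ n x, (x, z n x) ∈ genGraph (W n))
    (hlim : ∀ p ∈ G, Tendsto (fun n => z n p.1) atTop (𝓝 p.2))
    (hcauchy : ∀ p ∈ G, ∀ t, CauchySeq fun n => W n t p.1) :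
    ∃ V, IsFlow V ∧ G ≤ genGraph V := by
  have hdist : ∀ x : E, ∀ ε > 0, ∃ p ∈ G, ‖x - p.1‖ < ε := by
    intro x ε hε
    obtain ⟨y, hy, hxy⟩ := Metric.mem_closure_iff.1 (hd x) ε hε
    obtain ⟨p, hp, rfl⟩ := hy
    exact ⟨p, hp, by rwa [dist_eq_norm] at hxy⟩
  have hC : ∀ t x, CauchySeq fun n => W n t x := by
    intro t x
    rw [Metric.cauchySeq_iff]
    intro ε hε
    obtain ⟨p, hp, hxp⟩ := hdist x (ε / 3) (by linarith)
    obtain ⟨N, hN⟩ := Metric.cauchySeq_iff.1 (hcauchy p hp t) (ε / 3) (by linarith)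
    refine ⟨N, fun m hm n hn => ?_⟩
    have h1 : ∀ k, dist (W k t x) (W k t p.1) < ε / 3 := fun k => by
      rw [dist_eq_norm, ← map_sub, (hW k).norm_map]; exact hxp
    have h2 := h1 n
    rw [dist_comm] at h2
    linarith [dist_triangle4 (W m t x) (W m t p.1) (W n t p.1) (W n t x), h1 m, hN m hm n hn]
  choose v hv using fun t x => cauchySeq_tendsto_of_complete (hC t x)
  have hvn : ∀ t x, ‖v t x‖ = ‖x‖ := fun t x =>
    tendsto_nhds_unique ((hv t x).norm) (by simp only [(hW _).norm_map]; exact tendsto_const_nhds)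
  let V : ℝ → E →L[ℂ] E := fun t => LinearMap.mkContinuous
    (linearMapOfTendsto (v t) (fun n => (W n t).toLinearMap) (tendsto_pi_nhds.2 (hv t))) 1
    fun x => by rw [one_mul]; exact (hvn t x).le
  have hVt : ∀ t x, Tendsto (fun n => W n t x) atTop (𝓝 (V t x)) := hv
  have hnorm : ∀ t x, ‖V t x‖ = ‖x‖ := hvn
  have hadd : ∀ s t x, V (s + t) x = V s (V t x) := by
    intro s t x
    refine tendsto_nhds_unique (hVt (s + t) x) ?_
    have h1 : Tendsto (fun n => W n s (W n t x - V t x)) atTop (𝓝 0) := by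
      rw [tendsto_zero_iff_norm_tendsto_zero]
      simp only [(hW _).norm_map]
      simpa using ((hVt t x).sub_const (V t x)).norm
    simpa [(hW _).apply_add] using h1.add (hVt s (V t x))
  have hzero : ∀ x, V 0 x = x := fun x => tendsto_nhds_unique (hVt 0 x) (by
    simp only [(hW _).map_zero]; exact tendsto_const_nhds)
  have hlip : ∀ p ∈ G, ∀ t, ‖V t p.1 - p.1‖ ≤ |t| * ‖p.2‖ := by
    intro p hp t
    refine le_of_tendsto_of_tendsto' ((hVt t p.1).sub_const p.1).norm
      ((hlim p hp).norm.const_mul |t|) fun n => ?_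
    exact (hW n).norm_sub_le (hz n p.1) t
  have hflow : IsFlow V := by
    refine ⟨ContinuousLinearMap.ext hzero, fun s t => ContinuousLinearMap.ext (hadd s t), hnorm,
      fun x => ?_⟩
    -- Orbits of vectors in the dense domain are Lipschitz, and they approximate any orbit uniformly
    -- in time.
    refine continuous_of_uniform_approx_of_continuous fun u hu => ?_
    obtain ⟨ε, hε, hu⟩ := Metric.mem_uniformity_dist.1 hu
    obtain ⟨p, hp, hxp⟩ := hdist x ε hε
    refine ⟨fun t => V t p.1, ?_, fun t => hu ?_⟩
    · refine (LipschitzWith.of_dist_le_mul (K := ‖p.2‖₊) fun s t => ?_).continuous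
      have h1 : V s p.1 - V t p.1 = V t (V (s - t) p.1 - p.1) := by
        rw [map_sub, ← hadd, add_sub_cancel]
      rw [dist_eq_norm, h1, hnorm, Real.dist_eq, mul_comm]
      exact hlip p hp (s - t)
    · rw [dist_eq_norm, ← map_sub, hnorm]; exact hxp
  refine ⟨V, hflow, fun p hp => ?_⟩
  -- The integrated evolution equation survives pointwise limits by dominated convergence; the
  -- derivative is then recovered from the fundamental theorem of calculus.
  have hint : ∀ t, V t p.1 = p.1 + ∫ s in (0 : ℝ)..t, -Complex.I • V s p.2 := by
    intro t
    have h1 : Tendsto (fun n => ∫ s in (0 : ℝ)..t, -Complex.I • W n s (z n p.1)) atTop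
        (𝓝 (∫ s in (0 : ℝ)..t, -Complex.I • V s p.2)) := by
      obtain ⟨C, hC⟩ := (hlim p hp).norm.bddAbove_range
      refine intervalIntegral.tendsto_integral_filter_of_dominated_convergence (fun _ => C) ?_ ?_
        intervalIntegrable_const ?_
      · exact Eventually.of_forall fun n =>
          (((hW n).strongly_continuous _).const_smul _).aestronglyMeasurable
      · refine Eventually.of_forall fun n => Eventually.of_forall fun s _ => ?_
        simpa [norm_smul, (hW n).norm_map] using hC (Set.mem_range_self n)
      · refine Eventually.of_forall fun s _ => Tendsto.const_smul ?_ _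
        have h2 : Tendsto (fun n => W n s (z n p.1 - p.2)) atTop (𝓝 0) := by
          rw [tendsto_zero_iff_norm_tendsto_zero]
          simp only [(hW _).norm_map]
          simpa using ((hlim p hp).sub_const p.2).norm
        simpa using h2.add (hVt s p.2)
    have h2 : ∀ n, W n t p.1 = p.1 + ∫ s in (0 : ℝ)..t, -Complex.I • W n s (z n p.1) := by
      intro n
      rw [intervalIntegral.integral_eq_sub_of_hasDerivAt
        (fun s _ => (hW n).hasDerivAt (hz n p.1) s)
        ((((hW n).strongly_continuous _).const_smul _).intervalIntegrable _ _)]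
      simp [(hW n).map_zero]
    refine tendsto_nhds_unique (hVt t p.1) ?_
    simp only [h2]
    exact h1.const_add _
  rw [mem_genGraph]
  have h3 : HasDerivAt (fun t => p.1 + ∫ s in (0 : ℝ)..t, -Complex.I • V s p.2)
      (-Complex.I • V 0 p.2) 0 :=
    (((hflow.strongly_continuous p.2).const_smul (-Complex.I)).integral_hasStrictDerivAt
      0 0).hasDerivAt.const_add p.1
  rw [hflow.map_zero] at h3
  exact h3.congr_of_eventuallyEq (Eventually.of_forall hint)

open NormedSpace in
theorem isFlow_exp {B : E →L[ℂ] E} (hB : B ∈ skewAdjoint (E →L[ℂ] E)) :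
    IsFlow fun t : ℝ => exp (t • B) := by
  let _ : NormedAlgebra ℚ (E →L[ℂ] E) := .restrictScalars ℚ ℂ (E →L[ℂ] E)
  refine ⟨by simp, fun s t => ?_, fun t x => ?_, fun x => ?_⟩
  · have hc : Commute (s • B) (t • B) := ((Commute.refl B).smul_left s).smul_right t
    simp only [add_smul]
    exact exp_add_of_commute hc
  · have h1 : t • B ∈ skewAdjoint (E →L[ℂ] E) := by
      rw [skewAdjoint.mem_iff] at hB ⊢
      rw [star_smul, hB, star_trivial, smul_neg]
    have h2 : exp (t • B) ∈ unitary (E →L[ℂ] E) := exp_mem_unitary_of_mem_skewAdjoint h1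
    exact ContinuousLinearMap.norm_map_of_mem_unitary h2 x
  · have hc : Continuous fun t : ℝ => exp (t • B) := continuous_iff_continuousAt.2 fun t =>
      (hasDerivAt_exp_smul_const (𝕂 := ℝ) B t).continuousAt
    exact hc.clm_apply continuous_const

open NormedSpace in
theorem hasDerivAt_exp_apply (B : E →L[ℂ] E) (x : E) :
    HasDerivAt (fun t : ℝ => exp (t • B) x) (B x) 0 := by
  have h1 := hasDerivAt_exp_smul_const (𝕂 := ℝ) B 0
  have h2 := ((ContinuousLinearMap.apply ℂ E x).restrictScalars ℝ).hasFDerivAt.comp_hasDerivAt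
    (0 : ℝ) h1
  simpa [Function.comp_def] using h2

-- Commutativity gives `exp(tB) = exp(tC) exp(t(B - C))`, and the isometry `exp(tC)` drops out of
-- the norm.
open NormedSpace in
theorem norm_exp_sub_exp_le {B C : E →L[ℂ] E} (hB : B ∈ skewAdjoint (E →L[ℂ] E))
    (hC : C ∈ skewAdjoint (E →L[ℂ] E)) (hBC : Commute B C) (t : ℝ) (x : E) :
    ‖exp (t • B) x - exp (t • C) x‖ ≤ |t| * ‖B x - C x‖ := by
  let _ : NormedAlgebra ℚ (E →L[ℂ] E) := .restrictScalars ℚ ℂ (E →L[ℂ] E)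
  have h1 : exp (t • B) = exp (t • C) * exp (t • (B - C)) := by
    rw [← exp_add_of_commute, ← smul_add, add_sub_cancel]
    exact ((hBC.symm.sub_right (Commute.refl C)).smul_left t).smul_right t
  have h2 : exp (t • B) x - exp (t • C) x = exp (t • C) (exp (t • (B - C)) x - x) := by
    rw [h1, map_sub]; rfl
  rw [h2, (isFlow_exp hC).norm_map]
  have h3 : (x, Complex.I • (B - C) x) ∈ genGraph fun t : ℝ => exp (t • (B - C)) := by
    rw [mem_genGraph, smul_smul, neg_mul, Complex.I_mul_I, neg_neg, one_smul]
    exact hasDerivAt_exp_apply _ _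
  simpa [norm_smul] using (isFlow_exp (sub_mem hB hC)).norm_sub_le h3 t

namespace EssSelfAdjoint

variable {G : Submodule ℂ (E × E)}

theorem exists_resolvent (hG : EssSelfAdjoint G) (hc : IsClosed (G : Set (E × E))) {s : ℝ}
    (hs : s ≠ 0) : ∃ R : E →L[ℂ] E, ∀ x, (R x, x + (s * Complex.I : ℂ) • R x) ∈ G := by
  choose f hf hfz using fun z => hG.exists_sub_eq hc hs z
  have hinj : ∀ p ∈ G, p.2 - (s * Complex.I : ℂ) • p.1 = 0 → p.1 = 0 := by
    intro p hp h0
    have h1 := hG.norm_le hp s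
    rw [h0, norm_zero] at h1
    have h2 := abs_pos.2 hs
    exact norm_le_zero_iff.1 (by nlinarith [norm_nonneg p.1])
  have huniq : ∀ p ∈ G, ∀ z, p.2 - (s * Complex.I : ℂ) • p.1 = z → p.1 = (f z).1 := by
    intro p hp z h0
    refine sub_eq_zero.1 (hinj (p - f z) (sub_mem hp (hf z)) ?_)
    rw [← sub_eq_zero.2 (h0.trans (hfz z).symm)]
    simp only [Prod.snd_sub, Prod.fst_sub, smul_sub]
    abel
  let R : E →L[ℂ] E := LinearMap.mkContinuous
    { toFun := fun z => (f z).1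
      map_add' := fun z w => by
        refine (huniq (f z + f w) (add_mem (hf z) (hf w)) _ ?_).symm
        conv_rhs => rw [← hfz z, ← hfz w]
        simp only [Prod.snd_add, Prod.fst_add, smul_add]
        abel
      map_smul' := fun c z => by
        refine (huniq (c • f z) (G.smul_mem c (hf z)) _ ?_).symm
        conv_rhs => rw [← hfz z]
        simp only [Prod.smul_snd, Prod.smul_fst, smul_sub, smul_comm c] }
    |s|⁻¹ fun z => by
      have h1 := hG.norm_le (hf z) s
      rw [hfz] at h1
      rw [inv_mul_eq_div, le_div_iff₀ (abs_pos.2 hs), mul_comm]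
      exact h1
  refine ⟨R, fun x => ?_⟩
  have h1 : x + (s * Complex.I : ℂ) • R x = (f x).2 := by
    exact (sub_eq_iff_eq_add.1 (hfz x)).symm
  rw [h1]
  exact hf x

/-- **Stone's theorem**: the closure of an essentially self-adjoint operator generates a unitary
group. -/
theorem exists_isUnitaryGroup (hG₀ : EssSelfAdjoint G) :
    ∃ V, IsUnitaryGroup G.topologicalClosure.toLinearPMap V := by
  obtain ⟨hG, hc⟩ : EssSelfAdjoint G.topologicalClosure ∧
    IsClosed (G.topologicalClosure : Set (E × E)) := ⟨hG₀.closure, G.isClosed_topologicalClosure⟩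
  set K := G.topologicalClosure with hK
  choose R hR using fun (s : {s : ℝ // s ≠ 0}) => hG.exists_resolvent hc s.2
  -- resolvent equation, applied on the domain
  have hinv : ∀ (s : {s : ℝ // s ≠ 0}) (p : E × E), p ∈ K →
      R s (p.2 - (s.1 * Complex.I : ℂ) • p.1) = p.1 := by
    intro s p hp
    set x := p.2 - (s.1 * Complex.I : ℂ) • p.1 with hx
    have h1 := hG.norm_le (sub_mem (hR s x) hp) s
    have h2 : ((R s x, x + (s.1 * Complex.I : ℂ) • R s x) - p).2 -
        (s.1 * Complex.I : ℂ) • ((R s x, x + (s.1 * Complex.I : ℂ) • R s x) - p).1 = 0 := by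
      simp only [Prod.snd_sub, Prod.fst_sub, hx, smul_sub]
      abel
    rw [h2, norm_zero] at h1
    have h3 := abs_pos.2 s.2
    have h4 : ‖R s x - p.1‖ ≤ 0 := by
      change |s.1| * ‖R s x - p.1‖ ≤ 0 at h1
      nlinarith [norm_nonneg (R s x - p.1)]
    exact sub_eq_zero.1 (norm_le_zero_iff.1 h4)
  have hres : ∀ (s s' : {s : ℝ // s ≠ 0}) (x : E),
      R s' x = R s x + ((s'.1 - s.1) * Complex.I : ℂ) • R s (R s' x) := by
    intro s s' x
    have h1 := hinv s _ (hR s' x)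
    have h2 : x + (s'.1 * Complex.I : ℂ) • R s' x - (s.1 * Complex.I : ℂ) • R s' x
        = x + ((s'.1 - s.1) * Complex.I : ℂ) • R s' x := by module
    simp only [h2, map_add, map_smul] at h1
    exact h1.symm
  have hcomm : ∀ s s', Commute (R s) (R s') := by
    intro s s'
    by_cases hss : s = s'
    · rw [hss]
    ext x
    have h1 := hres s s' x
    have h2 := hres s' s x
    have h3 : ((s'.1 - s.1) * Complex.I : ℂ) ≠ 0 := by
      refine mul_ne_zero ?_ Complex.I_ne_zero
      rw [sub_ne_zero]
      exact fun h => hss (Subtype.ext (Complex.ofReal_injective h.symm))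
    have h4 : ((s'.1 - s.1) * Complex.I : ℂ) • (R s (R s' x) - R s' (R s x)) = 0 := by
      have h5 : ((s'.1 - s.1) * Complex.I : ℂ) • R s (R s' x) = R s' x - R s x :=
        eq_sub_of_add_eq' h1.symm
      have h6 : ((s.1 - s'.1) * Complex.I : ℂ) • R s' (R s x) = R s x - R s' x :=
        eq_sub_of_add_eq' h2.symm
      have h7 : ((s'.1 - s.1) * Complex.I : ℂ) • R s' (R s x) = R s' x - R s x := by
        rw [← neg_sub (R s x), ← h6, ← neg_smul]; congr 1; ring
      rw [smul_sub, h5, h7, sub_self]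
    exact sub_eq_zero.1 ((smul_eq_zero.1 h4).resolve_left h3)
  have hadj : ∀ (s s' : {s : ℝ // s ≠ 0}), s'.1 = -s.1 → ∀ x y,
      inner ℂ (R s x) y = inner ℂ x (R s' y) := by
    intro s s' hs x y
    have h1 := hG.symm _ (hR s x) _ (hR s' y)
    simp only [inner_add_left, inner_add_right, inner_smul_left, inner_smul_right, hs,
      map_mul, Complex.conj_I, Complex.conj_ofReal] at h1
    push_cast at h1
    linear_combination -h1
  have hnorm : ∀ (s : {s : ℝ // s ≠ 0}) x, |s.1| * ‖R s x‖ ≤ ‖x‖ := by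
    intro s x
    have := hG.norm_le (hR s x) s.1
    simpa using this
  -- the Yosida approximations
  let a : ℕ → {s : ℝ // s ≠ 0} := fun n => ⟨n + 1, by positivity⟩
  let b : ℕ → {s : ℝ // s ≠ 0} := fun n => ⟨-(n + 1), by
    rw [neg_ne_zero]; positivity⟩
  have hab : ∀ n, (b n).1 = -(a n).1 := fun n => rfl
  have hba : ∀ n, (a n).1 = -(b n).1 := fun n => (neg_neg _).symm
  -- With `s = n + 1` this is `s² A (A² + s²)⁻¹`. Pairing the resolvents at `is` and `-is` makes the
  -- bounded approximation symmetric, so that its exponentials are unitary.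
  let A : ℕ → E →L[ℂ] E := fun n => (((n + 1) ^ 2 / 2 : ℝ) : ℂ) • (R (a n) + R (b n))
  have hA_symm : ∀ n x y, inner ℂ (A n x) y = inner ℂ x (A n y) := by
    intro n x y
    simp only [A, _root_.smul_apply, _root_.add_apply, inner_smul_left,
      inner_smul_right, inner_add_left, inner_add_right, Complex.conj_ofReal,
      hadj _ _ (hab n), hadj _ _ (hba n)]
    ring
  have hA_comm : ∀ m n, Commute (A m) (A n) := fun m n =>
    (((hcomm _ _).add_left (hcomm _ _)).add_right
      ((hcomm _ _).add_left (hcomm _ _))).smul_left _ |>.smul_right _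
  -- `J s = s² R(s) R(-s)` tends to the identity
  have hA_eq : ∀ n, ∀ p ∈ K, A n p.1 = (((n + 1) ^ 2 : ℝ) : ℂ) • R (a n) (R (b n) p.2) := by
    intro n p hp
    have h1 : R (b n) p.2 = p.1 - ((n + 1 : ℝ) * Complex.I : ℂ) • R (b n) p.1 := by
      have h0 := hinv (b n) p hp
      rw [map_sub, map_smul, sub_eq_iff_eq_add] at h0
      rw [h0]
      simp only [b]
      push_cast
      module
    have h2 := hres (a n) (b n) p.1
    have h3 : ((b n).1 - (a n).1 : ℂ) = -(2 * (n + 1 : ℝ)) := by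
      simp only [b, a]; push_cast; ring
    rw [h3] at h2
    have h4 : ((n + 1 : ℝ) * Complex.I : ℂ) • R (a n) (R (b n) p.1)
        = (1 / 2 : ℂ) • (R (a n) p.1 - R (b n) p.1) := by
      have h5 : R (a n) p.1 = R (b n) p.1 - (-(2 * (n + 1 : ℝ)) * Complex.I : ℂ) •
          R (a n) (R (b n) p.1) := eq_sub_of_add_eq h2.symm
      rw [h5]; module
    rw [h1, map_sub, map_smul, h4]
    simp only [A, _root_.smul_apply, _root_.add_apply]
    push_cast
    module
  have hR_tendsto : ∀ (c : ℕ → {s : ℝ // s ≠ 0}) , (∀ n, |(c n).1| = n + 1) → ∀ x,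
      Tendsto (fun n => (-((c n).1 * Complex.I) : ℂ) • R (c n) x) atTop (𝓝 x) := by
    intro c hcn x
    have hbound : ∀ n y, ‖(-((c n).1 * Complex.I) : ℂ) • R (c n) y‖ ≤ ‖y‖ := by
      intro n y
      have := hnorm (c n) y
      simpa [norm_smul] using this
    rw [Metric.tendsto_atTop]
    intro ε hε
    obtain ⟨y, hy, hxy⟩ := Metric.mem_closure_iff.1 (hG.dense_fst x) (ε / 3) (by linarith)
    obtain ⟨p, hp, rfl⟩ := hy
    obtain ⟨N, hN⟩ := exists_nat_gt (‖p.2‖ / (ε / 3))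
    refine ⟨N, fun n hn => ?_⟩
    have h1 : (-((c n).1 * Complex.I) : ℂ) • R (c n) p.1 - p.1 = - R (c n) p.2 := by
      have h2 := hinv (c n) p hp
      rw [map_sub, map_smul, sub_eq_iff_eq_add'] at h2
      rw [h2]
      module
    have h2 : ‖R (c n) p.2‖ < ε / 3 := by
      have h3 := hnorm (c n) p.2
      rw [hcn] at h3
      rw [div_lt_iff₀ (by linarith)] at hN
      have h4 : (N : ℝ) ≤ n := by exact_mod_cast hn
      by_contra! h5
      have : ((n : ℝ) + 1) * (ε / 3) ≤ (n + 1) * ‖R (c n) p.2‖ := by gcongr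
      nlinarith
    change dist x p.1 < ε / 3 at hxy
    rw [dist_eq_norm] at hxy
    have h3 := hbound n (x - p.1)
    rw [dist_eq_norm]
    have h4 : (-((c n).1 * Complex.I) : ℂ) • R (c n) x - x =
        (-((c n).1 * Complex.I) : ℂ) • R (c n) (x - p.1) +
        ((-((c n).1 * Complex.I) : ℂ) • R (c n) p.1 - p.1) - (x - p.1) := by
      rw [map_sub]; module
    rw [h4, h1]
    calc _ ≤ ‖(-((c n).1 * Complex.I) : ℂ) • R (c n) (x - p.1)‖ + ‖- R (c n) p.2‖ + ‖x - p.1‖ :=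
          (norm_sub_le _ _).trans (add_le_add_left (norm_add_le _ _) _)
      _ < ε := by rw [norm_neg]; linarith
  have hA_lim : ∀ p ∈ K, Tendsto (fun n => A n p.1) atTop (𝓝 p.2) := by
    intro p hp
    have h1 := hR_tendsto a (fun n => abs_of_nonneg (by positivity)) p.2
    have h2 := hR_tendsto b (fun n => (abs_neg _).trans (abs_of_nonneg (by positivity))) p.2
    have h3 : Tendsto (fun n => (-((a n).1 * Complex.I) : ℂ) • R (a n)
        ((-((b n).1 * Complex.I) : ℂ) • R (b n) p.2 - p.2)) atTop (𝓝 0) := by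
      refine squeeze_zero_norm (a := fun n => ‖(-((b n).1 * Complex.I) : ℂ) • R (b n) p.2 - p.2‖)
        (fun n => ?_) ?_
      · have := hnorm (a n) ((-((b n).1 * Complex.I) : ℂ) • R (b n) p.2 - p.2)
        simpa [norm_smul] using this
      · simpa using (h2.sub_const p.2).norm
    have h4 := h3.add h1
    rw [zero_add] at h4
    refine h4.congr fun n => ?_
    rw [hA_eq n p hp, map_sub, smul_sub, sub_add_cancel, map_smul, smul_smul]
    congr 1
    simp only [a, b]
    push_cast
    linear_combination (-((n : ℂ) + 1) ^ 2) * Complex.I_sq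
  have hskew : ∀ n, -Complex.I • A n ∈ skewAdjoint (E →L[ℂ] E) := by
    intro n
    rw [skewAdjoint.mem_iff, star_smul, ContinuousLinearMap.star_eq_adjoint]
    have h1 : ContinuousLinearMap.adjoint (A n) = A n := by
      symm
      rw [ContinuousLinearMap.eq_adjoint_iff]
      exact hA_symm n
    rw [h1, ← neg_smul]
    congr 1
    simp
  have hgen : ∀ n x, (x, A n x) ∈ genGraph fun t : ℝ => NormedSpace.exp (t • (-Complex.I • A n)) :=
    fun n x => hasDerivAt_exp_apply (-Complex.I • A n) x
  -- The approximants commute, so their exponentials on a domain vector differ by at most `|t|`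
  -- times the difference of the approximants there, which is Cauchy.
  obtain ⟨V, hV, hle⟩ := exists_flow_of_tendsto hG.dense_fst (fun n => isFlow_exp (hskew n)) hgen
    hA_lim fun p hp t => by
      rw [Metric.cauchySeq_iff]
      intro ε hε
      obtain ⟨N, hN⟩ := Metric.cauchySeq_iff.1 (hA_lim p hp).cauchySeq (ε / (|t| + 1))
        (by positivity)
      refine ⟨N, fun m hm n hn => ?_⟩
      have h1 := norm_exp_sub_exp_le (hskew m) (hskew n)
        (((hA_comm m n).smul_left _).smul_right _) t p.1
      have h2 := hN m hm n hn
      rw [dist_eq_norm] at h2 ⊢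
      rw [lt_div_iff₀ (by positivity)] at h2
      have h3 : ‖(-Complex.I • A m) p.1 - (-Complex.I • A n) p.1‖ = ‖A m p.1 - A n p.1‖ := by
        have h4 : (-Complex.I • A m) p.1 - (-Complex.I • A n) p.1
            = -Complex.I • (A m p.1 - A n p.1) := (smul_sub _ _ _).symm
        rw [h4, norm_smul]
        simp
      rw [h3] at h1
      nlinarith [norm_nonneg (A m p.1 - A n p.1)]
  refine ⟨V, hV.isUnitaryGroup_closure hG₀ fun p hp => hle (G.le_topologicalClosure hp)⟩

end EssSelfAdjoint

theorem isUnitaryGroup_unitaryGroup {h : E →ₗ.[ℂ] E} (hh : IsSelfAdjoint h) :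
    IsUnitaryGroup h (unitaryGroup h) := by
  refine unitaryGroup_spec ?_
  obtain ⟨V, hV⟩ := (essSelfAdjoint_of_isSelfAdjoint hh).exists_isUnitaryGroup
  refine ⟨V, ?_⟩
  have h1 : IsClosed (h.graph : Set (E × E)) := hh.isClosed
  have h2 : h.graph.topologicalClosure.toLinearPMap = h := by
    rw [h1.submodule_topologicalClosure_eq]
    exact LinearPMap.eq_of_eq_graph (essSelfAdjoint_of_isSelfAdjoint hh).graph_toLinearPMap
  rwa [h2] at hV

end Stone

open UniformSpace (Completion)

/-! ### Total families -/

section Total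

variable {E E' : Type*} [NormedAddCommGroup E] [InnerProductSpace ℂ E]
  [NormedAddCommGroup E'] [InnerProductSpace ℂ E']

theorem dense_span_of_inner [CompleteSpace E] {s : Set E}
    (h : ∀ ξ : E, (∀ x ∈ s, inner ℂ ξ x = 0) → ξ = 0) :
    Dense (Submodule.span ℂ s : Set E) := by
  rw [Submodule.dense_iff_topologicalClosure_eq_top, Submodule.topologicalClosure_eq_top_iff,
    Submodule.eq_bot_iff]
  intro ξ hξ
  rw [Submodule.mem_orthogonal'] at hξ
  exact h ξ fun x hx => hξ _ (Submodule.subset_span hx)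

theorem eq_zero_of_inner_dense_span {s : Set E} (hs : Dense (Submodule.span ℂ s : Set E)) {ξ : E}
    (h : ∀ x ∈ s, inner ℂ x ξ = 0) : ξ = 0 := by
  refine hs.eq_zero_of_inner_right (𝕜 := ℂ) fun v hv => ?_
  induction hv using Submodule.span_induction with
  | mem x hx => exact h x hx
  | zero => simp
  | add x y _ _ hx hy => rw [inner_add_left, hx, hy, add_zero]
  | smul c x _ hx => rw [inner_smul_left, hx, mul_zero]

/-- Gram matrices determine norms of linear combinations. Comparing the two maps from the free space
`ι →₀ ℂ` therefore yields well-definedness and the bound together. -/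
theorem exists_clm_of_inner [CompleteSpace E'] {ι : Type*} {e : ι → E} {e' : ι → E'}
    (hd : Dense (Submodule.span ℂ (Set.range e) : Set E)) {c : ℝ} (hc : 0 ≤ c)
    (h : ∀ i j, inner ℂ (e' i) (e' j) = (c ^ 2 : ℝ) * inner ℂ (e i) (e j)) :
    ∃ T : E →L[ℂ] E', (∀ i, T (e i) = e' i) ∧ ∀ x, ‖T x‖ = c * ‖x‖ := by
  let Φ := Finsupp.linearCombination ℂ e
  let Φ' := Finsupp.linearCombination ℂ e'
  have hΦ : DenseRange Φ := by
    have : Set.range Φ = (Submodule.span ℂ (Set.range e) : Set E) := by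
      rw [← Finsupp.range_linearCombination]; rfl
    rw [DenseRange, this]
    exact hd
  have hinner : ∀ a b, inner ℂ (Φ' a) (Φ' b) = (c ^ 2 : ℝ) * inner ℂ (Φ a) (Φ b) := by
    intro a b
    induction a using Finsupp.induction_linear with
    | zero => simp
    | add a a' ha ha' => simp only [map_add, inner_add_left, ha, ha', mul_add]
    | single i r =>
      induction b using Finsupp.induction_linear with
      | zero => simp
      | add b b' hb hb' => simp only [map_add, inner_add_right, hb, hb', mul_add]
      | single j r' =>
        simp only [Φ, Φ', Finsupp.linearCombination_single, inner_smul_left, inner_smul_right, h]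
        ring
  have hnorm : ∀ a, ‖Φ' a‖ = c * ‖Φ a‖ := by
    intro a
    have h1 := congrArg Complex.re (hinner a a)
    rw [Complex.re_ofReal_mul] at h1
    have h2 : ‖Φ' a‖ ^ 2 = (c * ‖Φ a‖) ^ 2 := by
      rw [mul_pow, ← inner_self_eq_norm_sq (𝕜 := ℂ), ← inner_self_eq_norm_sq (𝕜 := ℂ)]
      exact h1
    exact (pow_left_inj₀ (norm_nonneg _) (by positivity) two_ne_zero).1 h2
  have hT : ∀ a, Φ'.extendOfNorm Φ (Φ a) = Φ' a :=
    LinearMap.extendOfNorm_eq hΦ ⟨c, fun a => (hnorm a).le⟩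
  refine ⟨Φ'.extendOfNorm Φ, fun i => ?_, fun x => ?_⟩
  · simpa [Φ, Φ'] using hT (Finsupp.single i 1)
  · refine hΦ.induction_on (p := fun x => ‖Φ'.extendOfNorm Φ x‖ = c * ‖x‖) x
      (isClosed_eq (by fun_prop) (by fun_prop)) fun a => ?_
    rw [hT, hnorm]

end Total

/-! ### Symmetric tensors -/

section Symmetric

variable {F : Type*} [NormedAddCommGroup F] [InnerProductSpace ℂ F] {n : ℕ}

/-- The inclusion of the algebraic tensor power. -/
def ofAlgPow (F : Type*) [NormedAddCommGroup F] [InnerProductSpace ℂ F] (n : ℕ) :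
    AlgPow F n →ₗ[ℂ] TensorPow F n :=
  (Completion.toComplₗᵢ (𝕜 := ℂ) (E := AlgPow F n)).toLinearMap

/-- The elementary tensors depend multilinearly on the factors. -/
def elemTensorₗ (F : Type*) [NormedAddCommGroup F] [InnerProductSpace ℂ F] (n : ℕ) :
    MultilinearMap ℂ (fun _ : Fin n => F) (TensorPow F n) :=
  (ofAlgPow F n).compMultilinearMap
    (show MultilinearMap ℂ (fun _ : Fin n => F) (AlgPow F n) from PiTensorProduct.tprod ℂ)

theorem norm_elemTensor (v : Fin n → F) : ‖elemTensor v‖ = ∏ i, ‖v i‖ := by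
  have h := inner_elemTensor v v
  simp only [inner_self_eq_norm_sq_to_K] at h
  have h2 : ‖elemTensor v‖ ^ 2 = (∏ i, ‖v i‖) ^ 2 := by
    rw [← Finset.prod_pow]
    exact_mod_cast h
  exact (pow_left_inj₀ (norm_nonneg _) (Finset.prod_nonneg fun i _ => norm_nonneg _)
    two_ne_zero).1 h2

theorem dense_span_elemTensor :
    Dense (Submodule.span ℂ (Set.range (elemTensor : (Fin n → F) → TensorPow F n)) :
      Set (TensorPow F n)) := by
  have key : ∀ x : AlgPow F n, ofAlgPow F n x ∈
      Submodule.span ℂ (Set.range (elemTensor : (Fin n → F) → TensorPow F n)) := by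
    intro x
    obtain ⟨s, c, rfl⟩ := algPow_exists_finsupp x
    rw [map_sum]
    refine Submodule.sum_mem _ fun v _ => ?_
    rw [map_smul]
    exact Submodule.smul_mem _ _ (Submodule.subset_span ⟨v, rfl⟩)
  have hd : DenseRange (ofAlgPow F n) := Completion.denseRange_coe (α := AlgPow F n)
  refine hd.mono ?_
  rintro _ ⟨x, rfl⟩
  exact key x

theorem symmetrize_comp_perm (v : Fin n → F) (σ : Equiv.Perm (Fin n)) :
    symmetrize (v ∘ σ) = symmetrize v := by
  unfold symmetrize
  congr 1
  exact Fintype.sum_equiv (Equiv.mulLeft σ) _ _ fun τ => rfl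

theorem inner_symmetrize_elemTensor_comp (v w : Fin n → F) (τ : Equiv.Perm (Fin n)) :
    inner ℂ (symmetrize v) (elemTensor (w ∘ τ)) = inner ℂ (symmetrize v) (elemTensor w) := by
  simp only [symmetrize, inner_smul_left, sum_inner, inner_elemTensor]
  congr 1
  refine Fintype.sum_equiv (Equiv.mulRight τ⁻¹) _ _ fun σ => ?_
  refine Fintype.prod_equiv τ _ _ fun i => ?_
  simp

/-- Symmetrization acts as an orthogonal projection, so applying it on one side of an inner product
is enough. -/
theorem inner_symmetrize_right (v w : Fin n → F) :
    inner ℂ (symmetrize v) (symmetrize w) = inner ℂ (symmetrize v) (elemTensor w) := by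
  conv_lhs => rw [symmetrize.eq_def w]
  have hn : (n.factorial : ℂ) ≠ 0 := by exact_mod_cast n.factorial_ne_zero
  simp only [inner_smul_right, inner_sum, inner_symmetrize_elemTensor_comp, Finset.sum_const,
    Finset.card_univ, Fintype.card_perm, Fintype.card_fin, nsmul_eq_mul]
  field_simp

theorem inner_symmetrize (v w : Fin n → F) :
    inner ℂ (symmetrize v) (symmetrize w) =
      (n.factorial : ℂ)⁻¹ * ∑ σ : Equiv.Perm (Fin n), ∏ i, inner ℂ (v (σ i)) (w i) := by
  rw [inner_symmetrize_right]
  simp only [symmetrize, inner_smul_left, sum_inner, inner_elemTensor, map_inv₀, map_natCast]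
  rfl

theorem norm_symmetrize_le (v : Fin n → F) : ‖symmetrize v‖ ≤ ∏ i, ‖v i‖ := by
  have hn : (0 : ℝ) < n.factorial := by exact_mod_cast n.factorial_pos
  rw [symmetrize, norm_smul, norm_inv, Complex.norm_natCast, inv_mul_le_iff₀ hn]
  refine (norm_sum_le _ _).trans (le_of_eq ?_)
  have h : ∀ σ : Equiv.Perm (Fin n), ‖elemTensor (v ∘ σ)‖ = ∏ i, ‖v i‖ := fun σ => by
    rw [norm_elemTensor]
    exact Equiv.prod_comp σ fun i => ‖v i‖
  simp [h, Fintype.card_perm]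

/-- The bijection `σ ↦ (σ 0, σ')` between permutations of `n + 1` letters and pairs of a letter `k`
and a permutation of the remaining letters. -/
theorem sum_perm_succ {M : Type*} [AddCommMonoid M] (f : (Fin (n + 1) → Fin (n + 1)) → M) :
    ∑ σ : Equiv.Perm (Fin (n + 1)), f σ =
      ∑ k : Fin (n + 1), ∑ τ : Equiv.Perm (Fin n), f (Fin.cons k (k.succAbove ∘ τ)) := by
  have hinj : ∀ (k : Fin (n + 1)) (τ : Equiv.Perm (Fin n)),
      Function.Injective (Fin.cons k (k.succAbove ∘ τ) : Fin (n + 1) → Fin (n + 1)) := by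
    intro k τ
    rw [Fin.cons_injective_iff]
    refine ⟨?_, (Fin.succAbove_right_injective).comp τ.injective⟩
    rintro ⟨i, hi⟩
    exact Fin.succAbove_ne k _ hi
  let g : Fin (n + 1) × Equiv.Perm (Fin n) → Equiv.Perm (Fin (n + 1)) := fun p =>
    Equiv.ofBijective _ (Finite.injective_iff_bijective.1 (hinj p.1 p.2))
  have hg : ∀ p, (g p : Fin (n + 1) → Fin (n + 1)) = Fin.cons p.1 (p.1.succAbove ∘ p.2) :=
    fun p => rfl
  have hbij : Function.Bijective g := by
    rw [Fintype.bijective_iff_injective_and_card]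
    constructor
    · rintro ⟨k, τ⟩ ⟨k', τ'⟩ h
      have h1 : (Fin.cons k (k.succAbove ∘ τ) : Fin (n + 1) → Fin (n + 1)) =
          Fin.cons k' (k'.succAbove ∘ τ') := congrArg DFunLike.coe h
      rw [Fin.cons_inj] at h1
      obtain ⟨rfl, h2⟩ := h1
      refine Prod.ext rfl (Equiv.ext fun i => ?_)
      exact Fin.succAbove_right_injective (congrFun h2 i)
    · simp [Fintype.card_perm, Nat.factorial_succ]
  rw [← Fintype.sum_prod_type']
  exact (Fintype.sum_bijective g hbij _ _ fun p => by rw [hg]).symm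

/-- The inner product is a permanent divided by a factorial; this is its expansion along the row of
`g`. -/
theorem inner_symmetrize_cons (g : F) (u : Fin n → F) (w : Fin (n + 1) → F) :
    inner ℂ (symmetrize (Fin.cons g u : Fin (n + 1) → F)) (symmetrize w) =
      ((n + 1 : ℕ) : ℂ)⁻¹ * ∑ k, inner ℂ g (w k) *
        inner ℂ (symmetrize u) (symmetrize (k.removeNth w)) := by
  have hs : ∀ {m : ℕ} (v w : Fin m → F), inner ℂ (symmetrize v) (symmetrize w) =
      (m.factorial : ℂ)⁻¹ * ∑ σ : Equiv.Perm (Fin m), ∏ i, inner ℂ (v i) (w (σ i)) := by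
    intro m v w
    rw [inner_symmetrize]
    congr 1
    refine Fintype.sum_equiv (Equiv.inv _) _ _ fun σ => ?_
    refine Fintype.prod_equiv σ _ _ fun i => ?_
    simp
  rw [hs, sum_perm_succ (fun σ => ∏ i, inner ℂ ((Fin.cons g u : Fin (n + 1) → F) i) (w (σ i))),
    Nat.factorial_succ, Nat.cast_mul, mul_inv, mul_assoc, Finset.mul_sum]
  congr 1
  refine Finset.sum_congr rfl fun k _ => ?_
  rw [hs]
  simp only [Fin.prod_univ_succ, Fin.cons_zero, Fin.cons_succ, Function.comp_apply, Fin.removeNth]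
  rw [← Finset.mul_sum]
  ring

/-- Tensoring with `g` from the left. -/
theorem exists_leftTensor (g : F) (n : ℕ) : ∃ T : TensorPow F n →L[ℂ] TensorPow F (n + 1),
    (∀ v : Fin n → F, T (elemTensor v) = elemTensor (Fin.cons g v : Fin (n + 1) → F)) ∧
    ∀ x, ‖T x‖ = ‖g‖ * ‖x‖ := by
  refine exists_clm_of_inner dense_span_elemTensor (norm_nonneg g) fun v w => ?_
  rw [inner_elemTensor, inner_elemTensor, Fin.prod_univ_succ]
  simp [inner_self_eq_norm_sq_to_K]

/-- The operator `x ↦ g ⊗ x`. -/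
def leftTensor (g : F) (n : ℕ) : TensorPow F n →L[ℂ] TensorPow F (n + 1) :=
  (exists_leftTensor g n).choose

theorem leftTensor_elemTensor (g : F) (v : Fin n → F) :
    leftTensor g n (elemTensor v) = elemTensor (Fin.cons g v : Fin (n + 1) → F) :=
  (exists_leftTensor g n).choose_spec.1 v

theorem norm_leftTensor (g : F) (x : TensorPow F n) : ‖leftTensor g n x‖ = ‖g‖ * ‖x‖ :=
  (exists_leftTensor g n).choose_spec.2 x

/-- The symmetrized elementary tensor as an element of the symmetric tensor power. -/
def symTensor (v : Fin n → F) : SymPow F n :=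
  ⟨symmetrize v, Submodule.le_topologicalClosure _ (Submodule.subset_span ⟨v, rfl⟩)⟩

theorem symVec_eq (v : Fin n → F) : symVec v = lp.single 2 n (symTensor v) := rfl

theorem symPow_eq_zero {ξ : SymPow F n}
    (h : ∀ v : Fin n → F, inner ℂ (symmetrize v) (ξ : TensorPow F n) = 0) : ξ = 0 := by
  have h1 : ∀ y ∈ SymPow F n, inner ℂ y (ξ : TensorPow F n) = 0 := by
    intro y hy
    refine closure_minimal (t := {y | inner ℂ y (ξ : TensorPow F n) = 0}) ?_
      (isClosed_eq (by fun_prop) continuous_const) hy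
    intro y hy
    simp only [SetLike.mem_coe] at hy
    induction hy using Submodule.span_induction with
    | mem x hx => obtain ⟨v, rfl⟩ := hx; exact h v
    | zero => exact inner_zero_left _
    | add x y _ _ hx hy =>
      exact (inner_add_left _ _ _).trans (by rw [show inner ℂ x _ = (0 : ℂ) from hx,
        show inner ℂ y _ = (0 : ℂ) from hy, add_zero])
    | smul c x _ hx =>
      exact (inner_smul_left _ _ _).trans (by rw [show inner ℂ x _ = (0 : ℂ) from hx, mul_zero])
  exact Subtype.ext (inner_self_eq_zero.1 (h1 _ ξ.2))

/-- The adjoint of the inclusion is the projection onto symmetric tensors. Permuting the last `n`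
factors beforehand changes nothing: those are the permutations `decomposeFin.symm (0, σ)` fixing the
first slot. -/
theorem adjoint_subtype_leftTensor (g : F) (v : Fin n → F) :
    ContinuousLinearMap.adjoint (SymPow F (n + 1)).subtypeL (leftTensor g n (symmetrize v)) =
      symTensor (Fin.cons g v : Fin (n + 1) → F) := by
  rw [← sub_eq_zero]
  refine symPow_eq_zero fun w => ?_
  have hcons : ∀ σ : Equiv.Perm (Fin n), (Fin.cons g (v ∘ σ) : Fin (n + 1) → F) =
      (Fin.cons g v : Fin (n + 1) → F) ∘ Equiv.Perm.decomposeFin.symm (0, σ) := by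
    intro σ
    funext i
    refine Fin.cases ?_ (fun i => ?_) i
    · simp
    · simp
  have h1 : ∀ x, inner ℂ (symmetrize w)
      ((ContinuousLinearMap.adjoint (SymPow F (n + 1)).subtypeL x : SymPow F (n + 1)) :
        TensorPow F (n + 1)) = inner ℂ (symmetrize w) x := fun x =>
    ContinuousLinearMap.adjoint_inner_right (SymPow F (n + 1)).subtypeL (symTensor w) x
  have hn : (n.factorial : ℂ) ≠ 0 := by exact_mod_cast n.factorial_ne_zero
  rw [AddSubgroupClass.coe_sub, inner_sub_right, h1]
  change _ - inner ℂ (symmetrize w) (symmetrize _) = 0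
  rw [sub_eq_zero, inner_symmetrize_right, symmetrize.eq_def v, map_smul, map_sum]
  simp only [leftTensor_elemTensor, hcons, inner_smul_right, inner_sum,
    inner_symmetrize_elemTensor_comp, Finset.sum_const, Finset.card_univ, Fintype.card_perm,
    Fintype.card_fin, nsmul_eq_mul]
  field_simp

end Symmetric

/-! ### Operators on the Fock space -/

section FockOperators

theorem removeNth_succ_cons {F : Type*} {n : ℕ} (k : Fin (n + 1)) (g : F) (v : Fin (n + 1) → F) :
    k.succ.removeNth (Fin.cons g v : Fin (n + 2) → F) = Fin.cons g (k.removeNth v) := by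
  funext i
  refine Fin.cases ?_ (fun i => ?_) i <;> simp [Fin.removeNth]

theorem cons_cons_swap {F : Type*} {n : ℕ} (f g : F) (v : Fin n → F) :
    (Fin.cons f (Fin.cons g v : Fin (n + 1) → F) : Fin (n + 2) → F) =
      (Fin.cons g (Fin.cons f v : Fin (n + 1) → F) : Fin (n + 2) → F) ∘ Equiv.swap 0 1 := by
  funext i
  refine Fin.cases ?_ (fun i => ?_) i
  · simp
  · refine Fin.cases ?_ (fun i => ?_) i
    · simp
    · rw [Function.comp_apply, Equiv.swap_apply_of_ne_of_ne]
      · simp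
      · exact Fin.succ_ne_zero _
      · rw [← Fin.succ_zero_eq_one]
        exact fun h => Fin.succ_ne_zero _ (Fin.succ_injective _ h)

variable {F : Type*} [NormedAddCommGroup F] [InnerProductSpace ℂ F] {n m : ℕ}

theorem inner_symVec_left (v : Fin n → F) (ξ : Fock F) :
    inner ℂ (symVec v) ξ = inner ℂ (symmetrize v) (ξ n : TensorPow F n) := by
  rw [symVec_eq, lp.inner_single_left, Submodule.coe_inner]
  rfl

theorem inner_symVec (v w : Fin n → F) :
    inner ℂ (symVec v) (symVec w) = inner ℂ (symmetrize v) (symmetrize w) := by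
  rw [inner_symVec_left, symVec_eq, lp.single_apply_self]
  rfl

theorem inner_symVec_of_ne (h : m ≠ n) (v : Fin m → F) (w : Fin n → F) :
    inner ℂ (symVec v) (symVec w) = 0 := by
  rw [inner_symVec_left, symVec_eq, lp.single_apply_ne _ _ _ h]
  exact inner_zero_right _

theorem symVec_comp_perm (v : Fin n → F) (σ : Equiv.Perm (Fin n)) :
    symVec (v ∘ σ) = symVec v :=
  congrArg (lp.single 2 n) (Subtype.ext (symmetrize_comp_perm v σ))

theorem fock_eq_zero {ξ : Fock F}
    (h : ∀ (n : ℕ) (v : Fin n → F), inner ℂ (symVec v) ξ = 0) : ξ = 0 := by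
  refine lp.ext (funext fun n => ?_)
  exact symPow_eq_zero fun v => by rw [← inner_symVec_left]; exact h n v

variable (F) in
/-- The set of all symmetrized elementary tensors. -/
def symVecs : Set (Fock F) := {ψ | ∃ (n : ℕ) (v : Fin n → F), ψ = symVec v}

theorem dense_span_symVecs : Dense (Submodule.span ℂ (symVecs F) : Set (Fock F)) := by
  refine dense_span_of_inner fun ξ h => fock_eq_zero fun n v => ?_
  rw [← inner_conj_symm, h _ ⟨n, v, rfl⟩, map_zero]

theorem fock_clm_ext {E : Type*} [NormedAddCommGroup E] [NormedSpace ℂ E] {T T' : Fock F →L[ℂ] E}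
    (h : ∀ (n : ℕ) (v : Fin n → F), T (symVec v) = T' (symVec v)) : T = T' := by
  refine ContinuousLinearMap.ext_on dense_span_symVecs ?_
  rintro _ ⟨n, v, rfl⟩
  exact h n v

/-- The projection onto the `n`-particle space. -/
def fockProj (F : Type*) [NormedAddCommGroup F] [InnerProductSpace ℂ F] (n : ℕ) :
    Fock F →L[ℂ] Fock F :=
  (lp.singleContinuousLinearMap ℂ (fun n : ℕ => SymPow F n) 2 n).comp
    (lp.evalCLM ℂ (fun n : ℕ => SymPow F n) 2 n)

theorem fockProj_apply (ψ : Fock F) : fockProj F n ψ = lp.single 2 n (ψ n) := rfl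

theorem fockProj_symVec (v : Fin n → F) : fockProj F n (symVec v) = symVec v := by
  rw [fockProj_apply, symVec_eq, lp.single_apply_self]

theorem fockProj_symVec_of_ne (h : m ≠ n) (v : Fin m → F) : fockProj F n (symVec v) = 0 := by
  rw [fockProj_apply, symVec_eq, lp.single_apply_ne _ _ _ h.symm, lp.single_zero]

theorem inner_fockProj (ψ η : Fock F) :
    inner ℂ (fockProj F n ψ) η = inner ℂ ψ (fockProj F n η) := by
  rw [fockProj_apply, fockProj_apply, lp.inner_single_left, lp.inner_single_right]

theorem fockProj_fockProj (ψ : Fock F) : fockProj F n (fockProj F n ψ) = fockProj F n ψ := by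
  rw [fockProj_apply, fockProj_apply, lp.single_apply_self]

theorem fockProj_fockProj_of_ne (h : m ≠ n) (ψ : Fock F) : fockProj F n (fockProj F m ψ) = 0 := by
  rw [fockProj_apply, fockProj_apply, lp.single_apply_ne _ _ _ h.symm, lp.single_zero]

theorem hasSum_fockProj (ψ : Fock F) : HasSum (fun n => fockProj F n ψ) ψ :=
  lp.hasSum_single (by simp) ψ

theorem norm_apply_le (ψ : Fock F) : ‖ψ n‖ ≤ ‖ψ‖ := lp.norm_apply_le_norm (by simp) ψ n

theorem symVec_zero (v : Fin 0 → F) : symVec v = vac F := by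
  rw [vac, Subsingleton.elim v Fin.elim0]

/-- The creation operator restricted to the `n`-particle space. -/
def creationPart (g : F) (n : ℕ) : Fock F →L[ℂ] Fock F :=
  (Real.sqrt (n + 1) : ℂ) •
    (lp.singleContinuousLinearMap ℂ (fun n : ℕ => SymPow F n) 2 (n + 1)).comp
      ((ContinuousLinearMap.adjoint (SymPow F (n + 1)).subtypeL).comp
        ((leftTensor g n).comp ((SymPow F n).subtypeL.comp
          (lp.evalCLM ℂ (fun n : ℕ => SymPow F n) 2 n))))

theorem creationPart_apply (g : F) (ψ : Fock F) : creationPart g n ψ =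
    (Real.sqrt (n + 1) : ℂ) • lp.single 2 (n + 1)
      (ContinuousLinearMap.adjoint (SymPow F (n + 1)).subtypeL
        (leftTensor g n (ψ n : TensorPow F n))) := rfl

theorem creationPart_symVec (g : F) (v : Fin n → F) :
    creationPart g n (symVec v) =
      (Real.sqrt (n + 1) : ℂ) • symVec (Fin.cons g v : Fin (n + 1) → F) := by
  rw [creationPart_apply, symVec_eq, symVec_eq, lp.single_apply_self,
    ← adjoint_subtype_leftTensor]
  rfl

theorem creationPart_fockProj (g : F) (ψ : Fock F) :
    creationPart g n (fockProj F n ψ) = creationPart g n ψ := by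
  rw [creationPart_apply, creationPart_apply, fockProj_apply, lp.single_apply_self]

theorem creationPart_symVec_of_ne (h : m ≠ n) (g : F) (v : Fin m → F) :
    creationPart g n (symVec v) = 0 := by
  rw [← creationPart_fockProj, fockProj_symVec_of_ne h, map_zero]

theorem fockProj_creationPart (g : F) (ψ : Fock F) :
    fockProj F (n + 1) (creationPart g n ψ) = creationPart g n ψ := by
  rw [creationPart_apply, map_smul, fockProj_apply, lp.single_apply_self]

theorem norm_creationPart_le (g : F) (ψ : Fock F) :
    ‖creationPart g n ψ‖ ≤ Real.sqrt (n + 1) * ‖g‖ * ‖ψ‖ := by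
  rw [creationPart_apply, norm_smul, Complex.norm_real, Real.norm_of_nonneg (Real.sqrt_nonneg _),
    lp.norm_single (by norm_num), mul_assoc]
  gcongr
  refine (ContinuousLinearMap.le_opNorm _ _).trans ?_
  rw [LinearIsometryEquiv.norm_map]
  refine (mul_le_mul_of_nonneg_right (SymPow F (n + 1)).norm_subtypeL_le (norm_nonneg _)).trans ?_
  rw [one_mul, norm_leftTensor]
  gcongr
  exact norm_apply_le ψ

/-- The annihilation operator restricted to the `(n + 1)`-particle space. -/
def annihilationPart (g : F) (n : ℕ) : Fock F →L[ℂ] Fock F :=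
  ContinuousLinearMap.adjoint (creationPart g n)

theorem adjoint_annihilationPart (g : F) :
    ContinuousLinearMap.adjoint (annihilationPart g n) = creationPart g n :=
  ContinuousLinearMap.adjoint_adjoint _

theorem inner_annihilationPart_right (g : F) (ψ η : Fock F) :
    inner ℂ ψ (annihilationPart g n η) = inner ℂ (creationPart g n ψ) η :=
  ContinuousLinearMap.adjoint_inner_right _ _ _

theorem annihilationPart_fockProj (g : F) (ψ : Fock F) :
    annihilationPart g n (fockProj F (n + 1) ψ) = annihilationPart g n ψ := by
  refine ext_inner_left ℂ fun η => ?_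
  rw [inner_annihilationPart_right, inner_annihilationPart_right, ← inner_fockProj,
    fockProj_creationPart]

theorem fockProj_annihilationPart (g : F) (ψ : Fock F) :
    fockProj F n (annihilationPart g n ψ) = annihilationPart g n ψ := by
  refine ext_inner_left ℂ fun η => ?_
  rw [← inner_fockProj, inner_annihilationPart_right, inner_annihilationPart_right,
    creationPart_fockProj]

theorem annihilationPart_symVec_of_ne (h : m ≠ n + 1) (g : F) (v : Fin m → F) :
    annihilationPart g n (symVec v) = 0 := by
  rw [← annihilationPart_fockProj, fockProj_symVec_of_ne h, map_zero]

/-- The permanent expansion shows that the adjoint of the bounded creation part is given by the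
formula defining `annihilation`. -/
theorem annihilationPart_symVec (g : F) (v : Fin (n + 1) → F) :
    annihilationPart g n (symVec v) =
      ((Real.sqrt (n + 1) : ℂ)⁻¹) • ∑ k, inner ℂ g (v k) • symVec (k.removeNth v) := by
  rw [← sub_eq_zero]
  refine fock_eq_zero fun m u => ?_
  rw [inner_sub_right, inner_annihilationPart_right, inner_smul_right, inner_sum]
  by_cases h : m = n
  · subst h
    rw [creationPart_symVec, inner_smul_left, inner_symVec, inner_symmetrize_cons,
      Complex.conj_ofReal]
    simp only [inner_smul_right, inner_symVec]
    have h1 : (Real.sqrt (m + 1) : ℂ) * (Real.sqrt (m + 1) : ℂ) = ((m + 1 : ℕ) : ℂ) := by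
      rw [← Complex.ofReal_mul, Real.mul_self_sqrt (by positivity)]
      push_cast; ring
    have h2 : (Real.sqrt (m + 1) : ℂ) ≠ 0 := by
      rw [Complex.ofReal_ne_zero]; positivity
    rw [← h1]
    field_simp
    ring
  · rw [creationPart_symVec_of_ne h, inner_zero_left]
    simp [inner_smul_right, inner_symVec_of_ne h]

theorem norm_annihilationPart_le (g : F) (ψ : Fock F) :
    ‖annihilationPart g n ψ‖ ≤ Real.sqrt (n + 1) * ‖g‖ * ‖ψ‖ := by
  refine (ContinuousLinearMap.le_opNorm _ _).trans ?_
  rw [annihilationPart, LinearIsometryEquiv.norm_map]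
  gcongr
  exact ContinuousLinearMap.opNorm_le_bound _ (by positivity) fun x => norm_creationPart_le g x

theorem sqrt_succ_ne_zero (n : ℕ) : (Real.sqrt (n + 1) : ℂ) ≠ 0 := by
  rw [Complex.ofReal_ne_zero]; positivity

theorem annihilationPart_creationPart_zero (f g : F) :
    (annihilationPart f 0).comp (creationPart g 0) = inner ℂ f g • fockProj F 0 := by
  refine fock_clm_ext fun m v => ?_
  simp only [ContinuousLinearMap.comp_apply, smul_apply]
  by_cases h : m = 0
  · subst h
    rw [creationPart_symVec, map_smul, annihilationPart_symVec, fockProj_symVec, smul_smul,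
      mul_inv_cancel₀ (sqrt_succ_ne_zero 0)]
    simp [symVec_zero]
  · rw [creationPart_symVec_of_ne h, fockProj_symVec_of_ne h, map_zero, smul_zero]

/-- The canonical commutation relation in one sector: removing the newly created factor `g` gives
the scalar term, and removing any other factor gives creation after annihilation. -/
theorem annihilationPart_creationPart_succ (f g : F) :
    (annihilationPart f (n + 1)).comp (creationPart g (n + 1)) =
      inner ℂ f g • fockProj F (n + 1) + (creationPart g n).comp (annihilationPart f n) := by
  refine fock_clm_ext fun m v => ?_
  simp only [ContinuousLinearMap.comp_apply, smul_apply, add_apply]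
  by_cases h : m = n + 1
  · subst h
    rw [creationPart_symVec, map_smul, annihilationPart_symVec, fockProj_symVec, smul_smul,
      mul_inv_cancel₀ (sqrt_succ_ne_zero _), one_smul, annihilationPart_symVec, Fin.sum_univ_succ,
      map_smul, map_sum]
    simp only [map_smul, creationPart_symVec, removeNth_succ_cons, Fin.cons_zero, Fin.cons_succ,
      Fin.removeNth_zero, Fin.tail_cons]
    rw [Finset.smul_sum]
    congr 1
    refine Finset.sum_congr rfl fun k _ => ?_
    rw [smul_comm (inner ℂ f (v k)), smul_smul, inv_mul_cancel₀ (sqrt_succ_ne_zero n), one_smul]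
  · rw [creationPart_symVec_of_ne h, fockProj_symVec_of_ne h, annihilationPart_symVec_of_ne h,
      map_zero, map_zero, smul_zero, add_zero]

theorem creationPart_comm (f g : F) :
    (creationPart f (n + 1)).comp (creationPart g n) =
      (creationPart g (n + 1)).comp (creationPart f n) := by
  refine fock_clm_ext fun m v => ?_
  simp only [ContinuousLinearMap.comp_apply]
  by_cases h : m = n
  · subst h
    simp only [creationPart_symVec, map_smul]
    rw [cons_cons_swap, symVec_comp_perm]
  · rw [creationPart_symVec_of_ne h, creationPart_symVec_of_ne h, map_zero, map_zero]

theorem annihilationPart_comm (f g : F) :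
    (annihilationPart f n).comp (annihilationPart g (n + 1)) =
      (annihilationPart g n).comp (annihilationPart f (n + 1)) := by
  simp only [annihilationPart, ← ContinuousLinearMap.adjoint_comp]
  rw [creationPart_comm]

/-! ### The closed annihilation and creation operators -/

/-- The pairs spanning the graph of the annihilation operator. -/
def annihilationCore (g : F) : Submodule ℂ (Fock F × Fock F) :=
  Submodule.span ℂ ({(vac F, 0)} ∪
    {p : Fock F × Fock F | ∃ (n : ℕ) (v : Fin (n + 1) → F),
      p = (symVec v, ((Real.sqrt (n + 1) : ℂ)⁻¹) •
        ∑ k, inner ℂ g (v k) • symVec (k.removeNth v))})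

theorem annihilation_eq (g : F) :
    annihilation g = (annihilationCore g).topologicalClosure.toLinearPMap := rfl

theorem apply_eq_of_mem_closure_span {E E' E'' : Type*} [NormedAddCommGroup E] [NormedSpace ℂ E]
    [NormedAddCommGroup E'] [NormedSpace ℂ E'] [NormedAddCommGroup E''] [NormedSpace ℂ E'']
    {s : Set (E × E')} {A : E →L[ℂ] E''} {B : E' →L[ℂ] E''} (h : ∀ q ∈ s, B q.2 = A q.1)
    {p : E × E'} (hp : p ∈ (Submodule.span ℂ s).topologicalClosure) : B p.2 = A p.1 := by
  let T : E × E' →L[ℂ] E'' := B.comp (ContinuousLinearMap.snd ℂ E E') -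
    A.comp (ContinuousLinearMap.fst ℂ E E')
  have h1 : (Submodule.span ℂ s).topologicalClosure ≤ T.toLinearMap.ker :=
    Submodule.topologicalClosure_minimal _
      (Submodule.span_le.2 fun q hq => sub_eq_zero.2 (h q hq)) T.isClosed_ker
  exact sub_eq_zero.1 (h1 hp)

/-- Each component is a relation between bounded operators, so it passes from the spanning pairs to
the closure. It shows that the closure is single-valued. -/
theorem fockProj_of_mem_annihilationCore {g : F} {p : Fock F × Fock F}
    (hp : p ∈ (annihilationCore g).topologicalClosure) (n : ℕ) :
    fockProj F n p.2 = annihilationPart g n p.1 := by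
  refine apply_eq_of_mem_closure_span ?_ hp
  rintro q (rfl | ⟨m, v, rfl⟩)
  · have h1 : annihilationPart g n (vac F) = 0 := annihilationPart_symVec_of_ne (by omega) g _
    rw [h1, map_zero]
  · rw [← annihilationPart_symVec]
    by_cases h : m = n
    · subst h
      rw [fockProj_annihilationPart]
    · rw [← fockProj_annihilationPart g, fockProj_fockProj_of_ne h,
        annihilationPart_symVec_of_ne (by omega)]

theorem annihilation_graph (g : F) :
    (annihilation g).graph = (annihilationCore g).topologicalClosure := by
  rw [annihilation_eq]
  refine Submodule.toLinearPMap_graph_eq _ fun p hp h0 => ?_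
  have h1 := (hasSum_fockProj p.2)
  simp only [fockProj_of_mem_annihilationCore hp, h0, map_zero] at h1
  exact h1.unique hasSum_zero

theorem symVec_mem_annihilation_graph (g : F) (v : Fin (n + 1) → F) :
    (symVec v, annihilationPart g n (symVec v)) ∈ (annihilation g).graph := by
  rw [annihilation_graph]
  refine Submodule.le_topologicalClosure _ (Submodule.subset_span (Or.inr ⟨n, v, ?_⟩))
  rw [annihilationPart_symVec]

theorem vac_mem_annihilation_graph (g : F) : (vac F, 0) ∈ (annihilation g).graph := by
  rw [annihilation_graph]
  exact Submodule.le_topologicalClosure _ (Submodule.subset_span (Or.inl rfl))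

theorem fockProj_of_mem_annihilation_graph {g : F} {ψ β : Fock F}
    (h : (ψ, β) ∈ (annihilation g).graph) (n : ℕ) :
    fockProj F n β = annihilationPart g n ψ := by
  rw [annihilation_graph] at h
  exact fockProj_of_mem_annihilationCore h n

theorem symVec_mem_annihilation_domain (g : F) (v : Fin n → F) :
    ∃ β, (symVec v, β) ∈ (annihilation g).graph := by
  cases n with
  | zero => exact ⟨0, by rw [symVec_zero]; exact vac_mem_annihilation_graph g⟩
  | succ n => exact ⟨_, symVec_mem_annihilation_graph g v⟩

theorem dense_annihilation_domain (g : F) : Dense ((annihilation g).domain : Set (Fock F)) := by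
  refine dense_span_symVecs.mono ?_
  refine Submodule.span_le.2 ?_
  rintro _ ⟨n, v, rfl⟩
  exact LinearPMap.mem_domain_iff.2 (symVec_mem_annihilation_domain g v)

theorem mem_creation_graph {g : F} {ψ α : Fock F} :
    (ψ, α) ∈ (creation g).graph ↔
      ∀ p ∈ (annihilation g).graph, inner ℂ ψ p.2 = inner ℂ α p.1 := by
  rw [creation, LinearPMap.adjoint_graph_eq_graph_adjoint (dense_annihilation_domain g),
    Submodule.mem_adjoint_iff]
  constructor
  · intro h p hp
    have h1 := sub_eq_zero.1 (h p.1 p.2 hp)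
    rw [← inner_conj_symm, h1, inner_conj_symm]
  · intro h a b hab
    have h1 := h _ hab
    simp only at h1 ⊢
    rw [← inner_conj_symm, h1, inner_conj_symm, sub_self]

/-- Test the adjoint relation against the elementary tensors, which lie in the domain of the
annihilation operator. -/
theorem fockProj_of_mem_creation_graph {g : F} {ψ α : Fock F}
    (h : (ψ, α) ∈ (creation g).graph) (n : ℕ) :
    fockProj F (n + 1) α = creationPart g n ψ := by
  rw [← sub_eq_zero]
  refine fock_eq_zero fun m v => ?_
  rw [inner_sub_right, ← inner_fockProj, sub_eq_zero]
  rw [mem_creation_graph] at h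
  by_cases hm : m = n + 1
  · subst hm
    have h1 := h _ (symVec_mem_annihilation_graph g v)
    rw [fockProj_symVec, ← inner_conj_symm, ← h1, inner_conj_symm, ← adjoint_annihilationPart,
      ContinuousLinearMap.adjoint_inner_right]
  · rw [fockProj_symVec_of_ne hm, inner_zero_left, ← fockProj_creationPart, ← inner_fockProj,
      fockProj_symVec_of_ne hm, inner_zero_left]

theorem fockProj_zero_of_mem_creation_graph {g : F} {ψ α : Fock F}
    (h : (ψ, α) ∈ (creation g).graph) : fockProj F 0 α = 0 := by
  refine fock_eq_zero fun m v => ?_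
  rw [← inner_fockProj]
  rw [mem_creation_graph] at h
  by_cases hm : m = 0
  · subst hm
    have h1 := h _ (vac_mem_annihilation_graph g)
    rw [inner_zero_right] at h1
    rw [fockProj_symVec, symVec_zero, ← inner_conj_symm]
    exact (congrArg _ h1.symm).trans (map_zero _)
  · rw [fockProj_symVec_of_ne hm, inner_zero_left]

theorem symVec_mem_creation_graph (g : F) (v : Fin n → F) :
    (symVec v, creationPart g n (symVec v)) ∈ (creation g).graph := by
  rw [mem_creation_graph]
  intro p hp
  rw [← inner_annihilationPart_right, ← fockProj_of_mem_annihilation_graph hp, ← inner_fockProj,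
    fockProj_symVec]

end FockOperators

/-! ### Second quantization -/

section FlowLemmas

open Filter Topology

variable {E : Type*} [NormedAddCommGroup E] [InnerProductSpace ℂ E]

theorem continuous_of_dense_span {s : Set E} (hs : Dense (Submodule.span ℂ s : Set E))
    {W : ℝ → E →L[ℂ] E} (hW : ∀ t x, ‖W t x‖ = ‖x‖) (h : ∀ x ∈ s, Continuous fun t => W t x)
    (x : E) : Continuous fun t => W t x := by
  have h1 : ∀ y ∈ Submodule.span ℂ s, Continuous fun t => W t y := by
    intro y hy
    induction hy using Submodule.span_induction with
    | mem x hx => exact h x hx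
    | zero => simpa using continuous_const
    | add x y _ _ hx hy => simp only [map_add]; exact hx.add hy
    | smul c x _ hx => simp only [map_smul]; exact hx.const_smul c
  refine continuous_of_uniform_approx_of_continuous fun u hu => ?_
  obtain ⟨ε, hε, hu⟩ := Metric.mem_uniformity_dist.1 hu
  obtain ⟨y, hy, hxy⟩ := Metric.mem_closure_iff.1 (hs x) ε hε
  refine ⟨fun t => W t y, h1 y hy, fun t => hu ?_⟩
  rwa [dist_eq_norm, ← map_sub, hW, ← dist_eq_norm]

/-- A flow as a family of isometries. -/
def IsFlow.isometry {V : ℝ → E →L[ℂ] E} (hV : IsFlow V) (t : ℝ) : E →ₗᵢ[ℂ] E :=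
  ⟨(V t).toLinearMap, hV.norm_map t⟩

theorem IsFlow.genGraph_invariant {V : ℝ → E →L[ℂ] E} (hV : IsFlow V) {p : E × E}
    (hp : p ∈ genGraph V) (t : ℝ) : (V t p.1, V t p.2) ∈ genGraph V := by
  have h1 : HasDerivAt (fun s => V s p.1) (-Complex.I • V t p.2) (0 + t) := by
    rw [zero_add]; exact hV.hasDerivAt hp t
  refine (h1.comp_add_const 0 t).congr_of_eventuallyEq (Eventually.of_forall fun s => ?_)
  exact (hV.apply_add s t p.1).symm

theorem map_mem_genGraph {E' : Type*} [NormedAddCommGroup E'] [InnerProductSpace ℂ E']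
    {V : ℝ → E →L[ℂ] E} {V' : ℝ → E' →L[ℂ] E'} {T : E →L[ℂ] E'}
    (hT : ∀ t x, V' t (T x) = T (V t x)) {p : E × E} (hp : p ∈ genGraph V) :
    (T p.1, T p.2) ∈ genGraph V' := by
  rw [mem_genGraph] at hp ⊢
  have h1 := (T.restrictScalars ℝ).hasFDerivAt.comp_hasDerivAt (0 : ℝ) hp
  refine (h1.congr_deriv ?_).congr_of_eventuallyEq (Eventually.of_forall fun s => ?_)
  · exact map_smul T _ _
  · exact hT s p.1

theorem prod_mem_span {E' : Type*} [NormedAddCommGroup E'] [InnerProductSpace ℂ E']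
    {s : Set (E × E)} {s' : Set (E' × E')} {T : E →L[ℂ] E'}
    (hT : ∀ p ∈ s, (T p.1, T p.2) ∈ Submodule.span ℂ s') {p : E × E}
    (hp : p ∈ Submodule.span ℂ s) : (T p.1, T p.2) ∈ Submodule.span ℂ s' := by
  have h1 : Submodule.span ℂ s ≤ (Submodule.span ℂ s').comap (T.toLinearMap.prodMap T.toLinearMap) :=
    Submodule.span_le.2 hT
  exact h1 hp

end FlowLemmas

section SecondQuantization

open Filter Topology

variable {F : Type*} [NormedAddCommGroup F] [InnerProductSpace ℂ F] {n m : ℕ}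

/-- Inner products of symmetrized tensors depend only on the one-particle inner products, which `V`
preserves. -/
theorem exists_secondQuant (V : F →ₗᵢ[ℂ] F) : ∃ T : Fock F →L[ℂ] Fock F,
    (∀ (n : ℕ) (v : Fin n → F), T (symVec v) = symVec fun i => V (v i)) ∧ ∀ x, ‖T x‖ = ‖x‖ := by
  have hd : Dense (Submodule.span ℂ (Set.range fun p : Σ n : ℕ, (Fin n → F) => symVec p.2) :
      Set (Fock F)) := by
    convert dense_span_symVecs (F := F) using 4
    ext ψ
    constructor
    · rintro ⟨⟨n, v⟩, rfl⟩
      exact ⟨n, v, rfl⟩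
    · rintro ⟨n, v, rfl⟩
      exact ⟨⟨n, v⟩, rfl⟩
  obtain ⟨T, hT, hn⟩ := exists_clm_of_inner hd (c := 1) zero_le_one
    (e' := fun p : Σ n : ℕ, (Fin n → F) => symVec fun i => V (p.2 i)) (by
      rintro ⟨m, v⟩ ⟨n, w⟩
      rw [one_pow, Complex.ofReal_one, one_mul]
      by_cases h : m = n
      · subst h
        simp only [inner_symVec, inner_symmetrize, V.inner_map_map]
      · rw [inner_symVec_of_ne h, inner_symVec_of_ne h])
  exact ⟨T, fun n v => hT ⟨n, v⟩, fun x => by rw [hn, one_mul]⟩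

/-- The second quantization `Γ(V)` of an isometry `V`. -/
def secondQuant (V : F →ₗᵢ[ℂ] F) : Fock F →L[ℂ] Fock F := (exists_secondQuant V).choose

theorem secondQuant_symVec (V : F →ₗᵢ[ℂ] F) (v : Fin n → F) :
    secondQuant V (symVec v) = symVec fun i => V (v i) :=
  (exists_secondQuant V).choose_spec.1 n v

theorem norm_secondQuant (V : F →ₗᵢ[ℂ] F) (ψ : Fock F) : ‖secondQuant V ψ‖ = ‖ψ‖ :=
  (exists_secondQuant V).choose_spec.2 ψ

/-- The symmetrized elementary tensors depend multilinearly on the factors. -/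
def symmetrizeₗ (F : Type*) [NormedAddCommGroup F] [InnerProductSpace ℂ F] (n : ℕ) :
    MultilinearMap ℂ (fun _ : Fin n => F) (TensorPow F n) :=
  ((n.factorial : ℂ)⁻¹) • ∑ σ : Equiv.Perm (Fin n), (elemTensorₗ F n).domDomCongr σ

theorem symmetrizeₗ_apply (v : Fin n → F) : symmetrizeₗ F n v = symmetrize v := by
  rw [symmetrizeₗ, smul_apply, sum_apply]
  rfl

theorem norm_symVec_le (v : Fin n → F) : ‖symVec v‖ ≤ ∏ i, ‖v i‖ := by
  rw [symVec_eq, lp.norm_single (by norm_num)]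
  exact norm_symmetrize_le v

/-- `symVec` as a continuous multilinear map. -/
def symVecL (F : Type*) [NormedAddCommGroup F] [InnerProductSpace ℂ F] (n : ℕ) :
    ContinuousMultilinearMap ℂ (fun _ : Fin n => F) (Fock F) :=
  MultilinearMap.mkContinuous
    ((lp.singleContinuousLinearMap ℂ (fun n : ℕ => SymPow F n) 2 n).toLinearMap.compMultilinearMap
      ((symmetrizeₗ F n).codRestrict (SymPow F n) fun v => by
        rw [symmetrizeₗ_apply]; exact (symTensor v).2)) 1 fun v => by
    rw [one_mul]
    refine le_trans (le_of_eq ?_) (norm_symVec_le v)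
    refine congrArg norm (congrArg (lp.single 2 n) (Subtype.ext ?_))
    exact symmetrizeₗ_apply v

theorem symVecL_apply (v : Fin n → F) : symVecL F n v = symVec v :=
  congrArg (lp.single 2 n) (Subtype.ext (symmetrizeₗ_apply v))

theorem continuous_symVec : Continuous (symVec : (Fin n → F) → Fock F) := by
  refine (symVecL F n).cont.congr fun v => symVecL_apply v

/-- Leibniz rule for a continuous multilinear map; it is the reason why `dΓ(h)` generates the second
quantized flow. -/
theorem hasDerivAt_symVec {u : ℝ → Fin n → F} {u' : Fin n → F} {t : ℝ}
    (hu : ∀ i, HasDerivAt (fun s => u s i) (u' i) t) :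
    HasDerivAt (fun s => symVec (u s)) (∑ k, symVec (Function.update (u t) k (u' k))) t := by
  have h1 : HasDerivAt u u' t := hasDerivAt_pi.2 hu
  have h2 := (((symVecL F n).hasFDerivAt (u t)).restrictScalars ℝ).comp_hasDerivAt t h1
  refine (h2.congr_deriv ?_).congr_of_eventuallyEq
    (Eventually.of_forall fun s => (symVecL_apply (u s)).symm)
  rw [ContinuousLinearMap.coe_restrictScalars', ContinuousMultilinearMap.linearDeriv_apply]
  exact Finset.sum_congr rfl fun k _ => symVecL_apply _

theorem symVec_update_smul (v : Fin n → F) (k : Fin n) (c : ℂ) (x : F) :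
    symVec (Function.update v k (c • x)) = c • symVec (Function.update v k x) := by
  rw [← symVecL_apply, ← symVecL_apply, (symVecL F n).map_update_smul]

/-- The second quantization of a flow. -/
def fockFlow {V : ℝ → F →L[ℂ] F} (hV : IsFlow V) (t : ℝ) : Fock F →L[ℂ] Fock F :=
  secondQuant (hV.isometry t)

section

variable {V : ℝ → F →L[ℂ] F} (hV : IsFlow V)

theorem fockFlow_symVec (t : ℝ) (v : Fin n → F) :
    fockFlow hV t (symVec v) = symVec fun i => V t (v i) := secondQuant_symVec _ v

theorem isFlow_fockFlow : IsFlow (fockFlow hV) where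
  map_zero := by
    refine fock_clm_ext fun n v => ?_
    rw [fockFlow_symVec, hV.map_zero]
    rfl
  map_add s t := by
    refine fock_clm_ext fun n v => ?_
    change _ = fockFlow hV s (fockFlow hV t (symVec v))
    simp only [fockFlow_symVec, hV.apply_add]
  norm_map t := norm_secondQuant _
  strongly_continuous := by
    refine continuous_of_dense_span dense_span_symVecs (fun t => norm_secondQuant _) ?_
    rintro _ ⟨n, v, rfl⟩
    simp only [fockFlow_symVec]
    exact continuous_symVec.comp (continuous_pi fun i => hV.strongly_continuous (v i))

theorem fockProj_fockFlow (t : ℝ) (ψ : Fock F) :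
    fockProj F n (fockFlow hV t ψ) = fockFlow hV t (fockProj F n ψ) := by
  refine congrFun (congrArg DFunLike.coe (fock_clm_ext
    (T := (fockProj F n).comp (fockFlow hV t)) (T' := (fockFlow hV t).comp (fockProj F n))
    fun m v => ?_)) ψ
  rw [ContinuousLinearMap.comp_apply, ContinuousLinearMap.comp_apply, fockFlow_symVec]
  by_cases h : m = n
  · subst h
    rw [fockProj_symVec, fockProj_symVec, fockFlow_symVec]
  · rw [fockProj_symVec_of_ne h, fockProj_symVec_of_ne h, map_zero]

theorem fockFlow_creationPart (t : ℝ) (g : F) (ψ : Fock F) :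
    fockFlow hV t (creationPart g n ψ) = creationPart (V t g) n (fockFlow hV t ψ) := by
  refine congrFun (congrArg DFunLike.coe (fock_clm_ext
    (T := (fockFlow hV t).comp (creationPart g n))
    (T' := (creationPart (V t g) n).comp (fockFlow hV t)) fun m v => ?_)) ψ
  rw [ContinuousLinearMap.comp_apply, ContinuousLinearMap.comp_apply, fockFlow_symVec]
  by_cases h : m = n
  · subst h
    rw [creationPart_symVec, creationPart_symVec, map_smul, fockFlow_symVec]
    congr 2
    funext i
    refine Fin.cases ?_ (fun i => ?_) i <;> simp
  · rw [creationPart_symVec_of_ne h, creationPart_symVec_of_ne h, map_zero]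

theorem fockFlow_annihilationPart (t : ℝ) (g : F) (ψ : Fock F) :
    fockFlow hV t (annihilationPart g n ψ) = annihilationPart (V t g) n (fockFlow hV t ψ) := by
  refine ext_inner_left ℂ fun η => ?_
  have hΓ := isFlow_fockFlow hV
  rw [inner_annihilationPart_right, ← hΓ.inner_neg_left, inner_annihilationPart_right,
    ← hΓ.inner_map t, fockFlow_creationPart, hΓ.apply_neg]

/-! ### Differential second quantization -/

/-- The pairs spanning the graph of `dΓ(h)`. -/
def dGammaCore (h : F →ₗ.[ℂ] F) : Submodule ℂ (Fock F × Fock F) :=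
  Submodule.span ℂ {p : Fock F × Fock F | ∃ (n : ℕ) (v : Fin n → h.domain),
      p = (symVec fun k => (v k : F),
        ∑ k, symVec (Function.update (fun l => (v l : F)) k (h (v k))))}

theorem dGamma_eq (h : F →ₗ.[ℂ] F) :
    dGamma h = (dGammaCore h).topologicalClosure.toLinearPMap := rfl

end

theorem inner_symVec_eq_zero_of_dense {D : Set F} (hD : Dense D) {ξ : Fock F}
    (h : ∀ v : Fin n → F, (∀ i, v i ∈ D) → inner ℂ ξ (symVec v) = 0) (v : Fin n → F) :
    inner ℂ ξ (symVec v) = 0 := by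
  have h1 : Dense (Set.pi Set.univ fun _ : Fin n => D) := dense_pi Set.univ fun i _ => hD
  have h2 : IsClosed {v : Fin n → F | inner ℂ ξ (symVec v) = 0} :=
    isClosed_eq (continuous_const.inner continuous_symVec) continuous_const
  have h3 := closure_minimal (s := Set.pi Set.univ fun _ : Fin n => D)
    (t := {v : Fin n → F | inner ℂ ξ (symVec v) = 0}) (fun v hv => h v fun i => hv i trivial) h2
  exact h3 (h1 v)

section

variable {h : F →ₗ.[ℂ] F} {V : ℝ → F →L[ℂ] F} (hV : IsUnitaryGroup h V)
include hV

theorem dGammaCore_le : dGammaCore h ≤ genGraph (fockFlow hV.isFlow) := by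
  refine Submodule.span_le.2 ?_
  rintro _ ⟨n, v, rfl⟩
  rw [SetLike.mem_coe, mem_genGraph]
  simp only [fockFlow_symVec]
  have h1 := hasDerivAt_symVec (u := fun t i => V t (v i)) (u' := fun i => -Complex.I • h (v i))
    (t := 0) fun i => (hV.generator _ _).1 (h.mem_graph (v i))
  refine h1.congr_deriv ?_
  simp only [symVec_update_smul, hV.map_zero, ← Finset.smul_sum]
  rfl

theorem dGammaCore_invariant (p : Fock F × Fock F) (hp : p ∈ dGammaCore h) (t : ℝ) :
    (fockFlow hV.isFlow t p.1, fockFlow hV.isFlow t p.2) ∈ dGammaCore h := by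
  refine prod_mem_span ?_ hp
  rintro _ ⟨n, v, rfl⟩
  refine Submodule.subset_span ?_
  have h1 : ∀ k, ∃ w : h.domain, (w : F) = V t (v k) ∧ h w = V t (h (v k)) := by
    intro k
    have h2 := hV.isFlow.genGraph_invariant
      (p := ((v k : F), h (v k))) (by rw [← hV.graph_eq]; exact h.mem_graph (v k)) t
    rw [← hV.graph_eq, LinearPMap.mem_graph_iff] at h2
    exact h2
  choose w hw hw' using h1
  refine ⟨n, w, ?_⟩
  simp only [map_sum, fockFlow_symVec, hw, hw']
  refine Prod.ext rfl ?_
  dsimp only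
  refine Finset.sum_congr rfl fun k _ => congrArg symVec (funext fun i => ?_)
  by_cases hik : i = k
  · subst hik
    simp
  · simp [hik]

/-- The invariant-core criterion applies because `V t` maps the domain of `h` into itself, and hence
elementary tensors over that domain to such tensors. -/
theorem essSelfAdjoint_dGammaCore (hd : Dense (h.domain : Set F)) :
    EssSelfAdjoint (dGammaCore h) := by
  have hdense : ∀ ξ : Fock F, (∀ p ∈ dGammaCore h, inner ℂ ξ p.1 = 0) → ξ = 0 := by
    intro ξ H
    refine fock_eq_zero fun n v => ?_
    have h1 : inner ℂ ξ (symVec v) = 0 := by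
      refine inner_symVec_eq_zero_of_dense hd (fun w hw => ?_) v
      exact H (symVec w, _) (Submodule.subset_span ⟨n, fun i => ⟨w i, hw i⟩, rfl⟩)
    rw [← inner_conj_symm, h1, map_zero]
  exact (isFlow_fockFlow hV.isFlow).essSelfAdjoint (dGammaCore_le hV) hdense
    (dGammaCore_invariant hV)

theorem isUnitaryGroup_dGamma (hd : Dense (h.domain : Set F)) :
    IsUnitaryGroup (dGamma h) (fockFlow hV.isFlow) :=
  (isFlow_fockFlow hV.isFlow).isUnitaryGroup_closure (essSelfAdjoint_dGammaCore hV hd)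
    (dGammaCore_le hV)

theorem dGamma_graph (hd : Dense (h.domain : Set F)) :
    (dGamma h).graph = genGraph (fockFlow hV.isFlow) :=
  (isUnitaryGroup_dGamma hV hd).graph_eq

end

end SecondQuantization

/-! ### Systems coupled to a bath -/

/-- The operators on the Hilbert space `𝓗` of a system `S` coupled to a Bose field over `F`:
ampliations of the system operators, the projections `proj n` onto the `n`-particle spaces, and the
bounded restrictions `ann f n` (`cre f n`) of the annihilation (creation) operators to the spaces
of `n + 1` (`n`) particles. -/
structure CoupledBath (S F 𝓗 : Type*) [NormedAddCommGroup S] [InnerProductSpace ℂ S]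
    [CompleteSpace S] [NormedAddCommGroup F] [InnerProductSpace ℂ F] [NormedAddCommGroup 𝓗]
    [InnerProductSpace ℂ 𝓗] [CompleteSpace 𝓗] where
  amp : (S →L[ℂ] S) →⋆ₐ[ℂ] (𝓗 →L[ℂ] 𝓗)
  proj : ℕ → 𝓗 →L[ℂ] 𝓗
  ann : F → ℕ → 𝓗 →L[ℂ] 𝓗
  cre : F → ℕ → 𝓗 →L[ℂ] 𝓗
  inner_proj : ∀ n x y, inner ℂ (proj n x) y = inner ℂ x (proj n y)
  proj_proj : ∀ n x, proj n (proj n x) = proj n x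
  proj_proj_of_ne : ∀ m n x, m ≠ n → proj n (proj m x) = 0
  tendsto_proj : ∀ x, Filter.Tendsto (fun m => ∑ n ∈ Finset.range m, proj n x) Filter.atTop (nhds x)
  inner_ann : ∀ f n x y, inner ℂ x (ann f n y) = inner ℂ (cre f n x) y
  ann_proj : ∀ f n x, ann f n (proj (n + 1) x) = ann f n x
  proj_ann : ∀ f n x, proj n (ann f n x) = ann f n x
  norm_ann_le : ∀ f n x, ‖ann f n x‖ ≤ Real.sqrt (n + 1) * ‖f‖ * ‖x‖
  ann_cre_zero : ∀ f g x, ann f 0 (cre g 0 x) = inner ℂ f g • proj 0 x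
  ann_cre_succ : ∀ f g n x,
    ann f (n + 1) (cre g (n + 1) x) = inner ℂ f g • proj (n + 1) x + cre g n (ann f n x)
  ann_comm : ∀ f g n x, ann f n (ann g (n + 1) x) = ann g n (ann f (n + 1) x)
  amp_proj : ∀ T n x, amp T (proj n x) = proj n (amp T x)
  amp_ann : ∀ T f n x, amp T (ann f n x) = ann f n (amp T x)

section SystemBath

open UniformSpace (Completion)
open Filter Topology

variable {S F : Type*} [NormedAddCommGroup S] [InnerProductSpace ℂ S]
  [NormedAddCommGroup F] [InnerProductSpace ℂ F]

/-- The inclusion of an inner product space into its completion. -/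
def completionIncl (E : Type*) [NormedAddCommGroup E] [InnerProductSpace ℂ E] :
    E →ₗᵢ[ℂ] Completion E := Completion.toComplₗᵢ

variable (S F) in
/-- The inclusion of the algebraic tensor product. -/
def ofTensor : S ⊗[ℂ] Fock F →ₗᵢ[ℂ] SysBath S F :=
  completionIncl (S ⊗[ℂ] Fock F)

theorem denseRange_ofTensor : DenseRange (ofTensor S F) :=
  Completion.denseRange_coe (α := S ⊗[ℂ] Fock F)

/-- The operator `ψ ↦ x ⊗ ψ`. -/
def tensLeft (x : S) : Fock F →L[ℂ] SysBath S F :=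
  (ofTensor S F).toContinuousLinearMap.comp (TensorProduct.mkL ℂ S (Fock F) x)

theorem tensLeft_apply (x : S) (ψ : Fock F) : tensLeft x ψ = tens x ψ := rfl

/-- The operator `x ↦ x ⊗ ψ`. -/
def tensRight (ψ : Fock F) : S →L[ℂ] SysBath S F :=
  (ofTensor S F).toContinuousLinearMap.comp ((TensorProduct.mkL ℂ S (Fock F)).flip ψ)

theorem tensRight_apply (x : S) (ψ : Fock F) : tensRight ψ x = tens x ψ := rfl

theorem dense_span_tens :
    Dense (Submodule.span ℂ {ξ : SysBath S F | ∃ x ψ, ξ = tens x ψ} : Set (SysBath S F)) := by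
  refine denseRange_ofTensor.mono ?_
  rintro _ ⟨z, rfl⟩
  rw [SetLike.mem_coe]
  induction z using TensorProduct.induction_on with
  | zero => rw [LinearIsometry.map_zero]; exact zero_mem _
  | tmul x ψ => exact Submodule.subset_span ⟨x, ψ, rfl⟩
  | add z w hz hw => rw [map_add]; exact add_mem hz hw

theorem sysBath_eq_zero {ξ : SysBath S F}
    (h : ∀ (x : S) (n : ℕ) (v : Fin n → F), inner ℂ ξ (tens x (symVec v)) = 0) : ξ = 0 := by
  have h2 : ∀ x (ψ : Fock F), inner ℂ ξ (tens x ψ) = 0 := by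
    intro x ψ
    have h3 : (innerSL ℂ ξ).comp (tensLeft x) = 0 := fock_clm_ext fun n v => h x n v
    exact DFunLike.congr_fun h3 ψ
  refine eq_zero_of_inner_dense_span dense_span_tens ?_
  rintro _ ⟨x, ψ, rfl⟩
  rw [← inner_conj_symm, h2, map_zero]

theorem sysBath_clm_ext {E : Type*} [NormedAddCommGroup E] [NormedSpace ℂ E]
    {T T' : SysBath S F →L[ℂ] E}
    (h : ∀ x ψ, T (tens x ψ) = T' (tens x ψ)) : T = T' := by
  refine ContinuousLinearMap.ext_on dense_span_tens ?_
  rintro _ ⟨x, ψ, rfl⟩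
  exact h x ψ

variable (S) in
/-- The operator `I_S ⊗ T` for a bounded operator `T` on the Fock space. -/
def lift (T : Fock F →L[ℂ] Fock F) : SysBath S F →L[ℂ] SysBath S F :=
  (show Completion (S ⊗[ℂ] Fock F) →L[ℂ] Completion (S ⊗[ℂ] Fock F) from
    (T.lTensor S).completion)

theorem lift_ofTensor (T : Fock F →L[ℂ] Fock F) (z : S ⊗[ℂ] Fock F) :
    lift S T (ofTensor S F z) = ofTensor S F (T.lTensor S z) :=
  ContinuousLinearMap.completion_apply_coe (T.lTensor S) z

theorem lift_tens (T : Fock F →L[ℂ] Fock F) (x : S) (ψ : Fock F) :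
    lift S T (tens x ψ) = tens x (T ψ) := lift_ofTensor T (x ⊗ₜ[ℂ] ψ)

theorem norm_lift_apply_le (T : Fock F →L[ℂ] Fock F) (ξ : SysBath S F) :
    ‖lift S T ξ‖ ≤ ‖T‖ * ‖ξ‖ := by
  refine denseRange_ofTensor.induction_on (p := fun ξ => ‖lift S T ξ‖ ≤ ‖T‖ * ‖ξ‖) ξ
    (isClosed_le (by fun_prop) (by fun_prop)) fun z => ?_
  rw [lift_ofTensor, LinearIsometry.norm_map, LinearIsometry.norm_map]
  refine ((T.lTensor S).le_opNorm z).trans ?_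
  exact mul_le_mul_of_nonneg_right (ContinuousLinearMap.norm_lTensor_le (𝕜 := ℂ) (G := S) T)
    (norm_nonneg z)

theorem lift_lift (T T' : Fock F →L[ℂ] Fock F) (ξ : SysBath S F) :
    lift S T (lift S T' ξ) = lift S (T.comp T') ξ := by
  refine DFunLike.congr_fun (sysBath_clm_ext (T := (lift S T).comp (lift S T'))
    (T' := lift S (T.comp T')) fun x ψ => ?_) ξ
  simp only [ContinuousLinearMap.comp_apply, lift_tens]

theorem lift_add (T T' : Fock F →L[ℂ] Fock F) : lift S (T + T') = lift S T + lift S T' := by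
  refine sysBath_clm_ext fun x ψ => ?_
  simp only [add_apply, lift_tens]
  simp only [← tensLeft_apply, map_add]

theorem lift_smul (c : ℂ) (T : Fock F →L[ℂ] Fock F) : lift S (c • T) = c • lift S T := by
  refine sysBath_clm_ext fun x ψ => ?_
  simp only [smul_apply, lift_tens]
  simp only [← tensLeft_apply, map_smul]

theorem lift_zero : lift S (0 : Fock F →L[ℂ] Fock F) = 0 := by
  refine sysBath_clm_ext fun x ψ => ?_
  simp only [zero_apply, lift_tens]
  simp only [← tensLeft_apply, map_zero]

theorem lift_one : lift S (1 : Fock F →L[ℂ] Fock F) = 1 := by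
  refine sysBath_clm_ext fun x ψ => ?_
  simp only [lift_tens, one_apply_eq_self]

theorem inner_lift {T T' : Fock F →L[ℂ] Fock F}
    (h : ∀ ψ η, inner ℂ ψ (T η) = inner ℂ (T' ψ) η) (ξ ζ : SysBath S F) :
    inner ℂ ξ (lift S T ζ) = inner ℂ (lift S T' ξ) ζ := by
  rw [← ContinuousLinearMap.adjoint_inner_left]
  congr 1
  refine DFunLike.congr_fun (sysBath_clm_ext
    (T := ContinuousLinearMap.adjoint (lift S T)) (T' := lift S T') fun x ψ => ?_) ξ
  rw [← sub_eq_zero]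
  refine sysBath_eq_zero fun y n v => ?_
  rw [inner_sub_left, ContinuousLinearMap.adjoint_inner_left, lift_tens, lift_tens, inner_tens,
    inner_tens, h, sub_self]

theorem ampliation_lift (X : S →L[ℂ] S) (T : Fock F →L[ℂ] Fock F) (ξ : SysBath S F) :
    ampliation F X (lift S T ξ) = lift S T (ampliation F X ξ) := by
  refine DFunLike.congr_fun (sysBath_clm_ext (T := (ampliation F X).comp (lift S T))
    (T' := (lift S T).comp (ampliation F X)) fun x ψ => ?_) ξ
  simp only [ContinuousLinearMap.comp_apply, lift_tens, ampliation_tens]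

variable (F) in
/-- The ampliation of system operators as a homomorphism of `*`-algebras. -/
def ampliationHom [CompleteSpace S] :
    (S →L[ℂ] S) →⋆ₐ[ℂ] (SysBath S F →L[ℂ] SysBath S F) where
  toFun := ampliation F
  map_one' := sysBath_clm_ext fun x ψ => by simp only [ampliation_tens, one_apply_eq_self]
  map_mul' X Y := sysBath_clm_ext fun x ψ => by
    change _ = ampliation F X (ampliation F Y (tens x ψ))
    simp only [ampliation_tens]
    rfl
  map_zero' := sysBath_clm_ext fun x ψ => by
    simp only [ampliation_tens, zero_apply]
    simp only [← tensRight_apply, map_zero]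
  map_add' X Y := sysBath_clm_ext fun x ψ => by
    simp only [ampliation_tens, add_apply]
    simp only [← tensRight_apply, map_add]
  commutes' c := sysBath_clm_ext fun x ψ => by
    simp only [ampliation_tens, Algebra.algebraMap_eq_smul_one, smul_apply, one_apply_eq_self]
    simp only [← tensRight_apply, map_smul]
  map_star' X := by
    refine sysBath_clm_ext fun x ψ => ?_
    rw [← sub_eq_zero]
    refine sysBath_eq_zero fun y n v => ?_
    rw [ContinuousLinearMap.star_eq_adjoint, ContinuousLinearMap.star_eq_adjoint, inner_sub_left,
      ContinuousLinearMap.adjoint_inner_left, ampliation_tens, ampliation_tens, inner_tens,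
      inner_tens, ContinuousLinearMap.adjoint_inner_left, sub_self]

theorem sum_fockProj_symm (m : ℕ) (ψ η : Fock F) :
    inner ℂ ψ ((∑ n ∈ Finset.range m, fockProj F n) η) =
      inner ℂ ((∑ n ∈ Finset.range m, fockProj F n) ψ) η := by
  simp only [sum_apply, inner_sum, sum_inner, inner_fockProj]

/-- A symmetric idempotent `Q` satisfies `‖Qψ‖² = ⟨Qψ, ψ⟩`, so it is a contraction by
Cauchy–Schwarz. -/
theorem norm_sum_fockProj_le (m : ℕ) : ‖∑ n ∈ Finset.range m, fockProj F n‖ ≤ 1 := by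
  set Q := ∑ n ∈ Finset.range m, fockProj F n with hQ
  have hQQ : ∀ ψ, Q (Q ψ) = Q ψ := by
    intro ψ
    simp only [hQ, sum_apply, map_sum]
    refine Finset.sum_congr rfl fun n hn => ?_
    rw [Finset.sum_eq_single_of_mem n hn, fockProj_fockProj]
    intro k _ hk
    exact fockProj_fockProj_of_ne hk.symm ψ
  refine ContinuousLinearMap.opNorm_le_bound _ zero_le_one fun ψ => ?_
  rw [one_mul]
  have h1 : ‖Q ψ‖ * ‖Q ψ‖ ≤ ‖Q ψ‖ * ‖ψ‖ := by
    have h2 : inner ℂ (Q ψ) (Q ψ) = inner ℂ (Q ψ) ψ := by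
      rw [sum_fockProj_symm m, hQQ]
    have h3 := norm_inner_le_norm (𝕜 := ℂ) (Q ψ) ψ
    rw [← h2] at h3
    have h4 : ‖inner ℂ (Q ψ) (Q ψ)‖ = ‖Q ψ‖ * ‖Q ψ‖ := by
      rw [inner_self_eq_norm_sq_to_K]
      simp [sq]
    rwa [h4] at h3
  rcases (norm_nonneg (Q ψ)).eq_or_lt with h | h
  · rw [← h]; exact norm_nonneg ψ
  · exact le_of_mul_le_mul_left h1 h

theorem tendsto_lift_proj (ξ : SysBath S F) :
    Tendsto (fun m => ∑ n ∈ Finset.range m, lift S (fockProj F n) ξ) atTop (𝓝 ξ) := by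
  have hsum : ∀ m ξ, ∑ n ∈ Finset.range m, lift S (fockProj F n) ξ =
      lift S (∑ n ∈ Finset.range m, fockProj F n) ξ := by
    intro m ξ
    induction m with
    | zero => simp [lift_zero]
    | succ m ih => rw [Finset.sum_range_succ, Finset.sum_range_succ, lift_add, ih, add_apply]
  have hb : ∀ m (ξ : SysBath S F), ‖lift S (∑ n ∈ Finset.range m, fockProj F n) ξ‖ ≤ ‖ξ‖ := by
    intro m ξ
    refine (norm_lift_apply_le _ _).trans ?_
    exact mul_le_of_le_one_left (norm_nonneg _) (norm_sum_fockProj_le m)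
  simp only [hsum]
  have h1 : ∀ ζ ∈ Submodule.span ℂ {ξ : SysBath S F | ∃ x ψ, ξ = tens x ψ},
      Tendsto (fun m => lift S (∑ n ∈ Finset.range m, fockProj F n) ζ) atTop (𝓝 ζ) := by
    intro ζ hζ
    induction hζ using Submodule.span_induction with
    | mem x hx =>
      obtain ⟨x, ψ, rfl⟩ := hx
      simp only [lift_tens, sum_apply]
      simp only [← tensLeft_apply]
      exact ((tensLeft x).continuous.tendsto ψ).comp (hasSum_fockProj ψ).tendsto_sum_nat
    | zero => simp only [map_zero]; exact tendsto_const_nhds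
    | add x y _ _ hx hy => simp only [map_add]; exact hx.add hy
    | smul c x _ hx => simp only [map_smul]; exact hx.const_smul c
  rw [Metric.tendsto_atTop]
  intro ε hε
  obtain ⟨ζ, hζ, hd⟩ := Metric.mem_closure_iff.1 (dense_span_tens ξ) (ε / 3) (by linarith)
  obtain ⟨N, hN⟩ := Metric.tendsto_atTop.1 (h1 ζ hζ) (ε / 3) (by linarith)
  refine ⟨N, fun m hm => ?_⟩
  have h2 := hb m (ξ - ζ)
  rw [map_sub, ← dist_eq_norm, ← dist_eq_norm] at h2
  rw [dist_comm] at hd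
  have h3 := hN m hm
  have h4 := dist_triangle4 (lift S (∑ n ∈ Finset.range m, fockProj F n) ξ)
    (lift S (∑ n ∈ Finset.range m, fockProj F n) ζ) ζ ξ
  rw [dist_comm ξ ζ] at h2
  linarith

theorem opNorm_annihilationPart_le (f : F) (n : ℕ) :
    ‖annihilationPart f n‖ ≤ Real.sqrt (n + 1) * ‖f‖ :=
  ContinuousLinearMap.opNorm_le_bound _ (by positivity) fun ψ => norm_annihilationPart_le f ψ

theorem inner_lift_annihilationPart (f : F) (n : ℕ) (ξ ζ : SysBath S F) :
    inner ℂ ξ (lift S (annihilationPart f n) ζ) = inner ℂ (lift S (creationPart f n) ξ) ζ :=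
  inner_lift (T := annihilationPart f n) (T' := creationPart f n)
    (fun ψ η => inner_annihilationPart_right f ψ η) ξ ζ

theorem lift_annihilationPart_fockProj (f : F) (n : ℕ) (ξ : SysBath S F) :
    lift S (annihilationPart f n) (lift S (fockProj F (n + 1)) ξ) =
      lift S (annihilationPart f n) ξ := by
  rw [lift_lift, show (annihilationPart f n).comp (fockProj F (n + 1)) = annihilationPart f n from
    ContinuousLinearMap.ext fun ψ => annihilationPart_fockProj (n := n) f ψ]

theorem lift_fockProj_annihilationPart (f : F) (n : ℕ) (ξ : SysBath S F) :
    lift S (fockProj F n) (lift S (annihilationPart f n) ξ) =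
      lift S (annihilationPart f n) ξ := by
  rw [lift_lift, show (fockProj F n).comp (annihilationPart f n) = annihilationPart f n from
    ContinuousLinearMap.ext fun ψ => fockProj_annihilationPart (n := n) f ψ]

theorem norm_lift_annihilationPart_le (f : F) (n : ℕ) (ξ : SysBath S F) :
    ‖lift S (annihilationPart f n) ξ‖ ≤ Real.sqrt (n + 1) * ‖f‖ * ‖ξ‖ :=
  (norm_lift_apply_le _ ξ).trans
    (mul_le_mul_of_nonneg_right (opNorm_annihilationPart_le f n) (norm_nonneg ξ))

theorem lift_annihilationPart_creationPart_succ (f g : F) (n : ℕ) (ξ : SysBath S F) :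
    lift S (annihilationPart f (n + 1)) (lift S (creationPart g (n + 1)) ξ) =
      inner ℂ f g • lift S (fockProj F (n + 1)) ξ +
        lift S (creationPart g n) (lift S (annihilationPart f n) ξ) := by
  rw [lift_lift, annihilationPart_creationPart_succ, lift_add, lift_smul, add_apply, smul_apply]
  congr 1
  exact (lift_lift _ _ _).symm

theorem lift_annihilationPart_comm (f g : F) (n : ℕ) (ξ : SysBath S F) :
    lift S (annihilationPart f n) (lift S (annihilationPart g (n + 1)) ξ) =
      lift S (annihilationPart g n) (lift S (annihilationPart f (n + 1)) ξ) := by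
  rw [lift_lift, lift_lift, annihilationPart_comm]

variable (S F) in
/-- The system coupled to the Bose field. -/
def sysBath [CompleteSpace S] : CoupledBath S F (SysBath S F) where
  amp := ampliationHom F
  proj n := lift S (fockProj F n)
  ann f n := lift S (annihilationPart f n)
  cre f n := lift S (creationPart f n)
  inner_proj n x y := (inner_lift (fun ψ η => (inner_fockProj ψ η).symm) x y).symm
  proj_proj n x := by
    rw [lift_lift]
    congr 1
    exact congrArg _ (ContinuousLinearMap.ext fun ψ => fockProj_fockProj ψ)
  proj_proj_of_ne m n x h := by
    rw [lift_lift, show (fockProj F n).comp (fockProj F m) = 0 from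
      ContinuousLinearMap.ext fun ψ => fockProj_fockProj_of_ne h ψ, lift_zero, zero_apply]
  tendsto_proj := tendsto_lift_proj
  inner_ann := inner_lift_annihilationPart
  ann_proj := lift_annihilationPart_fockProj
  proj_ann := lift_fockProj_annihilationPart
  norm_ann_le := norm_lift_annihilationPart_le
  ann_cre_zero f g x := by
    rw [lift_lift, annihilationPart_creationPart_zero, lift_smul, smul_apply]
  ann_cre_succ := lift_annihilationPart_creationPart_succ
  ann_comm := lift_annihilationPart_comm
  amp_proj T n x := ampliation_lift T _ x
  amp_ann T f n x := ampliation_lift T _ x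

/-! ### The free evolution -/

/-- The second quantization of a flow, on the Hilbert space of system and bath. -/
def bathFlow (S : Type*) [NormedAddCommGroup S] [InnerProductSpace ℂ S] {V : ℝ → F →L[ℂ] F}
    (hV : IsFlow V) (t : ℝ) : SysBath S F →L[ℂ] SysBath S F := lift S (fockFlow hV t)

theorem bathFlow_tens {V : ℝ → F →L[ℂ] F} (hV : IsFlow V) (t : ℝ) (x : S) (ψ : Fock F) :
    bathFlow S hV t (tens x ψ) = tens x (fockFlow hV t ψ) := lift_tens _ _ _

theorem isFlow_bathFlow {V : ℝ → F →L[ℂ] F} (hV : IsFlow V) : IsFlow (bathFlow S hV) := by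
  have hΓ := isFlow_fockFlow hV
  have hn : ∀ t (ξ : SysBath S F), ‖bathFlow S hV t ξ‖ = ‖ξ‖ := by
    intro t ξ
    have h1 : inner ℂ (bathFlow S hV t ξ) (bathFlow S hV t ξ) = inner ℂ ξ ξ := by
      rw [bathFlow, inner_lift (T' := fockFlow hV (-t))
        (fun ψ η => (hΓ.inner_neg_left t ψ η).symm), lift_lift]
      have : (fockFlow hV (-t)).comp (fockFlow hV t) = 1 :=
        ContinuousLinearMap.ext fun ψ => hΓ.neg_apply t ψ
      rw [this, lift_one, one_apply_eq_self]
    rw [norm_eq_sqrt_re_inner (𝕜 := ℂ), h1, ← norm_eq_sqrt_re_inner]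
  refine ⟨?_, fun s t => ?_, hn, ?_⟩
  · rw [bathFlow, hΓ.map_zero, lift_one]
  · refine ContinuousLinearMap.ext fun ξ => ?_
    change lift S _ ξ = lift S _ (lift S _ ξ)
    rw [lift_lift, hΓ.map_add]
    rfl
  · refine continuous_of_dense_span dense_span_tens hn ?_
    rintro _ ⟨x, ψ, rfl⟩
    simp only [bathFlow_tens]
    simp only [← tensLeft_apply]
    exact (tensLeft x).continuous.comp (hΓ.strongly_continuous ψ)

/-- The pairs spanning the graph of the free Hamiltonian. -/
def freeCore (S : Type*) [NormedAddCommGroup S] [InnerProductSpace ℂ S] (h : F →ₗ.[ℂ] F) :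
    Submodule ℂ (SysBath S F × SysBath S F) :=
  Submodule.span ℂ {p : SysBath S F × SysBath S F | ∃ (x : S) (ψ η : Fock F),
      (ψ, η) ∈ (dGamma h).graph ∧ p = (tens x ψ, tens x η)}

section

variable {h : F →ₗ.[ℂ] F} {V : ℝ → F →L[ℂ] F} (hV : IsUnitaryGroup h V)
  (hd : Dense (h.domain : Set F))
include hV hd

theorem tens_mem_genGraph (x : S) {p : Fock F × Fock F} (hp : p ∈ (dGamma h).graph) :
    (tens x p.1, tens x p.2) ∈ genGraph (bathFlow S hV.isFlow) := by
  rw [dGamma_graph hV hd] at hp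
  exact map_mem_genGraph (T := tensLeft x) (fun t ψ => bathFlow_tens hV.isFlow t x ψ) hp

theorem symVec_mem_dGamma_graph {n : ℕ} (v : Fin n → F) (hv : ∀ i, v i ∈ h.domain) :
    ∃ η, (symVec v, η) ∈ (dGamma h).graph := by
  refine ⟨∑ k, symVec (Function.update v k (h ⟨v k, hv k⟩)), ?_⟩
  rw [dGamma_eq, (essSelfAdjoint_dGammaCore hV hd).closure.graph_toLinearPMap]
  exact Submodule.le_topologicalClosure _ (Submodule.subset_span ⟨n, fun i => ⟨v i, hv i⟩, rfl⟩)

theorem freeCore_le : freeCore S h ≤ genGraph (bathFlow S hV.isFlow) := by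
  refine Submodule.span_le.2 ?_
  rintro _ ⟨x, ψ, η, hp, rfl⟩
  exact tens_mem_genGraph hV hd x (p := (ψ, η)) hp

omit hV in
theorem eq_zero_of_inner_tens_symVec {ξ : SysBath S F}
    (H : ∀ (x : S) (n : ℕ) (v : Fin n → F), (∀ i, v i ∈ h.domain) →
      inner ℂ ξ (tens x (symVec v)) = 0) : ξ = 0 := by
  refine sysBath_eq_zero fun x n v => ?_
  have h1 : inner ℂ (ContinuousLinearMap.adjoint (tensLeft x) ξ) (symVec v) = 0 := by
    refine inner_symVec_eq_zero_of_dense hd (fun w hw => ?_) v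
    rw [ContinuousLinearMap.adjoint_inner_left]
    exact H x n w hw
  rwa [ContinuousLinearMap.adjoint_inner_left] at h1

theorem isUnitaryGroup_freeHamiltonian :
    IsUnitaryGroup (freeHamiltonian S h) (bathFlow S hV.isFlow) ∧
      EssSelfAdjoint (freeCore S h) := by
  have hG : IsFlow (bathFlow S hV.isFlow) := isFlow_bathFlow hV.isFlow
  have hdense : ∀ ξ : SysBath S F, (∀ p ∈ freeCore S h, inner ℂ ξ p.1 = 0) → ξ = 0 := by
    intro ξ H
    refine eq_zero_of_inner_tens_symVec hd fun x n v hv => ?_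
    obtain ⟨η, hη⟩ := symVec_mem_dGamma_graph hV hd v hv
    exact H (_, _) (Submodule.subset_span ⟨x, _, η, hη, rfl⟩)
  have hinv : ∀ p ∈ freeCore S h, ∀ t,
      (bathFlow S hV.isFlow t p.1, bathFlow S hV.isFlow t p.2) ∈ freeCore S h := by
    intro p hp t
    refine prod_mem_span ?_ hp
    rintro _ ⟨x, ψ, η, hp, rfl⟩
    refine Submodule.subset_span ⟨x, fockFlow hV.isFlow t ψ, fockFlow hV.isFlow t η, ?_, ?_⟩
    · rw [dGamma_graph hV hd] at hp ⊢
      exact (isFlow_fockFlow hV.isFlow).genGraph_invariant hp t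
    · rw [bathFlow_tens, bathFlow_tens]
  have hess := hG.essSelfAdjoint (freeCore_le hV hd) hdense hinv
  exact ⟨hG.isUnitaryGroup_closure hess (freeCore_le hV hd), hess⟩

theorem dense_freeHamiltonian_domain :
    Dense ((freeHamiltonian S h).domain : Set (SysBath S F)) :=
  (isUnitaryGroup_freeHamiltonian hV hd).2.closure.dense_fst

end

end SystemBath

/-! ### Sums over particle numbers -/

section Sequences

open Filter Topology

/-- Otherwise `a m ≥ c / (m + 1)` for all large `m` and some `c > 0`, against the divergence of the
harmonic series. The full sequence need not converge. -/
theorem exists_tendsto_mul_of_summable {a : ℕ → ℝ} (h0 : ∀ m, 0 ≤ a m) (ha : Summable a) :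
    ∃ φ : ℕ → ℕ, Tendsto φ atTop atTop ∧
      Tendsto (fun k => ((φ k : ℝ) + 1) * a (φ k)) atTop (𝓝 0) := by
  have key : ∀ k : ℕ, ∃ m, k ≤ m ∧ ((m : ℝ) + 1) * a m < 1 / ((k : ℝ) + 1) := by
    intro k
    by_contra! hcon
    have h1 : Summable fun m : ℕ => 1 / ((k : ℝ) + 1) * (1 / (((m + k : ℕ) : ℝ) + 1)) := by
      refine Summable.of_nonneg_of_le (fun m => by positivity) (fun m => ?_)
        ((summable_nat_add_iff k).2 ha)
      have h2 := hcon (m + k) (Nat.le_add_left k m)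
      rw [mul_one_div, div_le_iff₀ (by positivity), mul_comm]
      exact h2
    have h3 : Summable fun m : ℕ => 1 / (((m + k : ℕ) : ℝ) + 1) :=
      (summable_mul_left_iff (by positivity)).1 h1
    have h4 : Summable fun m : ℕ => 1 / ((m : ℝ) + 1) := (summable_nat_add_iff k).1 h3
    have h5 : Summable fun m : ℕ => 1 / (m : ℝ) :=
      (summable_nat_add_iff 1).1 (by simpa using h4)
    exact Real.not_summable_one_div_natCast h5
  choose φ hφ1 hφ2 using key
  refine ⟨φ, tendsto_atTop_mono hφ1 tendsto_id, ?_⟩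
  exact squeeze_zero (fun k => mul_nonneg (by positivity) (h0 _)) (fun k => (hφ2 k).le)
    tendsto_one_div_add_atTop_nhds_zero_nat

end Sequences

namespace CoupledBath

open Filter Topology

variable {S F 𝓗 : Type*} [NormedAddCommGroup S] [InnerProductSpace ℂ S]
  [CompleteSpace S] [NormedAddCommGroup F] [InnerProductSpace ℂ F] [NormedAddCommGroup 𝓗]
  [InnerProductSpace ℂ 𝓗] [CompleteSpace 𝓗] (M : CoupledBath S F 𝓗)

/-- The annihilation operator on the `n`-particle space. -/
def low (g : F) : ℕ → 𝓗 →L[ℂ] 𝓗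
  | 0 => 0
  | n + 1 => M.ann g n

/-- The component with values in the `n`-particle space of the creation operator. -/
def raise (g : F) : ℕ → 𝓗 →L[ℂ] 𝓗
  | 0 => 0
  | n + 1 => M.cre g n

theorem inner_amp (T : S →L[ℂ] S) (x y : 𝓗) :
    inner ℂ x (M.amp T y) = inner ℂ (M.amp (ContinuousLinearMap.adjoint T) x) y := by
  rw [← ContinuousLinearMap.star_eq_adjoint, map_star, ContinuousLinearMap.star_eq_adjoint,
    ContinuousLinearMap.adjoint_inner_left]

theorem inner_amp_left (T : S →L[ℂ] S) (x y : 𝓗) :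
    inner ℂ (M.amp T x) y = inner ℂ x (M.amp (ContinuousLinearMap.adjoint T) y) := by
  rw [inner_amp, ContinuousLinearMap.adjoint_adjoint]

theorem inner_cre (g : F) (n : ℕ) (x y : 𝓗) :
    inner ℂ x (M.cre g n y) = inner ℂ (M.ann g n x) y := by
  rw [← inner_conj_symm, ← M.inner_ann, inner_conj_symm]

theorem inner_ann_left (g : F) (n : ℕ) (x y : 𝓗) :
    inner ℂ (M.ann g n x) y = inner ℂ x (M.cre g n y) := (M.inner_cre g n x y).symm

theorem inner_raise (g : F) (n : ℕ) (x y : 𝓗) :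
    inner ℂ x (M.raise g n y) = inner ℂ (M.low g n x) y := by
  cases n with
  | zero => simp [raise, low]
  | succ n => exact M.inner_cre g n x y

theorem inner_low (g : F) (n : ℕ) (x y : 𝓗) :
    inner ℂ x (M.low g n y) = inner ℂ (M.raise g n x) y := by
  cases n with
  | zero => simp [raise, low]
  | succ n => exact M.inner_ann g n x y

theorem low_proj (g : F) (n : ℕ) (x : 𝓗) : M.low g n (M.proj n x) = M.low g n x := by
  cases n with
  | zero => simp [low]
  | succ n => exact M.ann_proj g n x

theorem proj_raise (g : F) (n : ℕ) (x : 𝓗) : M.proj n (M.raise g n x) = M.raise g n x := by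
  refine ext_inner_left ℂ fun y => ?_
  rw [← M.inner_proj, inner_raise, low_proj, inner_raise]

theorem amp_raise (T : S →L[ℂ] S) (g : F) (n : ℕ) (x : 𝓗) :
    M.amp T (M.raise g n x) = M.raise g n (M.amp T x) := by
  cases n with
  | zero => simp [raise]
  | succ n =>
    refine ext_inner_left ℂ fun y => ?_
    change inner ℂ y (M.amp T (M.cre g n x)) = inner ℂ y (M.cre g n (M.amp T x))
    rw [inner_amp, inner_cre, inner_cre, inner_amp, M.amp_ann]

theorem amp_cre (T : S →L[ℂ] S) (g : F) (n : ℕ) (x : 𝓗) :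
    M.amp T (M.cre g n x) = M.cre g n (M.amp T x) := M.amp_raise T g (n + 1) x

theorem norm_proj_sq (n : ℕ) (x : 𝓗) :
    (‖M.proj n x‖ : ℂ) ^ 2 = inner ℂ x (M.proj n x) := by
  rw [← M.proj_proj n x, ← M.inner_proj, M.proj_proj]
  exact (inner_self_eq_norm_sq_to_K (𝕜 := ℂ) (M.proj n x)).symm

theorem norm_sum_proj_sq (m : ℕ) (x : 𝓗) :
    ∑ n ∈ Finset.range m, ‖M.proj n x‖ ^ 2 = ‖∑ n ∈ Finset.range m, M.proj n x‖ ^ 2 := by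
  have h : (∑ n ∈ Finset.range m, (‖M.proj n x‖ : ℂ) ^ 2) =
      inner ℂ (∑ n ∈ Finset.range m, M.proj n x) (∑ n ∈ Finset.range m, M.proj n x) := by
    rw [sum_inner]
    refine Finset.sum_congr rfl fun n hn => ?_
    rw [inner_sum, Finset.sum_eq_single_of_mem n hn]
    · rw [M.norm_proj_sq, M.inner_proj, M.proj_proj]
    · intro k _ hk
      rw [M.inner_proj, M.proj_proj_of_ne k n x hk, inner_zero_right]
  rw [inner_self_eq_norm_sq_to_K] at h
  exact Complex.ofReal_injective (by push_cast; exact h)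

theorem tendsto_inner_sum_proj (x y : 𝓗) :
    Tendsto (fun m => ∑ n ∈ Finset.range m, inner ℂ x (M.proj n y)) atTop (𝓝 (inner ℂ x y)) := by
  simp only [← inner_sum]
  exact ((innerSL ℂ x).continuous.tendsto y).comp (M.tendsto_proj y)

theorem hasSum_norm_proj_sq (x : 𝓗) : HasSum (fun n => ‖M.proj n x‖ ^ 2) (‖x‖ ^ 2) := by
  rw [hasSum_iff_tendsto_nat_of_nonneg (fun n => by positivity)]
  simp only [norm_sum_proj_sq]
  exact (M.tendsto_proj x).norm.pow 2

theorem sum_norm_proj_sq_le (m : ℕ) (x : 𝓗) :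
    ∑ n ∈ Finset.range m, ‖M.proj n x‖ ^ 2 ≤ ‖x‖ ^ 2 :=
  sum_le_hasSum _ (fun n _ => by positivity) (M.hasSum_norm_proj_sq x)

theorem norm_sum_proj_le (m : ℕ) (x : 𝓗) : ‖∑ n ∈ Finset.range m, M.proj n x‖ ≤ ‖x‖ := by
  refine le_of_sq_le_sq ?_ (norm_nonneg _)
  rw [← norm_sum_proj_sq]
  exact M.sum_norm_proj_sq_le m x

/-- Cauchy–Schwarz and orthogonality of the sectors. The shifts `j`, `k` are needed because boundary
fluxes couple different particle numbers. -/
theorem sum_norm_proj_mul_le (m j k : ℕ) (x y : 𝓗) :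
    ∑ n ∈ Finset.range m, ‖M.proj (n + j) x‖ * ‖M.proj (n + k) y‖ ≤ ‖x‖ * ‖y‖ := by
  have hshift : ∀ (j : ℕ) (x : 𝓗), ∑ n ∈ Finset.range m, ‖M.proj (n + j) x‖ ^ 2 ≤ ‖x‖ ^ 2 := by
    intro j x
    refine le_trans ?_ (M.sum_norm_proj_sq_le (j + m) x)
    rw [Finset.sum_range_add]
    simp only [add_comm _ j]
    exact le_add_of_nonneg_left (Finset.sum_nonneg fun n _ => by positivity)
  refine (Real.sum_mul_le_sqrt_mul_sqrt _ _ _).trans ?_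
  refine mul_le_mul ?_ ?_ (Real.sqrt_nonneg _) (norm_nonneg _)
  · exact Real.sqrt_le_iff.2 ⟨norm_nonneg _, hshift j x⟩
  · exact Real.sqrt_le_iff.2 ⟨norm_nonneg _, hshift k y⟩

theorem summable_norm_proj_mul (j k : ℕ) (x y : 𝓗) :
    Summable fun n => ‖M.proj (n + j) x‖ * ‖M.proj (n + k) y‖ :=
  summable_of_sum_range_le (fun n => by positivity) fun m => M.sum_norm_proj_mul_le m j k x y

theorem norm_ann_le_proj (f : F) (n : ℕ) (x : 𝓗) :
    ‖M.ann f n x‖ ≤ Real.sqrt (n + 1) * ‖f‖ * ‖M.proj (n + 1) x‖ := by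
  rw [← M.ann_proj]
  exact M.norm_ann_le f n _

/-- Only the `n`-particle part of `x` and the `(n + 1)`-particle part of `y` contribute. The factor
`√(n + 1)` is weakened to `n + 1`, the largest growth that the harmonic-series argument tolerates.
-/
theorem norm_inner_amp_ann_le (T : S →L[ℂ] S) (f : F) (n : ℕ) (x y : 𝓗) :
    ‖inner ℂ x (M.amp T (M.ann f n y))‖ ≤
      (n + 1) * (‖M.amp T‖ * ‖f‖ * (‖M.proj n x‖ * ‖M.proj (n + 1) y‖)) := by
  rw [← M.proj_ann, M.amp_proj, ← M.inner_proj]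
  refine (norm_inner_le_norm _ _).trans ?_
  have h1 := (M.amp T).le_opNorm (M.ann f n y)
  have h2 := M.norm_ann_le_proj f n y
  have h3 : Real.sqrt ((n : ℝ) + 1) ≤ n + 1 :=
    Real.sqrt_le_self_iff.2 (Or.inr (by linarith [(Nat.cast_nonneg n : (0 : ℝ) ≤ n)]))
  calc ‖M.proj n x‖ * ‖M.amp T (M.ann f n y)‖
      ≤ ‖M.proj n x‖ * (‖M.amp T‖ * (((n : ℝ) + 1) * ‖f‖ * ‖M.proj (n + 1) y‖)) := by
        gcongr
        refine h1.trans ?_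
        gcongr
        refine h2.trans ?_
        gcongr
    _ = _ := by ring

end CoupledBath

/-! ### Essential self-adjointness of the total Hamiltonian -/

section TotalEssSelfAdjoint

open Filter Topology

variable {S F 𝓗 : Type*} [NormedAddCommGroup S] [InnerProductSpace ℂ S]
  [CompleteSpace S] [NormedAddCommGroup F] [InnerProductSpace ℂ F] [NormedAddCommGroup 𝓗]
  [InnerProductSpace ℂ 𝓗] [CompleteSpace 𝓗]

theorem IsFlow.snd_unique {E : Type*} [NormedAddCommGroup E] [InnerProductSpace ℂ E]
    {G : ℝ → E →L[ℂ] E} {x y z : E} (hy : (x, y) ∈ genGraph G) (hz : (x, z) ∈ genGraph G) :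
    y = z :=
  smul_right_injective E (neg_ne_zero.2 Complex.I_ne_zero) (HasDerivAt.unique hy hz)

/-- The span of `N` is a core of the free Hamiltonian made of vectors of fixed particle number. A
deficiency vector `ξ` of `T` has all `P_m ξ` in the domain of the free closure. There the free part
and `H` have real expectations, so `s ‖P_m ξ‖²` equals the net flux into sector `m`; the sums
telescope to a boundary term that vanishes along a subsequence. -/
theorem essSelfAdjoint_of_interaction (M : CoupledBath S F 𝓗) {H L : S →L[ℂ] S}
    (hH : IsSelfAdjoint H) (g : F) {G : ℝ → 𝓗 →L[ℂ] 𝓗}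
    (hGP : ∀ t n x, G t (M.proj n x) = M.proj n (G t x))
    {N : Set (𝓗 × 𝓗)} (hN : EssSelfAdjoint (Submodule.span ℂ N))
    {T : Submodule ℂ (𝓗 × 𝓗)} (hT : ∀ p ∈ T, ∀ q ∈ T, inner ℂ p.2 q.1 = inner ℂ p.1 q.2)
    (hNT : ∀ q ∈ N, q ∈ genGraph G ∧ ∃ n, M.proj n q.1 = q.1 ∧
      (q.1, q.2 + M.amp H q.1 + Complex.I • M.amp L (M.cre g n q.1) -
        Complex.I • M.amp (ContinuousLinearMap.adjoint L) (M.low g n q.1)) ∈ T) :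
    EssSelfAdjoint T where
  symm := hT
  dense ξ hξ := by
    refine hN.dense ξ fun p hp => ?_
    induction hp using Submodule.span_induction with
    | mem q hq =>
      obtain ⟨_, n, _, h⟩ := hNT q hq
      have h1 := hξ _ h
      exact h1
    | zero => simp
    | add x y _ _ hx hy => rw [Prod.fst_add, inner_add_right, hx, hy, add_zero]
    | smul c x _ hx => rw [Prod.smul_fst, inner_smul_right, hx, mul_zero]
  range_dense s hs ξ hξ := by
    have hH' : ContinuousLinearMap.adjoint H = H := hH.adjoint_eq
    set b : ℕ → ℂ := fun n => inner ℂ (M.amp L ξ) (M.ann g n ξ) with hb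
    -- The value of the free Hamiltonian at `P_m ξ`, found by solving the formal equation `(H_Tot +
    -- is) ξ = 0` in sector `m`.
    set ζ : ℕ → 𝓗 := fun m => -M.amp H (M.proj m ξ) - ((s : ℂ) * Complex.I) • M.proj m ξ +
      Complex.I • M.ann g m (M.amp (ContinuousLinearMap.adjoint L) ξ) -
      Complex.I • M.raise g m (M.amp L ξ) with hζ
    have hmem : ∀ m, (M.proj m ξ, ζ m) ∈ (Submodule.span ℂ N).topologicalClosure := by
      intro m
      refine hN.adjoint_mem fun p hp => ?_
      induction hp using Submodule.span_induction with
      | zero => simp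
      | add x y _ _ hx hy =>
        rw [Prod.fst_add, Prod.snd_add, inner_add_right, inner_add_right, hx, hy]
      | smul c x _ hx =>
        rw [Prod.smul_fst, Prod.smul_snd, inner_smul_right, inner_smul_right, hx]
      | mem q hq =>
        obtain ⟨hqG, n, hn, hq2⟩ := hNT q hq
        have hn2 : M.proj n q.2 = q.2 := by
          have h1 := map_mem_genGraph (T := M.proj n) (fun t x => hGP t n x) hqG
          rw [hn] at h1
          exact IsFlow.snd_unique h1 hqG
        have hproj : M.proj m (ζ m) = ζ m := by
          simp only [hζ, map_sub, map_add, map_neg, map_smul, ← M.amp_proj, M.proj_proj,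
            M.proj_ann, M.proj_raise]
        by_cases hmn : m = n
        · subst hmn
          have h1 := hξ _ hq2
          simp only [inner_sub_right, inner_add_right, inner_smul_right, M.inner_amp, hH',
            ContinuousLinearMap.adjoint_adjoint, M.inner_cre, M.inner_low] at h1
          rw [M.inner_proj, hn2]
          simp only [hζ, inner_sub_left, inner_add_left, inner_neg_left, inner_smul_left,
            M.amp_proj, M.inner_proj, hn, map_mul, Complex.conj_ofReal, Complex.conj_I]
          linear_combination h1
        -- For different particle numbers both sides vanish by orthogonality of the sectors.
        · rw [M.inner_proj, ← hn2, M.proj_proj_of_ne n m _ (Ne.symm hmn), inner_zero_right,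
            ← hproj, M.inner_proj, ← hn, M.proj_proj_of_ne n m _ (Ne.symm hmn), inner_zero_right]
    -- The imaginary part of `⟨P_m ξ, ζ m⟩` is zero; what remains is the flux `b m` across the upper
    -- boundary minus that across the lower one.
    have hre' : ∀ m, s * ‖M.proj m ξ‖ ^ 2 =
        (b m).re - (inner ℂ (M.low g m ξ) (M.amp L ξ)).re := by
      intro m
      have h1 : (inner ℂ (M.proj m ξ) (ζ m)).im = 0 := hN.closure.inner_real (hmem m)
      have h2 : (inner ℂ (M.proj m ξ) (M.amp H (M.proj m ξ))).im = 0 := by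
        have h3 := M.inner_amp H (M.proj m ξ) (M.proj m ξ)
        rw [hH', ← inner_conj_symm] at h3
        rw [← inner_conj_symm, Complex.conj_im, Complex.conj_eq_iff_im.1 h3, neg_zero]
      have h3 : inner ℂ (M.proj m ξ) (M.ann g m (M.amp (ContinuousLinearMap.adjoint L) ξ)) =
          b m := by
        rw [M.inner_proj, M.proj_ann, ← M.amp_ann, M.inner_amp,
          ContinuousLinearMap.adjoint_adjoint]
      have h4 : inner ℂ (M.proj m ξ) (M.raise g m (M.amp L ξ)) =
          inner ℂ (M.low g m ξ) (M.amp L ξ) := by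
        rw [M.inner_raise, M.low_proj]
      have h5 : inner ℂ (M.proj m ξ) (M.proj m ξ) = ((‖M.proj m ξ‖ ^ 2 : ℝ) : ℂ) := by
        rw [inner_self_eq_norm_sq_to_K]; norm_cast
      simp only [hζ, inner_sub_right, inner_add_right, inner_neg_right, inner_smul_right, h3, h4,
        h5, Complex.sub_im, Complex.add_im, Complex.neg_im, h2, Complex.mul_im, Complex.mul_re,
        Complex.I_re, Complex.I_im, Complex.ofReal_re, Complex.ofReal_im] at h1
      linarith
    have hre0 : s * ‖M.proj 0 ξ‖ ^ 2 = (b 0).re := by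
      rw [hre' 0]
      simp [CoupledBath.low]
    have hre : ∀ m, s * ‖M.proj (m + 1) ξ‖ ^ 2 = (b (m + 1)).re - (b m).re := by
      intro m
      rw [hre' (m + 1), ← inner_conj_symm, Complex.conj_re]
      rfl
    have hsum : ∀ m, s * ∑ n ∈ Finset.range (m + 1), ‖M.proj n ξ‖ ^ 2 = (b m).re := by
      intro m
      induction m with
      | zero => simpa using hre0
      | succ m ih => rw [Finset.sum_range_succ, mul_add, ih, hre]; ring
    have hbd : ∀ m : ℕ, |s| * ∑ n ∈ Finset.range (m + 1), ‖M.proj n ξ‖ ^ 2 ≤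
        ‖M.amp (ContinuousLinearMap.adjoint L)‖ * ‖g‖ *
          (((m : ℝ) + 1) * (‖M.proj (m + 0) ξ‖ * ‖M.proj (m + 1) ξ‖)) := by
      intro m
      have h1 := M.norm_inner_amp_ann_le (ContinuousLinearMap.adjoint L) g m ξ ξ
      rw [M.inner_amp, ContinuousLinearMap.adjoint_adjoint] at h1
      have h2 := (Complex.abs_re_le_norm (b m)).trans h1
      rw [← hsum, abs_mul, abs_of_nonneg (a := ∑ n ∈ Finset.range (m + 1), ‖M.proj n ξ‖ ^ 2)
        (Finset.sum_nonneg fun n _ => by positivity)] at h2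
      refine h2.trans (le_of_eq ?_)
      rw [add_zero]; ring
    obtain ⟨φ, hφ, hlim⟩ := exists_tendsto_mul_of_summable (fun m => by positivity)
      (M.summable_norm_proj_mul 0 1 ξ ξ)
    have hl1 : Tendsto (fun k => |s| * ∑ n ∈ Finset.range (φ k + 1), ‖M.proj n ξ‖ ^ 2) atTop
        (𝓝 (|s| * ‖ξ‖ ^ 2)) :=
      (((M.hasSum_norm_proj_sq ξ).tendsto_sum_nat.comp
        ((tendsto_add_atTop_nat 1).comp hφ))).const_mul _
    have hl2 := hlim.const_mul (‖M.amp (ContinuousLinearMap.adjoint L)‖ * ‖g‖)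
    have h3 := le_of_tendsto_of_tendsto' hl1 hl2 fun k => hbd (φ k)
    rw [mul_zero] at h3
    have h4 : ‖ξ‖ ^ 2 ≤ 0 := by
      by_contra hcon
      exact absurd h3 (not_le.2 (mul_pos (abs_pos.2 hs) (not_le.1 hcon)))
    exact norm_eq_zero.1 (pow_eq_zero_iff two_ne_zero |>.1 (le_antisymm h4 (by positivity)))

end TotalEssSelfAdjoint

/-! ### The interaction picture in the spaces of fixed particle number -/

namespace CoupledBath

variable {S F 𝓗 : Type*} [NormedAddCommGroup S] [InnerProductSpace ℂ S]
  [CompleteSpace S] [NormedAddCommGroup F] [InnerProductSpace ℂ F] [NormedAddCommGroup 𝓗]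
  [InnerProductSpace ℂ 𝓗] [CompleteSpace 𝓗] (M : CoupledBath S F 𝓗)

/-- The component of `-i (H ⊗ I_B + i L ⊗ a(g)^* - i L^* ⊗ a(g))` with values in the `n`-particle
space. -/
def drift (H L : S →L[ℂ] S) (g : F) (n : ℕ) : 𝓗 →L[ℂ] 𝓗 :=
  -Complex.I • (M.amp H).comp (M.proj n) + (M.amp L).comp (M.raise g n) -
    (M.amp (ContinuousLinearMap.adjoint L)).comp (M.ann g n)

theorem drift_apply (H L : S →L[ℂ] S) (g : F) (n : ℕ) (x : 𝓗) :
    M.drift H L g n x = -Complex.I • M.amp H (M.proj n x) + M.amp L (M.raise g n x) -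
      M.amp (ContinuousLinearMap.adjoint L) (M.ann g n x) := rfl

theorem ann_cre (f g : F) (n : ℕ) (x : 𝓗) :
    M.ann f n (M.cre g n x) = inner ℂ f g • M.proj n x + M.raise g n (M.low f n x) := by
  cases n with
  | zero => simp [raise, M.ann_cre_zero]
  | succ n => exact M.ann_cre_succ f g n x

theorem low_ann_comm (f g : F) (n : ℕ) (x : 𝓗) :
    M.low g n (M.ann f n x) = M.low f n (M.ann g n x) := by
  cases n with
  | zero => simp [low]
  | succ n => exact M.ann_comm g f n x

theorem amp_low (T : S →L[ℂ] S) (g : F) (n : ℕ) (x : 𝓗) :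
    M.amp T (M.low g n x) = M.low g n (M.amp T x) := by
  cases n with
  | zero => simp [low]
  | succ n => exact M.amp_ann T g n x

theorem inner_proj_amp_ann (T : S →L[ℂ] S) (f : F) (n : ℕ) (u w : 𝓗) :
    inner ℂ (M.proj n u) (M.amp T (M.ann f n w)) = inner ℂ u (M.amp T (M.ann f n w)) := by
  rw [M.inner_proj, ← M.amp_proj, M.proj_ann]

theorem inner_proj_ann (f : F) (n : ℕ) (u w : 𝓗) :
    inner ℂ (M.proj n u) (M.ann f n w) = inner ℂ u (M.ann f n w) := by
  rw [M.inner_proj, M.proj_ann]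

/-- The flux through the boundary between the spaces of `n - 1` and `n` particles. -/
def flux (L : S →L[ℂ] S) (f g : F) (u w : 𝓗) (n : ℕ) : ℂ :=
  inner ℂ u (M.amp (ContinuousLinearMap.adjoint L) (M.low f n (M.ann g n w))) +
    inner ℂ u (M.amp L (M.raise g n (M.low f n w)))

/-- The sector version of "the interaction contributes `⟨f, g⟩ L` to the derivative of `a(f)`". The
`H` terms cancel and the commutation relation yields the main term. Products of two field operators
do not cancel within a sector, but they appear as a difference of consecutive fluxes. -/
theorem inner_drift {H : S →L[ℂ] S} (hH : IsSelfAdjoint H) (L : S →L[ℂ] S) (f g : F) (n : ℕ)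
    (u w : 𝓗) :
    inner ℂ (M.proj n u) (M.ann f n (M.drift H L g (n + 1) w)) +
      inner ℂ (M.drift H L g n u) (M.ann f n (M.proj (n + 1) w)) =
    inner ℂ f g * inner ℂ u (M.amp L (M.proj n w)) +
      (M.flux L f g u w n - M.flux L f g u w (n + 1)) := by
  have hH' : ContinuousLinearMap.adjoint H = H := hH.adjoint_eq
  have h1 : inner ℂ (M.proj n u) (M.ann f n (M.drift H L g (n + 1) w)) =
      -Complex.I * inner ℂ u (M.amp H (M.ann f n w)) +
      inner ℂ u (M.amp L (M.ann f n (M.cre g n w))) -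
      inner ℂ u (M.amp (ContinuousLinearMap.adjoint L) (M.ann f n (M.ann g (n + 1) w))) := by
    rw [M.inner_proj_ann, drift_apply, map_sub, map_add, map_smul, ← M.amp_ann, ← M.amp_ann,
      ← M.amp_ann, M.ann_proj, inner_sub_right, inner_add_right, inner_smul_right]
    rfl
  have h2 : inner ℂ (M.drift H L g n u) (M.ann f n (M.proj (n + 1) w)) =
      Complex.I * inner ℂ u (M.amp H (M.ann f n w)) +
      inner ℂ u (M.amp (ContinuousLinearMap.adjoint L) (M.low g n (M.ann f n w))) -
      inner ℂ u (M.amp L (M.cre g n (M.ann f n w))) := by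
    rw [M.ann_proj, drift_apply, inner_sub_left, inner_add_left, inner_smul_left,
      M.inner_amp_left H, hH', M.inner_proj_amp_ann, M.inner_amp_left L, ← M.inner_low, ← M.amp_low,
      M.inner_amp_left (ContinuousLinearMap.adjoint L), ContinuousLinearMap.adjoint_adjoint,
      M.inner_ann_left, ← M.amp_cre]
    simp
  have h3 : M.flux L f g u w (n + 1) =
      inner ℂ u (M.amp (ContinuousLinearMap.adjoint L) (M.ann f n (M.ann g (n + 1) w))) +
      inner ℂ u (M.amp L (M.cre g n (M.ann f n w))) := rfl
  rw [h1, h2, h3, flux, M.ann_cre, M.low_ann_comm f g, map_add, map_smul, inner_add_right,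
    inner_smul_right]
  ring

theorem flux_zero (L : S →L[ℂ] S) (f g : F) (u w : 𝓗) : M.flux L f g u w 0 = 0 := by
  simp [flux, low]

/-- Two field operators cost `√(m + 1) √(m + 2)` or `√(m + 1)²`, both at most `2 (m + 1)`: linear
growth, as the harmonic-series argument requires. -/
theorem norm_flux_succ_le (L : S →L[ℂ] S) (f g : F) (u w : 𝓗) (m : ℕ) :
    ‖M.flux L f g u w (m + 1)‖ ≤ ((m : ℝ) + 1) *
      (2 * ‖M.amp (ContinuousLinearMap.adjoint L)‖ * ‖f‖ * ‖g‖ *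
        (‖M.proj (m + 0) u‖ * ‖M.proj (m + 2) w‖ + ‖M.proj (m + 1) u‖ * ‖M.proj (m + 1) w‖)) := by
  have hm : (0 : ℝ) ≤ m := Nat.cast_nonneg m
  set A := ‖M.amp (ContinuousLinearMap.adjoint L)‖ with hA
  have h1 : ‖inner ℂ u (M.amp (ContinuousLinearMap.adjoint L)
      (M.ann f m (M.ann g (m + 1) w)))‖ ≤
      ‖M.proj m u‖ * (A * (Real.sqrt (m + 1) * ‖f‖ *
        (Real.sqrt ((m + 1 : ℕ) + 1) * ‖g‖ * ‖M.proj (m + 2) w‖))) := by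
    rw [← M.inner_proj_amp_ann]
    refine (norm_inner_le_norm _ _).trans ?_
    gcongr
    refine ((M.amp _).le_opNorm _).trans ?_
    gcongr
    refine (M.norm_ann_le f m _).trans ?_
    gcongr
    exact M.norm_ann_le_proj g (m + 1) w
  have h2 : ‖inner ℂ u (M.amp L (M.cre g m (M.ann f m w)))‖ ≤
      (A * (Real.sqrt (m + 1) * ‖g‖ * ‖M.proj (m + 1) u‖)) *
        (Real.sqrt (m + 1) * ‖f‖ * ‖M.proj (m + 1) w‖) := by
    rw [M.inner_amp, M.inner_cre, ← M.amp_ann]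
    refine (norm_inner_le_norm _ _).trans ?_
    gcongr
    · refine ((M.amp _).le_opNorm _).trans ?_
      gcongr
      exact M.norm_ann_le_proj g m u
    · exact M.norm_ann_le_proj f m w
  have h3 : Real.sqrt ((m : ℝ) + 1) * Real.sqrt ((m + 1 : ℕ) + 1) ≤ 2 * ((m : ℝ) + 1) := by
    rw [← Real.sqrt_mul (by positivity)]
    refine Real.sqrt_le_iff.2 ⟨by positivity, ?_⟩
    push_cast
    nlinarith
  have h4 : Real.sqrt ((m : ℝ) + 1) * Real.sqrt ((m : ℝ) + 1) ≤ 2 * ((m : ℝ) + 1) := by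
    rw [Real.mul_self_sqrt (by positivity)]
    linarith
  refine (norm_add_le _ _).trans ((add_le_add h1 h2).trans ?_)
  calc _ = (Real.sqrt ((m : ℝ) + 1) * Real.sqrt ((m + 1 : ℕ) + 1)) *
          (A * ‖f‖ * ‖g‖ * (‖M.proj m u‖ * ‖M.proj (m + 2) w‖)) +
        (Real.sqrt ((m : ℝ) + 1) * Real.sqrt ((m : ℝ) + 1)) *
          (A * ‖f‖ * ‖g‖ * (‖M.proj (m + 1) u‖ * ‖M.proj (m + 1) w‖)) := by ring
    _ ≤ (2 * ((m : ℝ) + 1)) * (A * ‖f‖ * ‖g‖ * (‖M.proj m u‖ * ‖M.proj (m + 2) w‖)) +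
        (2 * ((m : ℝ) + 1)) *
          (A * ‖f‖ * ‖g‖ * (‖M.proj (m + 1) u‖ * ‖M.proj (m + 1) w‖)) := by
        gcongr
    _ = _ := by rw [add_zero]; ring

/-- The sector-wise commutator of an observable with the total Hamiltonian. -/
theorem commutator_sector {H : S →L[ℂ] S} (hH : IsSelfAdjoint H) (L X : S →L[ℂ] S) (g : F) (n : ℕ)
    {w z y : 𝓗} (hy : y = z - Complex.I • M.drift H L g n w)
    (hX : inner ℂ y (M.amp X (M.proj n w)) = inner ℂ (M.proj n w) (M.amp X y)) :
    Complex.I * (inner ℂ z (M.amp X (M.proj n w)) - inner ℂ (M.proj n w) (M.amp X z)) =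
      inner ℂ w (M.amp ((1 / Complex.I) • ⁅X, H⁆) (M.proj n w)) +
      inner ℂ w (M.amp ⁅ContinuousLinearMap.adjoint L, X⁆ (M.ann g n w)) +
      inner ℂ (M.ann g n w) (M.amp ⁅X, L⁆ w) +
      ((inner ℂ w (M.amp (ContinuousLinearMap.adjoint L * X) (M.low g n w)) +
          inner ℂ (M.low g n w) (M.amp (X * L) w)) -
        (inner ℂ w (M.amp (ContinuousLinearMap.adjoint L * X) (M.ann g n w)) +
          inner ℂ (M.ann g n w) (M.amp (X * L) w))) := by
  have hH' : ContinuousLinearMap.adjoint H = H := hH.adjoint_eq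
  have hz : z = y + Complex.I • M.drift H L g n w := by
    rw [hy, sub_add_cancel]
  have hII : Complex.I * Complex.I = -1 := Complex.I_mul_I
  have hmul : ∀ (A B : S →L[ℂ] S) (x : 𝓗), M.amp (A * B) x = M.amp A (M.amp B x) := by
    intro A B x; rw [map_mul]; rfl
  have e1 : inner ℂ (M.drift H L g n w) (M.amp X (M.proj n w)) =
      Complex.I * inner ℂ w (M.amp H (M.amp X (M.proj n w))) +
      inner ℂ w (M.amp (ContinuousLinearMap.adjoint L) (M.amp X (M.low g n w))) -
      inner ℂ (M.ann g n w) (M.amp L (M.amp X w)) := by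
    have h1 : inner ℂ (M.amp H (M.proj n w)) (M.amp X (M.proj n w)) =
        inner ℂ w (M.amp H (M.amp X (M.proj n w))) := by
      rw [M.inner_amp_left H, hH', M.inner_proj, ← M.amp_proj, ← M.amp_proj, M.proj_proj]
    have h2 : inner ℂ (M.amp L (M.raise g n w)) (M.amp X (M.proj n w)) =
        inner ℂ w (M.amp (ContinuousLinearMap.adjoint L) (M.amp X (M.low g n w))) := by
      rw [M.inner_amp_left L, ← M.inner_low, ← M.amp_low, ← M.amp_low, M.low_proj]
    have h3 : inner ℂ (M.amp (ContinuousLinearMap.adjoint L) (M.ann g n w))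
        (M.amp X (M.proj n w)) = inner ℂ (M.ann g n w) (M.amp L (M.amp X w)) := by
      rw [M.inner_amp_left, ContinuousLinearMap.adjoint_adjoint, M.amp_proj, M.amp_proj,
        ← M.inner_proj, M.proj_ann]
    rw [drift_apply, inner_sub_left, inner_add_left, inner_smul_left, h1, h2, h3]
    simp
  have e2 : inner ℂ (M.proj n w) (M.amp X (M.drift H L g n w)) =
      -Complex.I * inner ℂ w (M.amp X (M.amp H (M.proj n w))) +
      inner ℂ (M.low g n w) (M.amp X (M.amp L w)) -
      inner ℂ w (M.amp X (M.amp (ContinuousLinearMap.adjoint L) (M.ann g n w))) := by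
    rw [drift_apply, map_sub, map_add, map_smul, inner_sub_right, inner_add_right,
      inner_smul_right, M.amp_raise, M.amp_raise, M.inner_raise, M.low_proj]
    congr 1
    · congr 2
      rw [M.inner_proj, ← M.amp_proj, ← M.amp_proj, M.proj_proj]
    · rw [M.inner_proj, ← M.amp_proj, ← M.amp_proj, M.proj_ann]
  -- By `hX` the free part `y` drops out, so only bounded operators remain to be commuted.
  have e3 : inner ℂ z (M.amp X (M.proj n w)) - inner ℂ (M.proj n w) (M.amp X z) =
      -Complex.I * (inner ℂ (M.drift H L g n w) (M.amp X (M.proj n w)) +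
        inner ℂ (M.proj n w) (M.amp X (M.drift H L g n w))) := by
    rw [hz, map_add, map_smul, inner_add_left, inner_add_right, inner_smul_left, inner_smul_right,
      hX, Complex.conj_I]
    ring
  have e4 : ∀ x, M.amp ((1 / Complex.I) • ⁅X, H⁆) x =
      -Complex.I • (M.amp X (M.amp H x) - M.amp H (M.amp X x)) := by
    intro x
    rw [map_smul, Ring.lie_def, map_sub, one_div, Complex.inv_I, ← hmul, ← hmul]
    rfl
  have e5 : ∀ (A B : S →L[ℂ] S) x, M.amp ⁅A, B⁆ x = M.amp A (M.amp B x) - M.amp B (M.amp A x) := by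
    intro A B x
    rw [Ring.lie_def, map_sub, ← hmul, ← hmul]
    rfl
  -- The products `L* X` and `X L` occur with `low`, the products in the other order with `ann`.
  -- Completing the commutators leaves the difference between `low g n` and `ann g n = low g (n +
  -- 1)`, which telescopes.
  rw [e3, e1, e2, e4, e5, e5, hmul, hmul, hmul, inner_smul_right, inner_sub_right, inner_sub_right,
    inner_sub_right]
  linear_combination (-(Complex.I * inner ℂ w (M.amp H (M.amp X (M.proj n w))) +
      inner ℂ w (M.amp (ContinuousLinearMap.adjoint L) (M.amp X (M.low g n w))) -
      inner ℂ (M.ann g n w) (M.amp L (M.amp X w)) +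
      (-Complex.I * inner ℂ w (M.amp X (M.amp H (M.proj n w))) +
      inner ℂ (M.low g n w) (M.amp X (M.amp L w)) -
      inner ℂ w (M.amp X (M.amp (ContinuousLinearMap.adjoint L) (M.ann g n w)))))) * hII

end CoupledBath

/-! ### Duhamel formula for the annihilation operator in the Heisenberg picture. -/

section Ehrenfest

open Filter Topology MeasureTheory

variable {S F 𝓗 : Type*} [NormedAddCommGroup S] [InnerProductSpace ℂ S]
  [CompleteSpace S] [NormedAddCommGroup F] [InnerProductSpace ℂ F] [NormedAddCommGroup 𝓗]
  [InnerProductSpace ℂ 𝓗] [CompleteSpace 𝓗]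

/-- `W` is the evolution of the system coupled to the bath, where `V` is the evolution of one
particle of the bath and `G` is the free evolution. -/
structure IsCoupledEvolution (M : CoupledBath S F 𝓗) (H L : S →L[ℂ] S) (g : F)
    (V : ℝ → F →L[ℂ] F) (G W : ℝ → 𝓗 →L[ℂ] 𝓗) : Prop where
  isFlow_particle : IsFlow V
  isFlow_free : IsFlow G
  isFlow_total : IsFlow W
  isSelfAdjoint : IsSelfAdjoint H
  free_amp : ∀ t T x, G t (M.amp T x) = M.amp T (G t x)
  free_ann : ∀ t f n x, G t (M.ann f n x) = M.ann (V t f) n (G t x)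
  proj_mem : ∀ p ∈ genGraph W, ∀ n,
    (M.proj n p.1, M.proj n p.2 - Complex.I • M.drift H L g n p.1) ∈ genGraph G
  dense : Dense {x | ∃ y, (x, y) ∈ genGraph W}

namespace IsCoupledEvolution

variable {M : CoupledBath S F 𝓗} {H L : S →L[ℂ] S} {g : F}
  {V : ℝ → F →L[ℂ] F} {G W : ℝ → 𝓗 →L[ℂ] 𝓗} (hW : IsCoupledEvolution M H L g V G W)
include hW

/-- By `proj_mem` the unbounded free parts coming from `W` and from `G(-τ)` cancel, leaving the
bounded drift. -/
theorem hasDerivAt_proj_of_mem {p : 𝓗 × 𝓗} (hp : p ∈ genGraph W) (n : ℕ) (τ : ℝ) :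
    HasDerivAt (fun τ => G (-τ) (M.proj n (W τ p.1)))
      (G (-τ) (M.drift H L g n (W τ p.1))) τ := by
  have h1 := hW.isFlow_total.hasDerivAt hp τ
  have h2 := ((M.proj n).restrictScalars ℝ).hasFDerivAt.comp_hasDerivAt τ h1
  have h3 := mem_genGraph_neg (hW.proj_mem _ (hW.isFlow_total.genGraph_invariant hp τ) n)
  refine (hW.isFlow_free.neg.hasDerivAt_apply h2 h3).congr_deriv ?_
  simp only [ContinuousLinearMap.coe_restrictScalars', map_smul, map_neg, map_sub, smul_neg,
    smul_sub, smul_smul, neg_smul]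
  simp

/-- Since the drift is bounded, the derivatives converge uniformly when `η` is approximated from the
domain. General `η` is essential: the Ehrenfest equation uses vectors `W(-t) T W(t) Ω`, with no
control of their domain. -/
theorem hasDerivAt_proj (η : 𝓗) (n : ℕ) (τ : ℝ) :
    HasDerivAt (fun τ => G (-τ) (M.proj n (W τ η))) (G (-τ) (M.drift H L g n (W τ η))) τ := by
  obtain ⟨u, hu, hlim⟩ := mem_closure_iff_seq_limit.1 (hW.dense η)
  refine hasDerivAt_of_tendstoUniformly (l := atTop)
    (f := fun k τ => G (-τ) (M.proj n (W τ (u k))))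
    (f' := fun k τ => G (-τ) (M.drift H L g n (W τ (u k))))
    (g' := fun τ => G (-τ) (M.drift H L g n (W τ η))) ?_
    (Eventually.of_forall fun k τ => ?_) (fun τ => ?_) τ
  · rw [Metric.tendstoUniformly_iff]
    intro ε hε
    have h1 : Tendsto (fun k => ‖M.drift H L g n‖ * ‖η - u k‖) atTop (𝓝 0) := by
      have h2 := (tendsto_const_nhds (x := η)).sub hlim
      rw [sub_self] at h2
      simpa using h2.norm.const_mul ‖M.drift H L g n‖
    filter_upwards [h1.eventually (gt_mem_nhds hε)] with k hk τ
    rw [dist_eq_norm, ← map_sub, ← map_sub, ← map_sub, hW.isFlow_free.norm_map]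
    refine lt_of_le_of_lt ((M.drift H L g n).le_opNorm _) ?_
    rwa [hW.isFlow_total.norm_map]
  · obtain ⟨y, hy⟩ := hu k
    exact hW.hasDerivAt_proj_of_mem hy n τ
  · exact (((G (-τ)).comp ((M.proj n).comp (W τ))).continuous.tendsto η).comp hlim

/-- Covariance under the free flow: a fixed `a(f)` between interaction-picture vectors is `a(V_τ f)`
between Schrödinger-picture ones. -/
theorem inner_free_ann (f : F) (n : ℕ) (τ : ℝ) (x y : 𝓗) :
    inner ℂ (G (-τ) x) (M.ann f n (G (-τ) y)) = inner ℂ x (M.ann (V τ f) n y) := by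
  have h1 := hW.free_ann (-τ) (V τ f) n y
  rw [hW.isFlow_particle.neg_apply] at h1
  rw [← h1, hW.isFlow_free.inner_map]

theorem hasDerivAt_inner_ann (f : F) (n : ℕ) (η Ω : 𝓗) (τ : ℝ) :
    HasDerivAt (fun τ => inner ℂ (M.proj n (W τ η)) (M.ann (V τ f) n (M.proj (n + 1) (W τ Ω))))
      (inner ℂ (M.proj n (W τ η)) (M.ann (V τ f) n (M.drift H L g (n + 1) (W τ Ω))) +
        inner ℂ (M.drift H L g n (W τ η)) (M.ann (V τ f) n (M.proj (n + 1) (W τ Ω)))) τ := by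
  have h1 := hW.hasDerivAt_proj η n τ
  have h2 := ((M.ann f n).restrictScalars ℝ).hasFDerivAt.comp_hasDerivAt τ
    (hW.hasDerivAt_proj Ω (n + 1) τ)
  have h3 := HasDerivAt.inner ℂ h1 h2
  simp only [Function.comp_apply, ContinuousLinearMap.coe_restrictScalars',
    hW.inner_free_ann] at h3
  exact h3

theorem continuous_inner_ann (f : F) (n : ℕ) (T T' : 𝓗 →L[ℂ] 𝓗) (η Ω : 𝓗) :
    Continuous fun τ => inner ℂ (T (W τ η)) (M.ann (V τ f) n (T' (W τ Ω))) := by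
  simp only [← hW.inner_free_ann]
  have h : ∀ (T : 𝓗 →L[ℂ] 𝓗) (η : 𝓗), Continuous fun τ => G (-τ) (T (W τ η)) := fun T η =>
    hW.isFlow_free.continuous_apply continuous_neg
      (T.continuous.comp (hW.isFlow_total.strongly_continuous η))
  exact (h T η).inner ((M.ann f n).continuous.comp (h T' Ω))

/-- The Duhamel formula for the annihilation operator in the Heisenberg picture, truncated at a
finite particle number. -/
theorem norm_sum_inner_ann_sub_integral_le (f : F) (η : 𝓗) {Ω : 𝓗}
    (hΩ : ∀ f n, M.ann f n Ω = 0) (t : ℝ) (m : ℕ) :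
    ‖∑ n ∈ Finset.range (m + 1), inner ℂ (W t η) (M.ann (V t f) n (W t Ω)) -
        ∫ τ in (0 : ℝ)..t, inner ℂ (V τ f) g *
          ∑ n ∈ Finset.range (m + 1), inner ℂ (W τ η) (M.amp L (M.proj n (W τ Ω)))‖ ≤
      ((m : ℝ) + 1) * (2 * ‖M.amp (ContinuousLinearMap.adjoint L)‖ * ‖f‖ * ‖g‖ *
        ∫ τ in Set.uIoc 0 t, (‖M.proj (m + 0) (W τ η)‖ * ‖M.proj (m + 2) (W τ Ω)‖ +
          ‖M.proj (m + 1) (W τ η)‖ * ‖M.proj (m + 1) (W τ Ω)‖)) := by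
  set D : ℝ → ℂ := fun τ => ∑ n ∈ Finset.range (m + 1),
    (inner ℂ (M.proj n (W τ η)) (M.ann (V τ f) n (M.drift H L g (n + 1) (W τ Ω))) +
        inner ℂ (M.drift H L g n (W τ η)) (M.ann (V τ f) n (M.proj (n + 1) (W τ Ω)))) with hD
  set K : ℝ → ℂ := fun τ => inner ℂ (V τ f) g *
          ∑ n ∈ Finset.range (m + 1), inner ℂ (W τ η) (M.amp L (M.proj n (W τ Ω))) with hK
  have hcW : ∀ x, Continuous fun τ => W τ x := hW.isFlow_total.strongly_continuous
  have hDc : Continuous D := continuous_finsetSum _ fun n _ =>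
    (hW.continuous_inner_ann f n (M.proj n) (M.drift H L g (n + 1)) η Ω).add
      (hW.continuous_inner_ann f n (M.drift H L g n) (M.proj (n + 1)) η Ω)
  have hKc : Continuous K :=
    ((hW.isFlow_particle.strongly_continuous f).inner continuous_const).mul
      (continuous_finsetSum _ fun n _ => (hcW η).inner
        ((M.amp L).continuous.comp ((M.proj n).continuous.comp (hcW Ω))))
  -- The fluxes telescope; the lower boundary contributes nothing since `flux` vanishes at `0`.
  have hDK : ∀ τ, D τ = K τ - M.flux L (V τ f) g (W τ η) (W τ Ω) (m + 1) := by
    intro τ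
    simp only [hD, hK, M.inner_drift hW.isSelfAdjoint]
    rw [Finset.sum_add_distrib, Finset.sum_range_sub', M.flux_zero, zero_sub, ← Finset.mul_sum]
    rfl
  -- The boundary value at time `0` disappears because `Ω` is annihilated.
  have hFTC : ∫ τ in (0 : ℝ)..t, D τ =
      ∑ n ∈ Finset.range (m + 1), inner ℂ (W t η) (M.ann (V t f) n (W t Ω)) := by
    rw [intervalIntegral.integral_eq_sub_of_hasDerivAt (f := fun τ => ∑ n ∈ Finset.range (m + 1),
      inner ℂ (M.proj n (W τ η)) (M.ann (V τ f) n (M.proj (n + 1) (W τ Ω))))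
      (fun τ _ => HasDerivAt.fun_sum fun n _ => hW.hasDerivAt_inner_ann f n η Ω τ)
      (hDc.intervalIntegrable _ _)]
    simp only [M.ann_proj, M.inner_proj_ann, hW.isFlow_total.map_zero, one_apply_eq_self, hΩ,
      inner_zero_right, Finset.sum_const_zero, sub_zero]
  rw [← hFTC, ← intervalIntegral.integral_sub (hDc.intervalIntegrable _ _)
    (hKc.intervalIntegrable _ _)]
  refine intervalIntegral.norm_integral_le_integral_norm_uIoc.trans ?_
  rw [← integral_const_mul, ← integral_const_mul]
  have hcont : Continuous fun τ => (‖M.proj (m + 0) (W τ η)‖ * ‖M.proj (m + 2) (W τ Ω)‖ +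
      ‖M.proj (m + 1) (W τ η)‖ * ‖M.proj (m + 1) (W τ Ω)‖) := by
    have h : ∀ k x, Continuous fun τ => ‖M.proj k (W τ x)‖ := fun k x =>
      ((M.proj k).continuous.comp (hcW x)).norm
    exact ((h _ _).mul (h _ _)).add ((h _ _).mul (h _ _))
  refine setIntegral_mono ((hDc.sub hKc).norm.integrableOn_uIoc)
    ((hcont.const_mul _).const_mul _).integrableOn_uIoc fun τ => ?_
  change ‖D τ - K τ‖ ≤ _
  rw [hDK, sub_sub_cancel_left, norm_neg]
  refine (M.norm_flux_succ_le L (V τ f) g (W τ η) (W τ Ω) m).trans (le_of_eq ?_)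
  rw [hW.isFlow_particle.norm_map]

/-- Finite sums are taken inside the integral, where Cauchy–Schwarz over the sectors bounds them
uniformly in time by `‖η‖ ‖Ω‖`. -/
theorem summable_integral (η Ω : 𝓗) (t : ℝ) (i j : ℕ) :
    Summable fun m : ℕ => ∫ τ in Set.uIoc 0 t,
      ‖M.proj (m + i) (W τ η)‖ * ‖M.proj (m + j) (W τ Ω)‖ := by
  have hc : ∀ m : ℕ, Continuous fun τ => ‖M.proj (m + i) (W τ η)‖ * ‖M.proj (m + j) (W τ Ω)‖ :=
    fun m => ((M.proj _).continuous.comp (hW.isFlow_total.strongly_continuous η)).norm.mul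
      ((M.proj _).continuous.comp (hW.isFlow_total.strongly_continuous Ω)).norm
  refine summable_of_sum_range_le (c := ∫ τ in Set.uIoc 0 t, ‖η‖ * ‖Ω‖)
    (fun m => integral_nonneg fun τ => by positivity) fun m => ?_
  rw [← integral_finsetSum _ fun k _ => (hc k).integrableOn_uIoc]
  refine setIntegral_mono
    (continuous_finsetSum _ fun k _ => hc k).integrableOn_uIoc
    continuous_const.integrableOn_uIoc fun τ => ?_
  refine (M.sum_norm_proj_mul_le m i j _ _).trans (le_of_eq ?_)
  rw [hW.isFlow_total.norm_map, hW.isFlow_total.norm_map]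

theorem exists_summable_bound (f : F) (η : 𝓗) {Ω : 𝓗} (hΩ : ∀ f n, M.ann f n Ω = 0) (t : ℝ) :
    ∃ a : ℕ → ℝ, (∀ m, 0 ≤ a m) ∧ Summable a ∧ ∀ m : ℕ,
      ‖∑ n ∈ Finset.range (m + 1), inner ℂ (W t η) (M.ann (V t f) n (W t Ω)) -
        ∫ τ in (0 : ℝ)..t, inner ℂ (V τ f) g *
          ∑ n ∈ Finset.range (m + 1), inner ℂ (W τ η) (M.amp L (M.proj n (W τ Ω)))‖ ≤
      ((m : ℝ) + 1) * a m := by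
  have hc : ∀ i j : ℕ, Continuous fun τ => ‖M.proj i (W τ η)‖ * ‖M.proj j (W τ Ω)‖ :=
    fun i j => ((M.proj _).continuous.comp (hW.isFlow_total.strongly_continuous η)).norm.mul
      ((M.proj _).continuous.comp (hW.isFlow_total.strongly_continuous Ω)).norm
  refine ⟨_, fun m => ?_, ?_, hW.norm_sum_inner_ann_sub_integral_le f η hΩ t⟩
  · exact mul_nonneg (by positivity) (integral_nonneg fun τ => by positivity)
  · refine Summable.mul_left _ ?_
    refine ((hW.summable_integral η Ω t 0 2).add (hW.summable_integral η Ω t 1 1)).congr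
      fun m => ?_
    exact (integral_add (hc _ _).integrableOn_uIoc (hc _ _).integrableOn_uIoc).symm

/-- Dominated convergence: partial sums of the projections are contractions converging strongly to
the identity. -/
theorem tendsto_integral_sum_proj (f : F) (η Ω : 𝓗) (t : ℝ) :
    Tendsto (fun m => ∫ τ in (0 : ℝ)..t, inner ℂ (V τ f) g *
        ∑ n ∈ Finset.range m, inner ℂ (W τ η) (M.amp L (M.proj n (W τ Ω)))) atTop
      (𝓝 (∫ τ in (0 : ℝ)..t, inner ℂ (V τ f) g * inner ℂ (W τ η) (M.amp L (W τ Ω)))) := by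
  have hcW : ∀ x, Continuous fun τ => W τ x := hW.isFlow_total.strongly_continuous
  have hsum : ∀ m τ, ∑ n ∈ Finset.range m, inner ℂ (W τ η) (M.amp L (M.proj n (W τ Ω))) =
      inner ℂ (W τ η) (M.amp L (∑ n ∈ Finset.range m, M.proj n (W τ Ω))) := by
    intro m τ
    rw [map_sum, inner_sum]
  refine intervalIntegral.tendsto_integral_filter_of_dominated_convergence
    (fun _ => ‖f‖ * ‖g‖ * (‖η‖ * (‖M.amp L‖ * ‖Ω‖))) (Eventually.of_forall fun m => ?_)
    (Eventually.of_forall fun m => Eventually.of_forall fun τ _ => ?_)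
    (continuous_const.intervalIntegrable _ _) (Eventually.of_forall fun τ _ => ?_)
  · refine Continuous.aestronglyMeasurable ?_
    exact ((hW.isFlow_particle.strongly_continuous f).inner continuous_const).mul
      (continuous_finsetSum _ fun n _ => (hcW η).inner
        ((M.amp L).continuous.comp ((M.proj n).continuous.comp (hcW Ω))))
  · rw [hsum, norm_mul]
    refine mul_le_mul ((norm_inner_le_norm _ _).trans (le_of_eq ?_)) ?_ (norm_nonneg _)
      (by positivity)
    · rw [hW.isFlow_particle.norm_map]
    · refine (norm_inner_le_norm _ _).trans ?_
      rw [hW.isFlow_total.norm_map]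
      gcongr
      refine ((M.amp L).le_opNorm _).trans ?_
      gcongr
      refine (M.norm_sum_proj_le m _).trans (le_of_eq (hW.isFlow_total.norm_map _ _))
  · simp only [hsum]
    refine Tendsto.const_mul _ ?_
    exact (((innerSL ℂ (W τ η)).comp (M.amp L)).continuous.tendsto _).comp (M.tendsto_proj (W τ Ω))

end IsCoupledEvolution

end Ehrenfest

/-! ### Removal of the particle-number cutoff and the Ehrenfest equation. -/

section EhrenfestEquation

open Filter Topology MeasureTheory

variable {S F 𝓗 : Type*} [NormedAddCommGroup S] [InnerProductSpace ℂ S]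
  [CompleteSpace S] [NormedAddCommGroup F] [InnerProductSpace ℂ F] [NormedAddCommGroup 𝓗]
  [InnerProductSpace ℂ 𝓗] [CompleteSpace 𝓗]

namespace IsCoupledEvolution

variable {M : CoupledBath S F 𝓗} {H L : S →L[ℂ] S} {g : F}
  {V : ℝ → F →L[ℂ] F} {G W : ℝ → 𝓗 →L[ℂ] 𝓗} (hW : IsCoupledEvolution M H L g V G W)
include hW

theorem commutator_sum (X : S →L[ℂ] S) {p : 𝓗 × 𝓗} (hp : p ∈ genGraph W) (m : ℕ) :
    Complex.I * (∑ n ∈ Finset.range m, inner ℂ p.2 (M.amp X (M.proj n p.1)) -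
        ∑ n ∈ Finset.range m, inner ℂ p.1 (M.amp X (M.proj n p.2))) =
      ∑ n ∈ Finset.range m, inner ℂ p.1 (M.amp ((1 / Complex.I) • ⁅X, H⁆) (M.proj n p.1)) +
      ∑ n ∈ Finset.range m,
        inner ℂ p.1 (M.amp ⁅ContinuousLinearMap.adjoint L, X⁆ (M.ann g n p.1)) +
      ∑ n ∈ Finset.range m, inner ℂ (M.ann g n p.1) (M.amp ⁅X, L⁆ p.1) -
      (inner ℂ p.1 (M.amp (ContinuousLinearMap.adjoint L * X) (M.low g m p.1)) +
          inner ℂ (M.low g m p.1) (M.amp (X * L) p.1)) := by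
  -- `X` commutes with the free flow, hence maps the graph of its generator into itself; symmetry of
  -- that generator is then the hypothesis `hX` of the sector identity.
  have hsector := fun n => M.commutator_sector hW.isSelfAdjoint L X g n rfl
    (hW.isFlow_free.genGraph_symm (hW.proj_mem p hp n)
      (map_mem_genGraph (T := M.amp X) (fun t x => hW.free_amp t X x) (hW.proj_mem p hp n)))
  simp only [M.inner_proj, ← M.amp_proj, M.proj_proj] at hsector
  rw [← Finset.sum_sub_distrib, Finset.mul_sum, Finset.sum_congr rfl fun n _ => hsector n,
    Finset.sum_add_distrib, Finset.sum_add_distrib, Finset.sum_add_distrib]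
  have h3 := Finset.sum_range_sub' (fun n =>
    inner ℂ p.1 (M.amp (ContinuousLinearMap.adjoint L * X) (M.low g n p.1)) +
          inner ℂ (M.low g n p.1) (M.amp (X * L) p.1)) m
  have h0 : inner ℂ p.1 (M.amp (ContinuousLinearMap.adjoint L * X) (M.low g 0 p.1)) +
          inner ℂ (M.low g 0 p.1) (M.amp (X * L) p.1) = 0 := by
    simp [CoupledBath.low]
  rw [h0, zero_sub] at h3
  rw [sub_eq_add_neg, ← h3]
  rfl

/-- The Ehrenfest equation. -/
theorem hasDerivAt_inner (X : S →L[ℂ] S) {p : 𝓗 × 𝓗} (hp : p ∈ genGraph W)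
    (hΩ : ∀ f n, M.ann f n p.1 = 0) (t : ℝ) {η₁ η₂ : 𝓗}
    (hη₁ : W t η₁ = M.amp (ContinuousLinearMap.adjoint ⁅ContinuousLinearMap.adjoint L, X⁆)
      (W t p.1))
    (hη₂ : W t η₂ = M.amp ⁅X, L⁆ (W t p.1)) :
    HasDerivAt (fun s => inner ℂ (W s p.1) (M.amp X (W s p.1)))
      (inner ℂ (W t p.1) (M.amp ((1 / Complex.I) • ⁅X, H⁆) (W t p.1)) +
        (∫ τ in (0 : ℝ)..t, inner ℂ (V τ (V (-t) g)) g *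
          inner ℂ (W τ η₁) (M.amp L (W τ p.1))) +
        conj (∫ τ in (0 : ℝ)..t, inner ℂ (V τ (V (-t) g)) g *
          inner ℂ (W τ η₂) (M.amp L (W τ p.1)))) t := by
  have hq := hW.isFlow_total.genGraph_invariant hp t
  set w := W t p.1 with hw
  set z := W t p.2 with hz
  have hd := hW.isFlow_total.hasDerivAt hp t
  have hd2 := HasDerivAt.inner ℂ hd
    (((M.amp X).restrictScalars ℝ).hasFDerivAt.comp_hasDerivAt t hd)
  refine hd2.congr_deriv ?_
  have hderiv : inner ℂ w (M.amp X (-Complex.I • z)) +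
      inner ℂ (-Complex.I • z) (M.amp X w) =
      Complex.I * (inner ℂ z (M.amp X w) - inner ℂ w (M.amp X z)) := by
    rw [map_smul, inner_smul_right, inner_smul_left, map_neg, Complex.conj_I]
    ring
  refine hderiv.trans ?_
  -- The Duhamel formula is applied with `f = V(-t) g`, so that at the final time it speaks of
  -- `a(g)`. The vectors `η₁`, `η₂` absorb the commutators, and both memory terms become the same
  -- formula, once conjugated.
  have hVf : V t (V (-t) g) = g := hW.isFlow_particle.apply_neg t g
  obtain ⟨a₁, ha₁, hs₁, hb₁⟩ := hW.exists_summable_bound (V (-t) g) η₁ hΩ t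
  obtain ⟨a₂, ha₂, hs₂, hb₂⟩ := hW.exists_summable_bound (V (-t) g) η₂ hΩ t
  rw [hVf, ← hw] at hb₁ hb₂
  set c := ‖M.amp (ContinuousLinearMap.adjoint L * X)‖ * ‖g‖ +
    ‖M.amp (ContinuousLinearMap.adjoint (X * L))‖ * ‖g‖ with hc
  set Y : ℕ → ℂ := fun m =>
    inner ℂ w (M.amp (ContinuousLinearMap.adjoint L * X) (M.low g m w)) +
      inner ℂ (M.low g m w) (M.amp (X * L) w) with hY
  have hYb : ∀ m : ℕ, ‖Y (m + 1)‖ ≤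
      ((m : ℝ) + 1) * (c * (‖M.proj (m + 0) w‖ * ‖M.proj (m + 1) w‖)) := by
    intro m
    have h1 := M.norm_inner_amp_ann_le (ContinuousLinearMap.adjoint L * X) g m w w
    have h2 := M.norm_inner_amp_ann_le (ContinuousLinearMap.adjoint (X * L)) g m w w
    rw [← M.inner_amp_left, norm_inner_symm] at h2
    refine (norm_add_le _ _).trans ((add_le_add h1 h2).trans (le_of_eq ?_))
    rw [hc, add_zero]
    ring
  -- Adding the two Duhamel bounds and the commutator bound produces one subsequence along which all
  -- three errors vanish.
  obtain ⟨φ, hφ, hlim⟩ := exists_tendsto_mul_of_summable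
    (a := fun m => a₁ m + a₂ m + c * (‖M.proj (m + 0) w‖ * ‖M.proj (m + 1) w‖))
    (fun m => add_nonneg (add_nonneg (ha₁ m) (ha₂ m)) (by positivity))
    ((hs₁.add hs₂).add ((M.summable_norm_proj_mul 0 1 w w).mul_left c))
  have hφ1 : Tendsto (fun k => φ k + 1) atTop atTop := (tendsto_add_atTop_nat 1).comp hφ
  have hnn : ∀ m : ℕ, 0 ≤ c * (‖M.proj (m + 0) w‖ * ‖M.proj (m + 1) w‖) :=
    fun m => by positivity
  have hsmall : ∀ e : ℕ → ℂ, (∀ m : ℕ, ‖e m‖ ≤ ((m : ℝ) + 1) *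
      (a₁ m + a₂ m + c * (‖M.proj (m + 0) w‖ * ‖M.proj (m + 1) w‖))) →
      Tendsto (fun k => e (φ k)) atTop (𝓝 0) := fun e he =>
    squeeze_zero_norm (fun k => he (φ k)) hlim
  have he₁ := hsmall _ fun m => (hb₁ m).trans (mul_le_mul_of_nonneg_left
    (by linarith [ha₂ m, hnn m]) (by positivity))
  have he₂ := hsmall _ fun m => (hb₂ m).trans (mul_le_mul_of_nonneg_left
    (by linarith [ha₁ m, hnn m]) (by positivity))
  have heY := hsmall _ fun m => (hYb m).trans (mul_le_mul_of_nonneg_left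
    (by linarith [ha₁ m, ha₂ m]) (by positivity))
  have hI : ∀ η, Tendsto (fun k => ∫ τ in (0 : ℝ)..t, inner ℂ (V τ (V (-t) g)) g *
      ∑ n ∈ Finset.range (φ k + 1), inner ℂ (W τ η) (M.amp L (M.proj n (W τ p.1)))) atTop
      (𝓝 (∫ τ in (0 : ℝ)..t, inner ℂ (V τ (V (-t) g)) g *
        inner ℂ (W τ η) (M.amp L (W τ p.1)))) := fun η =>
    (hW.tendsto_integral_sum_proj (V (-t) g) η p.1 t).comp hφ1
  have hamp : ∀ (T : S →L[ℂ] S) (x y : 𝓗), Tendsto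
      (fun k => ∑ n ∈ Finset.range (φ k + 1), inner ℂ x (M.amp T (M.proj n y))) atTop
      (𝓝 (inner ℂ x (M.amp T y))) := by
    intro T x y
    simp only [M.inner_amp]
    exact (M.tendsto_inner_sum_proj _ y).comp hφ1
  have hl := ((hamp X z w).sub (hamp X w z)).const_mul Complex.I
  -- The truncated sums containing `a(g)` are not known to converge as `m` grows; along `φ` their
  -- limits are supplied by the Duhamel integrals.
  refine tendsto_nhds_unique hl ?_
  have hr := (((hamp ((1 / Complex.I) • ⁅X, H⁆) w w).add (he₁.add (hI η₁))).add
    ((Complex.continuous_conj.tendsto _).comp (he₂.add (hI η₂)))).sub heY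
  simp only [zero_add, sub_zero] at hr
  refine hr.congr fun k => ?_
  have hk := hW.commutator_sum X hq (φ k + 1)
  refine Eq.trans ?_ hk.symm
  simp only [sub_add_cancel, Function.comp_apply, map_sum, inner_conj_symm, hη₁, hη₂,
    ← M.inner_amp]
  rfl

end IsCoupledEvolution

end EhrenfestEquation

/-! ### The total Hamiltonian -/

section Total

open Filter Topology

variable {S F : Type*} [NormedAddCommGroup S] [InnerProductSpace ℂ S] [CompleteSpace S]
  [NormedAddCommGroup F] [InnerProductSpace ℂ F]

/-- The pairs spanning the graph of the total Hamiltonian. -/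
def totalCore (H L : S →L[ℂ] S) (h : F →ₗ.[ℂ] F) (g : F) :
    Submodule ℂ (SysBath S F × SysBath S F) :=
  Submodule.span ℂ {p : SysBath S F × SysBath S F | ∃ (x : S) (ψ η α β : Fock F),
      (ψ, η) ∈ (dGamma h).graph ∧ (ψ, α) ∈ (creation g).graph ∧ (ψ, β) ∈ (annihilation g).graph ∧
      p = (tens x ψ, tens (H x) ψ + tens x η + Complex.I • tens (L x) α
        - Complex.I • tens (ContinuousLinearMap.adjoint L x) β)}

theorem totalHamiltonian_eq (H L : S →L[ℂ] S) (h : F →ₗ.[ℂ] F) (g : F) :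
    totalHamiltonian H L h g = (totalCore H L h g).topologicalClosure.toLinearPMap := rfl

theorem proj_sysBath (n : ℕ) (x : S) (ψ : Fock F) :
    (sysBath S F).proj n (tens x ψ) = tens x (fockProj F n ψ) := lift_tens _ _ _

theorem ann_sysBath (f : F) (n : ℕ) (x : S) (ψ : Fock F) :
    (sysBath S F).ann f n (tens x ψ) = tens x (annihilationPart f n ψ) := lift_tens _ _ _

theorem cre_sysBath (f : F) (n : ℕ) (x : S) (ψ : Fock F) :
    (sysBath S F).cre f n (tens x ψ) = tens x (creationPart f n ψ) := lift_tens _ _ _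

theorem amp_sysBath (T : S →L[ℂ] S) (x : S) (ψ : Fock F) :
    (sysBath S F).amp T (tens x ψ) = tens (T x) ψ := ampliation_tens _ _ _

theorem raise_sysBath_of_mem {f : F} {ψ α : Fock F} (hα : (ψ, α) ∈ (creation f).graph) (n : ℕ)
    (x : S) : (sysBath S F).raise f n (tens x ψ) = tens x (fockProj F n α) := by
  cases n with
  | zero =>
    rw [fockProj_zero_of_mem_creation_graph hα, ← tensLeft_apply x 0, map_zero]
    rfl
  | succ n =>
    rw [fockProj_of_mem_creation_graph hα]
    exact cre_sysBath f n x ψ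

theorem low_sysBath_symVec (f : F) {n : ℕ} (v : Fin n → F) :
    ∃ β, (symVec v, β) ∈ (annihilation f).graph ∧
      ∀ x : S, (sysBath S F).low f n (tens x (symVec v)) = tens x β := by
  cases n with
  | zero =>
    refine ⟨0, by rw [symVec_zero]; exact vac_mem_annihilation_graph f, fun x => ?_⟩
    rw [← tensLeft_apply x 0, map_zero]
    rfl
  | succ n => exact ⟨_, symVec_mem_annihilation_graph f v, fun x => ann_sysBath f n x _⟩

theorem inner_swap_eq {E : Type*} [NormedAddCommGroup E] [InnerProductSpace ℂ E] {a b c d : E}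
    (h : inner ℂ a b = inner ℂ c d) : inner ℂ b a = inner ℂ d c := by
  rw [← inner_conj_symm, h, inner_conj_symm]

theorem inner_interaction_symm {H : S →L[ℂ] S} (L : S →L[ℂ] S) {x x' : S}
    {ψ η α β ψ' η' α' β' : Fock F}
    (e1 : inner ℂ η ψ' = inner ℂ ψ η') (e2 : inner ℂ ψ β' = inner ℂ α ψ')
    (e3 : inner ℂ β ψ' = inner ℂ ψ α') (e4 : inner ℂ (H x) x' = inner ℂ x (H x')) :
    inner ℂ (tens (H x) ψ + tens x η + Complex.I • tens (L x) α
        - Complex.I • tens (ContinuousLinearMap.adjoint L x) β) (tens x' ψ') =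
      inner ℂ (tens x ψ) (tens (H x') ψ' + tens x' η' + Complex.I • tens (L x') α'
        - Complex.I • tens (ContinuousLinearMap.adjoint L x') β') := by
  rw [inner_sub_left, inner_add_left, inner_add_left, inner_smul_left, inner_smul_left,
    inner_sub_right, inner_add_right, inner_add_right, inner_smul_right, inner_smul_right,
    inner_tens, inner_tens, inner_tens, inner_tens, inner_tens, inner_tens, inner_tens, inner_tens,
    ContinuousLinearMap.adjoint_inner_left, ContinuousLinearMap.adjoint_inner_right, e1, e2, e3,
    e4, Complex.conj_I]
  generalize inner ℂ α ψ' = a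
  generalize inner ℂ ψ α' = b
  generalize inner ℂ (L x) x' = c
  generalize inner ℂ x (L x') = d
  ring

variable {h : F →ₗ.[ℂ] F} {V : ℝ → F →L[ℂ] F} (hV : IsUnitaryGroup h V)
  (hd : Dense (h.domain : Set F)) {H : S →L[ℂ] S} (hH : IsSelfAdjoint H) (L : S →L[ℂ] S) (g : F)
include hV hd

omit [CompleteSpace S] in
/-- The restriction of the free Hamiltonian to the products with symmetrized elementary tensors is
essentially self-adjoint. -/
theorem essSelfAdjoint_span_tens_symVec :
    EssSelfAdjoint (Submodule.span ℂ {q : SysBath S F × SysBath S F |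
      ∃ (x : S) (n : ℕ) (v : Fin n → F) (η : Fock F), (∀ i, v i ∈ h.domain) ∧
        (symVec v, η) ∈ (dGamma h).graph ∧ q = (tens x (symVec v), tens x η)}) := by
  refine (isFlow_bathFlow hV.isFlow).essSelfAdjoint ?_ ?_ ?_
  · refine Submodule.span_le.2 ?_
    rintro _ ⟨x, n, v, η, _, hp, rfl⟩
    exact tens_mem_genGraph hV hd x (p := (symVec v, η)) hp
  · intro ξ hξ
    refine eq_zero_of_inner_tens_symVec hd fun x n v hv => ?_
    obtain ⟨η, hη⟩ := symVec_mem_dGamma_graph hV hd v hv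
    exact hξ (_, _) (Submodule.subset_span ⟨x, n, v, η, hv, hη, rfl⟩)
  · intro p hp t
    refine prod_mem_span ?_ hp
    rintro _ ⟨x, n, v, η, hv, hη, rfl⟩
    refine Submodule.subset_span ⟨x, n, fun i => V t (v i), fockFlow hV.isFlow t η, fun i => ?_,
      ?_, ?_⟩
    · have h1 := LinearPMap.mem_graph h ⟨v i, hv i⟩
      rw [hV.graph_eq] at h1
      have h2 := hV.isFlow.genGraph_invariant h1 t
      rw [← hV.graph_eq] at h2
      exact LinearPMap.mem_domain_of_mem_graph h2
    · rw [dGamma_graph hV hd] at hη ⊢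
      rw [← fockFlow_symVec hV.isFlow]
      exact (isFlow_fockFlow hV.isFlow).genGraph_invariant hη t
    · rw [← fockFlow_symVec hV.isFlow, bathFlow_tens, bathFlow_tens]

/-- In each sector the total Hamiltonian is the free one plus `i` times the bounded drift.
Boundedness is what lets this pass from the core to its closure. -/
theorem proj_mem_of_mem_totalCore {p : SysBath S F × SysBath S F} (hp : p ∈ totalCore H L h g)
    (n : ℕ) :
    ((sysBath S F).proj n p.1, (sysBath S F).proj n p.2 -
      Complex.I • (sysBath S F).drift H L g n p.1) ∈ genGraph (bathFlow S hV.isFlow) := by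
  induction hp using Submodule.span_induction with
  | zero =>
    simp only [Prod.fst_zero, Prod.snd_zero, map_zero, smul_zero, sub_zero]
    exact zero_mem _
  | add p q _ _ h1 h2 =>
    convert add_mem h1 h2 using 1
    simp only [Prod.fst_add, Prod.snd_add, map_add, smul_add, Prod.mk_add_mk, add_sub_add_comm]
  | smul c p _ h1 =>
    convert Submodule.smul_mem _ c h1 using 1
    simp only [Prod.smul_fst, Prod.smul_snd, map_smul, Prod.smul_mk, smul_sub, smul_comm c]
  | mem p hp =>
    obtain ⟨x, ψ, η, α, β, hη, hα, hβ, rfl⟩ := hp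
    have h1 : (fockProj F n ψ, fockProj F n η) ∈ (dGamma h).graph := by
      rw [dGamma_graph hV hd] at hη ⊢
      exact map_mem_genGraph (T := fockProj F n)
        (fun t ψ => (fockProj_fockFlow hV.isFlow t ψ).symm) hη
    convert tens_mem_genGraph hV hd x h1 using 2
    · exact proj_sysBath n x ψ
    · change (sysBath S F).proj n (_ - _) - Complex.I • (sysBath S F).drift H L g n (tens x ψ) = _
      rw [CoupledBath.drift_apply, map_sub, map_add, map_add, map_smul, map_smul, proj_sysBath,
        proj_sysBath, proj_sysBath, proj_sysBath, proj_sysBath, ann_sysBath,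
        raise_sysBath_of_mem hα, amp_sysBath, amp_sysBath, amp_sysBath,
        fockProj_of_mem_annihilation_graph hβ, smul_sub, smul_add, smul_smul, mul_neg,
        Complex.I_mul_I, neg_neg, one_smul]
      abel

include hH

/-- The terms `iL ⊗ a(g)*` and `-iL* ⊗ a(g)` are formal adjoints of each other; the creation
operator was defined as an adjoint, so this needs no computation in Fock space. -/
theorem totalCore_symm : ∀ p ∈ totalCore H L h g, ∀ q ∈ totalCore H L h g,
    inner ℂ p.2 q.1 = inner ℂ p.1 q.2 := by
  have hH' : ContinuousLinearMap.adjoint H = H := hH.adjoint_eq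
  intro p hp q hq
  induction hp using Submodule.span_induction with
  | zero => simp
  | add p p' _ _ h1 h2 => rw [Prod.fst_add, Prod.snd_add, inner_add_left, inner_add_left, h1, h2]
  | smul c p _ h1 => rw [Prod.smul_fst, Prod.smul_snd, inner_smul_left, inner_smul_left, h1]
  | mem p hp =>
    induction hq using Submodule.span_induction with
    | zero => simp
    | add q q' _ _ h1 h2 =>
      rw [Prod.fst_add, Prod.snd_add, inner_add_right, inner_add_right, h1, h2]
    | smul c q _ h1 => rw [Prod.smul_fst, Prod.smul_snd, inner_smul_right, inner_smul_right, h1]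
    | mem q hq =>
      obtain ⟨x, ψ, η, α, β, hη, hα, hβ, rfl⟩ := hp
      obtain ⟨x', ψ', η', α', β', hη', hα', hβ', rfl⟩ := hq
      have e1 : inner ℂ η ψ' = inner ℂ ψ η' := by
        rw [dGamma_graph hV hd] at hη hη'
        exact (isFlow_fockFlow hV.isFlow).genGraph_symm (p := (ψ, η)) (q := (ψ', η')) hη hη'
      have e2 : inner ℂ ψ β' = inner ℂ α ψ' := mem_creation_graph.1 hα (ψ', β') hβ'
      have e3 : inner ℂ β ψ' = inner ℂ ψ α' :=
        inner_swap_eq (mem_creation_graph.1 hα' (ψ, β) hβ)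
      have e4 : inner ℂ (H x) x' = inner ℂ x (H x') := by
        have := ContinuousLinearMap.adjoint_inner_right H x x'
        rw [hH'] at this
        exact this.symm
      exact inner_interaction_symm L e1 e2 e3 e4

/-- The total Hamiltonian is essentially self-adjoint on the span of the product vectors. -/
theorem essSelfAdjoint_totalCore : EssSelfAdjoint (totalCore H L h g) := by
  refine essSelfAdjoint_of_interaction (sysBath S F) (L := L) hH g (G := bathFlow S hV.isFlow)
    (fun t n x => ?_) (essSelfAdjoint_span_tens_symVec hV hd) (totalCore_symm hV hd hH L g) ?_
  · change lift S _ (lift S _ x) = lift S _ (lift S _ x)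
    rw [lift_lift, lift_lift]
    congr 2
    exact ContinuousLinearMap.ext fun ψ => (fockProj_fockFlow hV.isFlow t ψ).symm
  · rintro _ ⟨x, n, v, η, hv, hη, rfl⟩
    refine ⟨tens_mem_genGraph hV hd x (p := (symVec v, η)) hη, n, ?_, ?_⟩
    · change (sysBath S F).proj n (tens x (symVec v)) = tens x (symVec v)
      rw [proj_sysBath, fockProj_symVec]
    · obtain ⟨β, hβ, hlow⟩ := low_sysBath_symVec (S := S) g v
      refine Submodule.subset_span ⟨x, symVec v, η, creationPart g n (symVec v), β, hη,
        symVec_mem_creation_graph g v, hβ, ?_⟩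
      rw [hlow, cre_sysBath, amp_sysBath, amp_sysBath, amp_sysBath, add_comm (tens x η)]

theorem isUnitaryGroup_totalHamiltonian :
    IsUnitaryGroup (totalHamiltonian H L h g) (unitaryGroup (totalHamiltonian H L h g)) :=
  unitaryGroup_spec (essSelfAdjoint_totalCore hV hd hH L g).exists_isUnitaryGroup

theorem genGraph_totalHamiltonian :
    genGraph (unitaryGroup (totalHamiltonian H L h g)) =
      (totalCore H L h g).topologicalClosure := by
  rw [← (isUnitaryGroup_totalHamiltonian hV hd hH L g).graph_eq, totalHamiltonian_eq,
    (essSelfAdjoint_totalCore hV hd hH L g).closure.graph_toLinearPMap]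

/-- The evolutions of the system coupled to the Bose field. -/
theorem isCoupledEvolution :
    IsCoupledEvolution (sysBath S F) H L g V (bathFlow S hV.isFlow)
      (unitaryGroup (totalHamiltonian H L h g)) where
  isFlow_particle := hV.isFlow
  isFlow_free := isFlow_bathFlow hV.isFlow
  isFlow_total := (isUnitaryGroup_totalHamiltonian hV hd hH L g).isFlow
  isSelfAdjoint := hH
  free_amp t T x := (ampliation_lift T _ x).symm
  free_ann t f n x := by
    change lift S _ (lift S _ x) = lift S _ (lift S _ x)
    rw [lift_lift, lift_lift]
    congr 2
    exact ContinuousLinearMap.ext fun ψ => fockFlow_annihilationPart hV.isFlow t f ψ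
  proj_mem p hp n := by
    rw [genGraph_totalHamiltonian hV hd hH L g] at hp
    let A : SysBath S F × SysBath S F →L[ℂ] SysBath S F × SysBath S F :=
      (((sysBath S F).proj n).comp (ContinuousLinearMap.fst ℂ _ _)).prod
        (((sysBath S F).proj n).comp (ContinuousLinearMap.snd ℂ _ _) -
          Complex.I • ((sysBath S F).drift H L g n).comp (ContinuousLinearMap.fst ℂ _ _))
    have h1 : (totalCore H L h g).topologicalClosure ≤
        (genGraph (bathFlow S hV.isFlow)).comap A.toLinearMap :=
      Submodule.topologicalClosure_minimal _
        (fun q hq => proj_mem_of_mem_totalCore hV hd L g hq n)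
        ((isFlow_bathFlow hV.isFlow).isClosed_genGraph.preimage A.continuous)
    exact h1 hp
  dense := by
    refine (essSelfAdjoint_totalCore hV hd hH L g).closure.dense_fst.mono ?_
    rintro _ ⟨p, hp, rfl⟩
    exact ⟨p.2, by rw [genGraph_totalHamiltonian hV hd hH L g]; exact hp⟩

/-- The initial vector lies in the domain of the total Hamiltonian, which is what makes its
expectations differentiable. -/
theorem exists_tens_vac_mem (φ : S) :
    ∃ y, (tens φ (vac F), y) ∈ genGraph (unitaryGroup (totalHamiltonian H L h g)) := by
  rw [genGraph_totalHamiltonian hV hd hH L g]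
  obtain ⟨η, hη⟩ := symVec_mem_dGamma_graph hV hd (Fin.elim0 : Fin 0 → F) fun i => i.elim0
  exact ⟨_, Submodule.le_topologicalClosure _ (Submodule.subset_span ⟨φ, vac F, η, _, _, hη,
    symVec_mem_creation_graph g (Fin.elim0 : Fin 0 → F), vac_mem_annihilation_graph g, rfl⟩)⟩

/-- The Heisenberg picture with respect to the total evolution. -/
theorem flow_apply (t : ℝ) (X : S →L[ℂ] S) (ξ : SysBath S F) :
    flow H L h g t X ξ = unitaryGroup (totalHamiltonian H L h g) (-t)
      (ampliation F X (unitaryGroup (totalHamiltonian H L h g) t ξ)) := by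
  have hG := isFlow_bathFlow (S := S) hV.isFlow
  have hW := (isUnitaryGroup_totalHamiltonian hV hd hH L g).isFlow
  have h1 : unitaryGroup (freeHamiltonian S h) = bathFlow S hV.isFlow :=
    (isUnitaryGroup_freeHamiltonian hV hd).1.unitaryGroup_eq (dense_freeHamiltonian_domain hV hd)
  rw [flow, evolution, h1]
  refine ext_inner_left ℂ fun ζ => ?_
  change inner ℂ ζ (ContinuousLinearMap.adjoint (bathFlow S hV.isFlow (-t) *
    unitaryGroup (totalHamiltonian H L h g) t) (ampliation F X (bathFlow S hV.isFlow (-t)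
      (unitaryGroup (totalHamiltonian H L h g) t ξ)))) = _
  rw [ContinuousLinearMap.adjoint_inner_right, hW.inner_neg_right]
  change inner ℂ (bathFlow S hV.isFlow (-t) (unitaryGroup (totalHamiltonian H L h g) t ζ)) _ = _
  -- The free evolution acts on the bath factor only, so it passes through `X ⊗ I` and cancels.
  rw [bathFlow, ampliation_lift]
  exact hG.inner_map (-t) _ _

theorem expect_flow (t : ℝ) (X : S →L[ℂ] S) (φ : S) :
    expect φ (flow H L h g t X) =
      inner ℂ (unitaryGroup (totalHamiltonian H L h g) t (tens φ (vac F)))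
        (ampliation F X (unitaryGroup (totalHamiltonian H L h g) t (tens φ (vac F)))) := by
  rw [expect, flow_apply hV hd hH,
    (isUnitaryGroup_totalHamiltonian hV hd hH L g).isFlow.inner_neg_right]

theorem expect_flow_mul_flow (t τ : ℝ) (X Y : S →L[ℂ] S) (φ : S) :
    expect φ (flow H L h g t X * flow H L h g τ Y) =
      inner ℂ (unitaryGroup (totalHamiltonian H L h g) τ
          (unitaryGroup (totalHamiltonian H L h g) (-t) (ampliation F
            (ContinuousLinearMap.adjoint X)
            (unitaryGroup (totalHamiltonian H L h g) t (tens φ (vac F))))))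
        (ampliation F Y (unitaryGroup (totalHamiltonian H L h g) τ (tens φ (vac F)))) := by
  have hW := (isUnitaryGroup_totalHamiltonian hV hd hH L g).isFlow
  have hamp := (sysBath S F).inner_amp X
  change inner ℂ _ (flow H L h g t X (flow H L h g τ Y _)) = _
  rw [flow_apply hV hd hH, flow_apply hV hd hH, hW.inner_neg_right, ← hW.inner_neg_right τ,
    hW.inner_neg_left t]
  exact hamp _ _

theorem expect_flow_mul_flow_adjoint (t τ : ℝ) (X Y : S →L[ℂ] S) (φ : S) :
    expect φ (flow H L h g τ (ContinuousLinearMap.adjoint Y) * flow H L h g t X) =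
      conj (inner ℂ (unitaryGroup (totalHamiltonian H L h g) τ
          (unitaryGroup (totalHamiltonian H L h g) (-t) (ampliation F X
            (unitaryGroup (totalHamiltonian H L h g) t (tens φ (vac F))))))
        (ampliation F Y (unitaryGroup (totalHamiltonian H L h g) τ (tens φ (vac F))))) := by
  have hW := (isUnitaryGroup_totalHamiltonian hV hd hH L g).isFlow
  have hamp := (sysBath S F).inner_amp_left Y
  change inner ℂ _ (flow H L h g τ (ContinuousLinearMap.adjoint Y) (flow H L h g t X _)) = _
  rw [flow_apply hV hd hH, flow_apply hV hd hH, hW.inner_neg_right, inner_conj_symm]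
  exact (hamp _ _).symm

end Total

end QBath

end

/-! ### The Ehrenfest equation for the concrete model. -/

theorem mainTheorem6 {S F : Type*}
    [NormedAddCommGroup S] [InnerProductSpace ℂ S] [CompleteSpace S]
    [NormedAddCommGroup F] [InnerProductSpace ℂ F] [CompleteSpace F]
    (H L X : S →L[ℂ] S) (hH : IsSelfAdjoint H)
    (h : F →ₗ.[ℂ] F) (hh : IsSelfAdjoint h) (g : F) (φ : S) (t : ℝ) :
    IntervalIntegrable
      (fun τ => QBath.bathKernel h g t τ * QBath.expect φ
        (QBath.flow H L h g t ⁅ContinuousLinearMap.adjoint L, X⁆ * QBath.flow H L h g τ L))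
      MeasureTheory.volume 0 t ∧
    IntervalIntegrable
      (fun τ => conj (QBath.bathKernel h g t τ) * QBath.expect φ
        (QBath.flow H L h g τ (ContinuousLinearMap.adjoint L) * QBath.flow H L h g t ⁅X, L⁆))
      MeasureTheory.volume 0 t ∧
    HasDerivAt (fun s => QBath.expect φ (QBath.flow H L h g s X))
      (QBath.expect φ (QBath.flow H L h g t ((1 / Complex.I) • ⁅X, H⁆))
        + (∫ τ in (0 : ℝ)..t, QBath.bathKernel h g t τ * QBath.expect φ
            (QBath.flow H L h g t ⁅ContinuousLinearMap.adjoint L, X⁆ * QBath.flow H L h g τ L))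
        + ∫ τ in (0 : ℝ)..t, conj (QBath.bathKernel h g t τ) * QBath.expect φ
            (QBath.flow H L h g τ (ContinuousLinearMap.adjoint L) * QBath.flow H L h g t ⁅X, L⁆))
      t := by
  have hV := QBath.isUnitaryGroup_unitaryGroup hh
  have hd := hh.dense_domain
  have hW := QBath.isCoupledEvolution hV hd hH L g
  obtain ⟨y, hy⟩ := QBath.exists_tens_vac_mem hV hd hH L g φ
  -- Moving `V(-τ)` to the left factor turns `K(t, τ)` into the Duhamel kernel for `f = V(-t) g`.
  have hK : ∀ τ, QBath.bathKernel h g t τ =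
      inner ℂ (QBath.unitaryGroup h τ (QBath.unitaryGroup h (-t) g)) g := fun τ =>
    hV.isFlow.inner_neg_right _ _ _
  simp only [QBath.expect_flow_mul_flow_adjoint hV hd hH]
  simp only [QBath.expect_flow_mul_flow hV hd hH, QBath.expect_flow hV hd hH, hK]
  -- Both integrands are of this form, the second after conjugation, so integrability is just
  -- continuity.
  have hcont : ∀ η, Continuous fun τ =>
      inner ℂ (QBath.unitaryGroup h τ (QBath.unitaryGroup h (-t) g)) g *
      inner ℂ (QBath.unitaryGroup (QBath.totalHamiltonian H L h g) τ η)
        (QBath.ampliation F L (QBath.unitaryGroup (QBath.totalHamiltonian H L h g) τ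
          (QBath.tens φ (QBath.vac F)))) := fun η =>
    ((hV.isFlow.strongly_continuous _).inner continuous_const).mul
      ((hW.isFlow_total.strongly_continuous η).inner ((QBath.ampliation F L).continuous.comp
        (hW.isFlow_total.strongly_continuous _)))
  refine ⟨(hcont _).intervalIntegrable _ _, ?_, ?_⟩
  · simp only [← map_mul]
    exact (Complex.continuous_conj.comp (hcont _)).intervalIntegrable _ _
  · have hΩ : ∀ f n, (QBath.sysBath S F).ann f n (QBath.tens φ (QBath.vac F)) = 0 := by
      intro f n
      rw [QBath.ann_sysBath, QBath.vac, QBath.annihilationPart_symVec_of_ne (by omega),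
        ← QBath.tensLeft_apply, map_zero]
    -- The two proofs of `W t (W(-t) y) = y` fix `η₁` and `η₂` by unification as `W(-t)` applied to
    -- the required vectors.
    have key := hW.hasDerivAt_inner X hy hΩ t (hW.isFlow_total.apply_neg t _)
      (hW.isFlow_total.apply_neg t _)
    refine key.congr_deriv ?_
    congr 1
    simp only [← map_mul]
    exact (intervalIntegral.intervalIntegral_conj (𝕜 := ℂ)).symm
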